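/- All graphs are finite and simple, $n=|V(G)|$. An nd-decomposition of $G$ is a partition of $V(G)$ into nonempty classes $P_1,\dots,P_k$ such that each $P_i$ is a clique or an independent set and between any two distinct classes there are either all possible edges or none; the neighborhood diversity $\mathrm{nd}(G)$ is the least possible $k$. For an nd-decomposition with $k=\mathrm{nd}(G)$, the type graph $T(G)$ has vertices $1,\dots,k$, where vertex $i$ has weight $|P_i|$; distinct $i,j$ are adjacent iff all edges between $P_i$ and $P_j$ are present, and there is a loop at $i$ iff $P_i$ is a clique. **Theorem.** (1) There are a single random access machine program and a constant $C$ such that for every graph $G$ with $n\ge 2$ vertices and $k=\mathrm{nd}(G)$, given $T(G)$ (that is, $k$, the $k$ weights, and the $k\times k$ adjacency matrix), the program halts after at most $$C\cdot\bigl(\sqrt{k}\bigr)^{2k}\log_2 n$$ elementary steps and outputs $\chi(G)$ together with a compact description of a proper coloring of $G$ with $\chi(G)$ colors. Here the elementary steps are assignments, memory accesses, comparisons, and the operations $+$, truncated $-$, $\cdot$ and integer division on nonnegative integers; no number computed by the program reaches $(n\,k^{k})^{C}$, i.e. words have $O(\log n+k\log k)$ bits. The compact description is a list of pairs $(S_\ell,m_\ell)$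 with $S_\ell\subseteq\{1,\dots,k\}$ and $m_\ell\in\mathbb{N}$; it is read as a list of $\sum_\ell m_\ell$ colors, where the $\ell$-th block of $m_\ell$ consecutive colors is available exactly to the classes $P_i$ with $i\in S_\ell$. If $P_i$ is a clique, its $r$-th vertex (in a fixed order of $V(G)$) gets the $r$-th color available to $P_i$; otherwise all vertices of $P_i$ get the first color available to $P_i$. (2) For every graph $G$ (with $k=\mathrm{nd}(G)$), let $\mathcal{I}(G)$ be the set of inclusion-maximal independent sets of $T(G)$, loops being disregarded. The optimal value of the integer program $$\min\sum_{I\in\mathcal{I}(G)}x_I\quad\text{s.t.}\quad \sum_{I\ni i}x_I\ge |P_i|\ \text{ if } P_i \text{ is a clique},\qquad \sum_{I\ni i}x_I\ge 1\ \text{ if } P_i\text{ is an independent set},\qquad x_I\in\mathbb{Z}_{\ge 0},$$ is attained and equals $\chi(G)$. -/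

import Mathlib

universe u

noncomputable section

open scoped Classical

namespace NDColoring

/-! ### Neighborhood diversity and type graphs -/

/-- A partition of the vertex set of `G` into `k` nonempty classes (the fibres of `part`) such that
every class is a clique or an independent set, and between two different classes there are either
all possible edges or none. -/
structure NDDecomposition {V : Type u} (G : SimpleGraph V) (k : ℕ) where
  part : V → Fin k
  surj : Function.Surjective part
  homogeneous : ∀ i, G.IsClique {v | part v = i} ∨ G.IsIndepSet {v | part v = i}
  uniform : ∀ i j, i ≠ j →
    (∀ u v, part u = i → part v = j → G.Adj u v) ∨
    (∀ u v, part u = i → part v = j → ¬ G.Adj u v)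

/-- The neighborhood diversity: the least size of an nd-decomposition. -/
def nd {V : Type u} (G : SimpleGraph V) : ℕ :=
  sInf {k | Nonempty (NDDecomposition G k)}

/-- Graphs on `{0, …, k-1}` with weighted vertices, in which loops are allowed. -/
structure TypeGraph (k : ℕ) where
  weight : Fin k → ℕ
  Adj : Fin k → Fin k → Prop

variable {V : Type u} {G : SimpleGraph V} {k : ℕ}

/-- The class `P_i`. -/
def NDDecomposition.cls (D : NDDecomposition G k) (i : Fin k) : Set V := {v | D.part v = i}

/-- The type graph of an nd-decomposition. For `i ≠ j` there is an edge `ij` iff all edges between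
`P_i` and `P_j` are present in `G`; there is a loop at `i` iff `P_i` is a clique of `G`. -/
def NDDecomposition.typeGraph (D : NDDecomposition G k) : TypeGraph k where
  weight i := (D.cls i).ncard
  Adj i j := if i = j then G.IsClique (D.cls i) else ∀ u ∈ D.cls i, ∀ v ∈ D.cls j, G.Adj u v

/-! ### The integer program -/

/-- Independence in a type graph, where loops are disregarded. -/
def TypeGraph.IsIndep (T : TypeGraph k) (I : Finset (Fin k)) : Prop :=
  ∀ i ∈ I, ∀ j ∈ I, i ≠ j → ¬ T.Adj i j

/-- The family of the inclusion-maximal independent sets of a type graph. -/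
def TypeGraph.maxIndep (T : TypeGraph k) : Finset (Finset (Fin k)) :=
  Finset.univ.filter fun I => Maximal T.IsIndep I

/-- The covering constraints on the nonnegative integer variables `x I`, where `I` ranges over the
maximal independent sets of the type graph (the values of `x` elsewhere play no role). -/
def NDDecomposition.Feasible (D : NDDecomposition G k) (x : Finset (Fin k) → ℕ) : Prop :=
  (∀ i, G.IsClique (D.cls i) →
    (D.cls i).ncard ≤ ∑ I ∈ D.typeGraph.maxIndep with i ∈ I, x I) ∧
  (∀ i, G.IsIndepSet (D.cls i) →
    1 ≤ ∑ I ∈ D.typeGraph.maxIndep with i ∈ I, x I)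

/-- The objective values, as extended naturals, of the feasible solutions. -/
def NDDecomposition.ipValues (D : NDDecomposition G k) : Set ℕ∞ :=
  {m | ∃ x, D.Feasible x ∧ m = ((∑ I ∈ D.typeGraph.maxIndep, x I : ℕ) : ℕ∞)}

/-! ### A random access machine with bounded words -/

/-- A configuration: registers, and a random access memory organised in arrays. A program, being
a finite text, only mentions finitely many registers and arrays. -/
structure State where
  reg : ℕ → ℕ
  arr : ℕ → ℕ → ℕ

def State.setReg (s : State) (x v : ℕ) : State :=
  { s with reg := Function.update s.reg x v }

def State.setArr (s : State) (a m v : ℕ) : State :=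
  { s with arr := Function.update s.arr a (Function.update (s.arr a) m v) }

/-- Arithmetic operations: addition, truncated subtraction, multiplication, integer division
(with the value `0` for division by `0`). -/
inductive Op
  | add | sub | mul | div

def Op.eval : Op → ℕ → ℕ → ℕ
  | .add, a, b => a + b
  | .sub, a, b => a - b
  | .mul, a, b => a * b
  | .div, a, b => a / b

/-- Programs. The letters `x y z` stand for registers, `a` for an array, `c` for a constant. -/
inductive Prog
  /-- do nothing -/
  | skip
  /-- `x := c` -/
  | const (x c : ℕ)
  /-- `x := y ∘ z` -/
  | arith (o : Op) (x y z : ℕ)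
  /-- `x := a[y]` -/
  | load (x a y : ℕ)
  /-- `a[y] := z` -/
  | store (a y z : ℕ)
  /-- `p; q` -/
  | seq (p q : Prog)
  /-- `if y < z then p else q` -/
  | branch (y z : ℕ) (p q : Prog)
  /-- `while y < z do p` -/
  | loop (y z : ℕ) (p : Prog)

/-- `Exec W p s t s'`: started in the configuration `s`, the program `p` halts in the configuration
`s'` after exactly `t` elementary steps (assignments, arithmetic operations, memory accesses,
comparisons), and never computes a number that is not smaller than `W`. A program that would
compute such a number has no execution. -/
inductive Exec (W : ℕ) : Prog → State → ℕ → State → Prop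
  | skip (s : State) : Exec W .skip s 1 s
  | const (s : State) (x c : ℕ) (h : c < W) : Exec W (.const x c) s 1 (s.setReg x c)
  | arith (s : State) (o : Op) (x y z : ℕ) (h : o.eval (s.reg y) (s.reg z) < W) :
      Exec W (.arith o x y z) s 1 (s.setReg x (o.eval (s.reg y) (s.reg z)))
  | load (s : State) (x a y : ℕ) :
      Exec W (.load x a y) s 1 (s.setReg x (s.arr a (s.reg y)))
  | store (s : State) (a y z : ℕ) :
      Exec W (.store a y z) s 1 (s.setArr a (s.reg y) (s.reg z))
  | seq {p q : Prog} {s s₁ s₂ : State} {t₁ t₂ : ℕ} :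
      Exec W p s t₁ s₁ → Exec W q s₁ t₂ s₂ → Exec W (.seq p q) s (t₁ + t₂) s₂
  | branch_true {p q : Prog} {s s₁ : State} {t y z : ℕ} (h : s.reg y < s.reg z) :
      Exec W p s t s₁ → Exec W (.branch y z p q) s (t + 1) s₁
  | branch_false {p q : Prog} {s s₁ : State} {t y z : ℕ} (h : ¬ s.reg y < s.reg z) :
      Exec W q s t s₁ → Exec W (.branch y z p q) s (t + 1) s₁
  | loop_true {p : Prog} {s s₁ s₂ : State} {t₁ t₂ y z : ℕ} (h : s.reg y < s.reg z) :
      Exec W p s t₁ s₁ → Exec W (.loop y z p) s₁ t₂ s₂ →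
      Exec W (.loop y z p) s (t₁ + t₂ + 1) s₂
  | loop_false {p : Prog} {s : State} {y z : ℕ} (h : ¬ s.reg y < s.reg z) :
      Exec W (.loop y z p) s 1 s

/-! ### Input and output -/

/-- The input configuration for a type graph: register `0` holds `k`, array `0` holds the `k`
weights, array `1` holds the adjacency matrix (with the loops on the diagonal) row by row, and
everything else is `0`. -/
def TypeGraph.input (T : TypeGraph k) : State where
  reg x := if x = 0 then k else 0
  arr a m :=
    if a = 0 then (if h : m < k then T.weight ⟨m, h⟩ else 0)
    else if a = 1 then
      (if ∃ i j : Fin k, m = (i : ℕ) * k + (j : ℕ) ∧ T.Adj i j then 1 else 0)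
    else 0

/-- The list of colors described by an output configuration. Register `0` holds the number of
blocks. The block `l` consists of `a₂[l]` consecutive colors (`a₂` is array `2`), which are all made
available to exactly those classes `i` for which `a₃[l * k + i] ≠ 0` (`a₃` is array `3`). The entry
at position `c` of the list is the set of classes to which the color `c` is available. -/
def State.palette (s : State) (k : ℕ) : List (Finset (Fin k)) :=
  (List.range (s.reg 0)).flatMap fun l =>
    List.replicate (s.arr 2 l) (Finset.univ.filter fun i : Fin k => s.arr 3 (l * k + i) ≠ 0)

/-- The position of `v` among the vertices of its class if the class is a clique (counted from
`0`, in the given order of the vertices), and `0` otherwise. -/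
def NDDecomposition.rank [LinearOrder V] (D : NDDecomposition G k) (v : V) : ℕ :=
  if G.IsClique (D.cls (D.part v)) then {u | u < v ∧ D.part u = D.part v}.ncard else 0

/-- The vertex coloring described by a list of colors: within a clique class, the successive
vertices receive the successive colors available to the class, and all vertices of any other class
receive the first color available to the class. -/
def NDDecomposition.decode [LinearOrder V] (D : NDDecomposition G k)
    (L : List (Finset (Fin k))) (v : V) : ℕ :=
  Nat.nth (fun c => ∃ S, L[c]? = some S ∧ D.part v ∈ S) (D.rank v)

/-- The output configuration `s` solves Graph Coloring for `G`: register `1` holds the chromatic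
number, and the coloring described by `s` is a proper coloring with that many colors. -/
def NDDecomposition.Solved [LinearOrder V] (D : NDDecomposition G k) (s : State) : Prop :=
  (s.reg 1 : ℕ∞) = G.chromaticNumber ∧
  (∀ v, D.decode (s.palette k) v < s.reg 1) ∧
  (∀ u v, G.Adj u v → D.decode (s.palette k) u ≠ D.decode (s.palette k) v)

end NDColoring

end

/-! Let the demand `b i` of a class be its size if it is a clique and `1` otherwise. The color
classes of a proper coloring project to independent sets of the type graph. Conversely, a list of
independent sets that contains every `i` at least `b i` times decodes to a proper coloring. So
`χ(G)` is the least number `cn` of independent sets covering `b`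
(`NDDecomposition.chromaticNumber_eq`), and enlarging the sets to maximal ones gives the integer
program (`NDDecomposition.isLeast_ipValues`).

The algorithm extends `cn` to integer vectors, where nonpositive entries demand nothing, and
computes it by repeated halving. In an optimal cover of `v`, a set used `x` times gives `x / 2`
copies to each of two parts, and the remaining single copies are distributed by a signing of small
discrepancy. A discrepancy of order `k ^ (9/16)` is available. As long as more than about `k ^
(17/16)` sets remain, the pigeonhole principle finds two disjoint subfamilies with equal row sums,
which get opposite signs for free; random signs do the rest (`exists_signedSum_le_of_pow`). Hence `v
= v₁ + v₂` with both parts close to `v / 2` and `cn v₁ + cn v₂ ≤ cn v` (`exists_split_balanced`).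

So at level `l` of `L` levels only a box of side `2 * H` around `b / 2 ^ (L - l)` matters, with `H`
of order `k ^ (9/16)`. Its vectors are coded by `k` digits in base `D = 4 * H`, all below `D / 2`,
so that adding codes adds vectors without carries. Costs within a box differ by fewer than `R = k *
D + 2`, so a table indexed by relative cost and code suffices, and the table of level `l + 1` is the
sumset of the table of level `l` with itself (`Setup.Good.sumset_iff`). A vector at level `l` must
moreover have cover number at most `2 ^ l`. The scaled demands vanish at level `0`, where a vector
needs at most one independent set, and this is read off the type graph.

A brute force sumset takes about `D ^ (2 * k)` steps, of order `k ^ (9 * k / 8)`, which is too much.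
A Fourier transform in only `k / 3` of the digits, modulo `D ^ r + 1` with a power of `D` as root of
unity, lowers the exponent to `2 * k - k / 3` (`conv_ne_zero_iff`). Since `(5/3) * (9/16) = 15/16 <
1`, factors polynomial or exponential in `k` are then absorbed by `k ^ k`
(`Setup.exists_base_pow_le`). The remaining digits and the cost of one summand stay visible as a
tag, so a decomposition of each marked vector is found by searching first the tags and then the
codes with that tag. Following these witnesses down from `b` splits it into `2 ^ L` vectors, each
covered by at most one independent set; those with a positive entry yield the palette. The number of
levels is `O(R * log n)`, and the factor `R` is absorbed as well.

The program consists of compiled loop-free expressions inside a few loop schemes. Its time is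
bounded by its length times a unit `U`, and its numbers by a fixed power of a parameter bound `Q`.
-/

namespace NDColoring
/-! ### Expressions and their compilation -/

/-- Arithmetic expressions over registers and array cells. -/
inductive Ex
  | lit (n : ℕ)
  | reg (x : ℕ)
  | get (a : ℕ) (e : Ex)
  | bin (o : Op) (e f : Ex)

namespace Ex

instance : Add Ex := ⟨bin .add⟩
instance : Sub Ex := ⟨bin .sub⟩
instance : Mul Ex := ⟨bin .mul⟩
instance : Div Ex := ⟨bin .div⟩
instance : Mod Ex := ⟨fun e f => e - (e / f) * f⟩

/-- The value of an expression in a configuration. -/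
def eval (s : State) : Ex → ℕ
  | lit n => n
  | reg x => s.reg x
  | get a e => s.arr a (e.eval s)
  | bin o e f => o.eval (e.eval s) (f.eval s)

variable (s : State) (e f : Ex)

@[simp] lemma eval_lit (n : ℕ) : (lit n).eval s = n := rfl
@[simp] lemma eval_reg (x : ℕ) : (reg x).eval s = s.reg x := rfl
@[simp] lemma eval_get (a : ℕ) : (get a e).eval s = s.arr a (e.eval s) := rfl
@[simp] lemma eval_add : (e + f).eval s = e.eval s + f.eval s := rfl
@[simp] lemma eval_sub : (e - f).eval s = e.eval s - f.eval s := rfl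
@[simp] lemma eval_mul : (e * f).eval s = e.eval s * f.eval s := rfl
@[simp] lemma eval_div : (e / f).eval s = e.eval s / f.eval s := rfl
@[simp] lemma eval_mod : (e % f).eval s = e.eval s % f.eval s := by
  change e.eval s - (e.eval s / f.eval s) * f.eval s = _
  rw [Nat.mod_eq_sub, Nat.mul_comm]

/-- The expression with value `1` if `e < f` and `0` otherwise. -/
def lt (e f : Ex) : Ex := lit 1 - (e + lit 1 - f)

@[simp] lemma eval_lt : (lt e f).eval s = if e.eval s < f.eval s then 1 else 0 := by
  simp only [lt, eval_sub, eval_add, eval_lit]; split_ifs <;> omega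

/-- The expression with value `1` if `e = 0` and `0` otherwise. -/
def isZero (e : Ex) : Ex := lit 1 - e

@[simp] lemma eval_isZero : (isZero e).eval s = if e.eval s = 0 then 1 else 0 := by
  simp only [isZero, eval_sub, eval_lit]; split_ifs <;> omega

/-- The value of `e` if `c = 0` and of `f` otherwise. -/
def cond (c e f : Ex) : Ex := isZero c * e + isZero (isZero c) * f

@[simp] lemma eval_cond (c : Ex) :
    (cond c e f).eval s = if c.eval s = 0 then e.eval s else f.eval s := by
  simp only [cond, eval_add, eval_mul, eval_isZero]; split_ifs <;> simp_all

/-- A degree bounding the growth of the value. -/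
def deg : Ex → ℕ
  | lit _ => 1
  | reg _ => 1
  | get _ _ => 1
  | bin _ e f => e.deg + f.deg

/-- The largest degree of a subexpression. -/
def height : Ex → ℕ
  | lit _ => 1
  | reg _ => 1
  | get _ e => e.height
  | bin _ e f => max (e.deg + f.deg) (max e.height f.height)

/-- An expression only mentions registers below `100` other than the loop bounds `13`, `14`, does
not read array `a`, and only mentions constants up to `c`. -/
def Wf (c a : ℕ) : Ex → Prop
  | lit n => n ≤ c
  | reg x => x < 100 ∧ x ≠ 13 ∧ x ≠ 14
  | get b e => b ≠ a ∧ e.Wf c a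
  | bin _ e f => e.Wf c a ∧ f.Wf c a

/-- The running time of the compiled expression. -/
def time : Ex → ℕ
  | lit _ => 1
  | reg _ => 2
  | get _ e => e.time + 1
  | bin _ e f => e.time + f.time + 1

/-- The program computing an expression in register `d`, using no registers below `d`. -/
def comp : Ex → ℕ → Prog
  | lit n, d => .const d n
  | reg x, d => .seq (.const d 0) (.arith .add d x d)
  | get a e, d => .seq (e.comp d) (.load d a d)
  | bin o e f, d => .seq (.seq (e.comp d) (f.comp (d + 1))) (.arith o d d (d + 1))

instance Wf.decidable (c a : ℕ) : ∀ e : Ex, Decidable (e.Wf c a)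
  | lit n => inferInstanceAs (Decidable (n ≤ c))
  | reg x => inferInstanceAs (Decidable (x < 100 ∧ x ≠ 13 ∧ x ≠ 14))
  | get _ e => @instDecidableAnd _ _ _ (Wf.decidable c a e)
  | bin _ e f => @instDecidableAnd _ _ (Wf.decidable c a e) (Wf.decidable c a f)

/-- Well-formedness with the constants used below, together with a height bound. -/
def Ok (a : ℕ) (e : Ex) : Prop := e.Wf 64 a ∧ e.height ≤ 300

instance (a : ℕ) (e : Ex) : Decidable (e.Ok a) := inferInstanceAs (Decidable (_ ∧ _))

lemma wf_inc (a : ℕ) {x : ℕ} (h : x < 100) (h' : x ≠ 13 ∧ x ≠ 14) : (reg x + lit 1).Wf 64 a :=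
  ⟨⟨h, h'⟩, (by norm_num : 1 ≤ 64)⟩

lemma one_le_deg (e : Ex) : 1 ≤ e.deg := by induction e <;> simp only [deg] <;> omega

end Ex

/-- All registers below `100` and all array cells hold numbers up to `B`. -/
structure State.Bd (s : State) (B : ℕ) : Prop where
  reg : ∀ x < 100, s.reg x ≤ B
  arr : ∀ a m, s.arr a m ≤ B

/-- Adding degrees is right for products and also serves sums, because `2 ≤ B` makes the sum of two
positive powers of `B` at most their product. -/
lemma Op.eval_le_pow {B p q x y : ℕ} (hB : 2 ≤ B) (o : Op) (hp : 1 ≤ p) (hq : 1 ≤ q)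
    (hx : x ≤ B ^ p) (hy : y ≤ B ^ q) : o.eval x y ≤ B ^ (p + q) := by
  have h1 : B ≤ B ^ p := Nat.le_self_pow (by omega) B
  have h2 : B ≤ B ^ q := Nat.le_self_pow (by omega) B
  have h3 : B ^ p ≤ B ^ p * B ^ q := Nat.le_mul_of_pos_right _ (by omega)
  rw [pow_add]
  cases o
  · simp only [Op.eval]
    nlinarith
  · exact (Nat.sub_le _ _).trans (hx.trans h3)
  · exact Nat.mul_le_mul hx hy
  · exact (Nat.div_le_self _ _).trans (hx.trans h3)

lemma Ex.eval_le {s : State} {B c a : ℕ} (hB : 2 ≤ B) (hc : c ≤ B) (hs : s.Bd B) :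
    ∀ e : Ex, e.Wf c a → e.eval s ≤ B ^ e.deg
  | lit n, h => by simpa [deg] using le_trans h hc
  | reg x, h => by simpa [deg] using hs.reg x h.1
  | get b e, _ => by simpa [deg] using hs.arr b _
  | bin o e f, h => Op.eval_le_pow hB o e.one_le_deg f.one_le_deg
      (eval_le hB hc hs e h.1) (eval_le hB hc hs f h.2)

/-- Two configurations agree on the registers below `d` and on the arrays. -/
def State.AgreeBelow (d : ℕ) (s s' : State) : Prop := (∀ x < d, s'.reg x = s.reg x) ∧ s'.arr = s.arr

/-- The exempt array is the target of a fill, and registers `13` and `14` hold the bounds of the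
running loops; well-formed expressions are insensitive to all of them. -/
lemma Ex.eval_congr {s s' : State} {c a : ℕ}
    (hr : ∀ x < 100, x ≠ 13 → x ≠ 14 → s'.reg x = s.reg x) (ha : ∀ b ≠ a, s'.arr b = s.arr b) :
    ∀ e : Ex, e.Wf c a → e.eval s' = e.eval s
  | lit _, _ => rfl
  | reg x, h => hr x h.1 h.2.1 h.2.2
  | get _ e, h => by
      simp only [eval_get]
      rw [eval_congr hr ha e h.2, ha _ h.1]
  | bin o e f, h => by
      simp only [eval]
      rw [eval_congr hr ha e h.1, eval_congr hr ha f h.2]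

@[simp] lemma State.setReg_arr (s : State) (x v : ℕ) : (s.setReg x v).arr = s.arr := rfl
@[simp] lemma State.setArr_reg (s : State) (a m v : ℕ) : (s.setArr a m v).reg = s.reg := rfl
lemma State.setReg_reg (s : State) (x v y : ℕ) :
    (s.setReg x v).reg y = if y = x then v else s.reg y := by
  simp [State.setReg, Function.update_apply]
lemma State.setArr_arr (s : State) (a m v b j : ℕ) :
    (s.setArr a m v).arr b j = if b = a ∧ j = m then v else s.arr b j := by
  simp only [State.setArr, Function.update_apply]
  split_ifs <;> simp_all

lemma State.Bd.of_agree {s s' : State} {B d : ℕ} (h : s.Bd B) (hd : 100 ≤ d)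
    (hs : s.AgreeBelow d s') : s'.Bd B :=
  ⟨fun x hx => by rw [hs.1 x (by omega)]; exact h.reg x hx, fun a m => by
    rw [hs.2]; exact h.arr a m⟩

/-- The registers from `d` on act as a stack: the second operand is computed from `d + 1` on and
leaves the first one in `d` intact. `height` bounds all intermediate values, array indices included,
while `deg` bounds only the final one. -/
theorem Ex.exec_comp {B W c a : ℕ} (hB : 2 ≤ B) (hc : c ≤ B) :
    ∀ (e : Ex) (s : State) (d : ℕ), s.Bd B → e.Wf c a → 100 ≤ d → B ^ e.height < W →
      ∃ s', Exec W (e.comp d) s e.time s' ∧ s.AgreeBelow d s' ∧ s'.reg d = e.eval s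
  | lit n, s, d, _, hw, _, hW => by
      have : n < W := (le_trans hw hc).trans_lt (by simpa [height] using hW)
      exact ⟨_, .const s d n this, ⟨fun x hx => by rw [State.setReg_reg, if_neg (by omega)], rfl⟩,
        by simp [State.setReg_reg]⟩
  | reg x, s, d, hs, hw, hd, hW => by
      have h0 : s.reg x < W := (hs.reg x hw.1).trans_lt (by simpa [height] using hW)
      have hx : x ≠ d := by have := hw.1; omega
      refine ⟨_, .seq (.const s d 0 (by omega)) (.arith _ .add d x d ?_), ⟨?_, rfl⟩, ?_⟩
      · simpa [Op.eval, State.setReg_reg, hx] using h0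
      · intro y hy
        simp [State.setReg_reg, (show y ≠ d by omega)]
      · simp [Op.eval, State.setReg_reg, hx]
  | get b e, s, d, hs, hw, hd, hW => by
      obtain ⟨s1, h1, h2, h3⟩ := exec_comp hB hc e s d hs hw.2 hd hW
      refine ⟨_, .seq h1 (.load s1 d b d), ⟨?_, h2.2⟩, ?_⟩
      · intro y hy
        simp [State.setReg_reg, (show y ≠ d by omega), h2.1 y hy]
      · simp [State.setReg_reg, h3, h2.2]
  | bin o e f, s, d, hs, hw, hd, hW => by
      have hpow : ∀ p, p ≤ (bin o e f).height → B ^ p < W := fun p hp =>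
        (Nat.pow_le_pow_right (by omega) hp).trans_lt hW
      obtain ⟨s1, h1, h2, h3⟩ := exec_comp hB hc e s d hs hw.1 hd
        (hpow _ (by simp [height]))
      obtain ⟨s2, h4, h5, h6⟩ := exec_comp hB hc f s1 (d + 1) (hs.of_agree hd h2) hw.2
        (by omega) (hpow _ (by simp [height]))
      have hf : f.eval s1 = f.eval s :=
        eval_congr (fun x hx _ _ => h2.1 x (by omega)) (fun b _ => by rw [h2.2]) f hw.2
      have hd2 : s2.reg d = e.eval s := by rw [h5.1 d (by omega), h3]
      have hv : o.eval (s2.reg d) (s2.reg (d + 1)) = (bin o e f).eval s := by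
        rw [hd2, h6, hf]; rfl
      refine ⟨_, .seq (.seq h1 h4) (.arith s2 o d d (d + 1) ?_), ⟨?_, ?_⟩, ?_⟩
      · rw [hv]
        exact (eval_le hB hc hs (bin o e f) hw).trans_lt (hpow _ (by simp [height, deg]))
      · intro y hy
        simp [State.setReg_reg, (show y ≠ d by omega), h5.1 y (by omega), h2.1 y hy]
      · simp [h5.2, h2.2]
      · simp [State.setReg_reg, hv]

/-! ### Total correctness with running times -/

/-- Started in `s`, the program `p` halts within `T` steps in a configuration satisfying `Q`. -/
def Runs (W : ℕ) (p : Prog) (s : State) (T : ℕ) (Q : State → Prop) : Prop :=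
  ∃ t s', Exec W p s t s' ∧ t ≤ T ∧ Q s'

variable {W B c : ℕ}

lemma Runs.mono {p : Prog} {s : State} {T T' : ℕ} {Q Q' : State → Prop} (h : Runs W p s T Q)
    (hT : T ≤ T') (hQ : ∀ s', Q s' → Q' s') : Runs W p s T' Q' := by
  obtain ⟨t, s', h1, h2, h3⟩ := h
  exact ⟨t, s', h1, h2.trans hT, hQ s' h3⟩

lemma Runs.seq {p q : Prog} {s : State} {T₁ T₂ : ℕ} {Q₁ Q : State → Prop} (h : Runs W p s T₁ Q₁)
    (hq : ∀ s₁, Q₁ s₁ → Runs W q s₁ T₂ Q) : Runs W (.seq p q) s (T₁ + T₂) Q := by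
  obtain ⟨t, s', h1, h2, h3⟩ := h
  obtain ⟨t', s'', h1', h2', h3'⟩ := hq s' h3
  exact ⟨t + t', s'', .seq h1 h1', by omega, h3'⟩

/-- The invariant is indexed by the number of completed rounds. Each round pays one step for its
test, and the final `1` pays for the failing test. -/
lemma Runs.loop {p : Prog} {y z T : ℕ} (I : ℕ → State → Prop) (n : ℕ)
    (hstep : ∀ j < n, ∀ s, I j s → s.reg y < s.reg z ∧ Runs W p s T (I (j + 1)))
    (hend : ∀ s, I n s → ¬ s.reg y < s.reg z) {s : State} (h0 : I 0 s) :
    Runs W (.loop y z p) s (n * (T + 1) + 1) (I n) := by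
  suffices H : ∀ m j s, j + m = n → I j s → Runs W (.loop y z p) s (m * (T + 1) + 1) (I n) from
    H n 0 s (by omega) h0
  intro m
  induction m with
  | zero =>
    intro j s hj hI
    obtain rfl : j = n := by omega
    exact ⟨1, s, .loop_false (hend s hI), by omega, hI⟩
  | succ m ih =>
    intro j s hj hI
    obtain ⟨hlt, t, s', h1, h2, h3⟩ := hstep j (by omega) s hI
    obtain ⟨t', s'', h1', h2', h3'⟩ := ih (j + 1) s' (by omega) h3
    refine ⟨t + t' + 1, s'', .loop_true hlt h1 h1', ?_, h3'⟩
    rw [Nat.succ_mul]; omega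

/-- `x := e` -/
def setP (x : ℕ) (e : Ex) : Prog := .seq (e.comp 100) (.seq (.const x 0) (.arith .add x 100 x))

/-- `a[e] := f` -/
def stoP (a : ℕ) (e f : Ex) : Prog := .seq (.seq (e.comp 100) (f.comp 101)) (.store a 100 101)

/-- `s'` arises from `s` by setting register `x` to `v`, disregarding the registers from `100` on. -/
def State.IsSet (s : State) (x v : ℕ) (s' : State) : Prop :=
  (∀ y < 100, s'.reg y = if y = x then v else s.reg y) ∧ s'.arr = s.arr

/-- Global assumptions on the word size. -/
structure Cap (W B c : ℕ) : Prop where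
  two : 2 ≤ B
  lit : c ≤ B
  word : B ^ 300 < W

lemma Cap.pow_lt (h : Cap W B c) {p : ℕ} (hp : p ≤ 300) : B ^ p < W :=
  (Nat.pow_le_pow_right (by have := h.two; omega) hp).trans_lt h.word

/-- The machine has no copy instruction, so the result is added to a zeroed register. -/
lemma runs_set (hC : Cap W B c) {s : State} (hs : s.Bd B) (x : ℕ) (hx : x < 100) (e : Ex) {a : ℕ}
    (hw : e.Wf c a) (hh : e.height ≤ 300) (hv : e.eval s ≤ B) :
    Runs W (setP x e) s (e.time + 2) fun s' => s.IsSet x (e.eval s) s' ∧ s'.Bd B := by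
  obtain ⟨s1, h1, h2, h3⟩ := e.exec_comp hC.two hC.lit s 100 hs hw le_rfl (hC.pow_lt hh)
  have hW : B < W := by simpa using hC.pow_lt (p := 1) (by norm_num)
  have hx' : 100 ≠ x := by omega
  have key : s.IsSet x (e.eval s) ((s1.setReg x 0).setReg x (s1.reg 100)) := by
    refine ⟨fun y hy => ?_, by simp [h2.2]⟩
    simp only [State.setReg_reg, h3]
    split_ifs <;> simp_all [h2.1 y hy]
  refine ⟨e.time + (1 + 1), (s1.setReg x 0).setReg x (s1.reg 100),
    .seq h1 (.seq (.const s1 x 0 (by omega)) ?_), by omega, key, ?_⟩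
  · have := Exec.arith (W := W) (s1.setReg x 0) .add x 100 x
      (by simp only [Op.eval, State.setReg_reg]; simp [hx', h3]; omega)
    simpa [Op.eval, State.setReg_reg, hx'] using this
  · refine ⟨fun y hy => ?_, fun a m => ?_⟩
    · rw [key.1 y hy]; split_ifs
      · exact hv
      · exact hs.reg y hy
    · rw [key.2]; exact hs.arr a m

/-- `s'` arises from `s` by setting `a[m]` to `v`, disregarding the registers from `100` on. -/
def State.IsSto (s : State) (a m v : ℕ) (s' : State) : Prop :=
  (∀ y < 100, s'.reg y = s.reg y) ∧
    ∀ b j, s'.arr b j = if b = a ∧ j = m then v else s.arr b j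

lemma runs_sto (hC : Cap W B c) {s : State} (hs : s.Bd B) (a : ℕ) (e f : Ex) {a' a'' : ℕ}
    (hw : e.Wf c a') (hw' : f.Wf c a'') (hh : e.height ≤ 300) (hh' : f.height ≤ 300)
    (hv : f.eval s ≤ B) :
    Runs W (stoP a e f) s (e.time + f.time + 1) fun s' =>
      s.IsSto a (e.eval s) (f.eval s) s' ∧ s'.Bd B := by
  obtain ⟨s1, h1, h2, h3⟩ := e.exec_comp hC.two hC.lit s 100 hs hw le_rfl (hC.pow_lt hh)
  obtain ⟨s2, h4, h5, h6⟩ := f.exec_comp hC.two hC.lit s1 101 (hs.of_agree le_rfl h2) hw'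
    (by omega) (hC.pow_lt hh')
  have hf : f.eval s1 = f.eval s :=
    f.eval_congr (fun x hx _ _ => h2.1 x (by omega)) (fun b _ => by rw [h2.2]) hw'
  have hd2 : s2.reg 100 = e.eval s := by rw [h5.1 100 (by omega), h3]
  have key : s.IsSto a (e.eval s) (f.eval s) (s2.setArr a (s2.reg 100) (s2.reg 101)) := by
    refine ⟨fun y hy => ?_, fun b j => ?_⟩
    · simp [h5.1 y (by omega), h2.1 y hy]
    · rw [State.setArr_arr, h5.2, h2.2, hd2, h6, hf]
  refine ⟨_, _, .seq (.seq h1 h4) (.store s2 a 100 101), le_rfl, key, fun y hy => ?_,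
    fun b m => ?_⟩
  · rw [key.1 y hy]; exact hs.reg y hy
  · rw [key.2]; split_ifs
    · exact hv
    · exact hs.arr b m


/-! ### Folds and array fills -/

/-- Iteration of a step function depending on the index. -/
def foldN (f : ℕ → ℕ → ℕ) (init : ℕ) : ℕ → ℕ
  | 0 => init
  | j + 1 => f j (foldN f init j)

lemma foldN_add (t : ℕ → ℕ) (init n : ℕ) :
    foldN (fun j acc => acc + t j) init n = init + ∑ j ∈ Finset.range n, t j := by
  induction n with
  | zero => simp [foldN]
  | succ n ih => rw [foldN, ih, Finset.sum_range_succ, add_assoc]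

lemma foldN_mul (x init n : ℕ) : foldN (fun _ acc => acc * x) init n = init * x ^ n := by
  induction n with
  | zero => simp [foldN]
  | succ n ih => rw [foldN, ih, pow_succ, mul_assoc]

/-- The configuration with the loop registers set. -/
def State.at (s : State) (i j acc : ℕ) : State where
  reg x := if x = 10 then i else if x = 11 then j else if x = 12 then acc else s.reg x
  arr := s.arr

@[simp] lemma State.at_arr (s : State) (i j acc : ℕ) : (s.at i j acc).arr = s.arr := rfl
@[simp] lemma State.at_reg (s : State) (i j acc x : ℕ) : (s.at i j acc).reg x =
    if x = 10 then i else if x = 11 then j else if x = 12 then acc else s.reg x := rfl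

/-- `s'` agrees with `s` on the registers below `100` except the loop registers. -/
def State.SameRegs (s s' : State) : Prop := ∀ x < 100, x < 10 ∨ 15 ≤ x → s'.reg x = s.reg x

lemma State.SameRegs.trans {s s' s'' : State} (h : s.SameRegs s') (h' : s'.SameRegs s'') :
    s.SameRegs s'' := fun x hx hx' => (h' x hx hx').trans (h x hx hx')

lemma Ex.eval_at {s s' : State} {i j acc c a : ℕ} (hr : s.SameRegs s')
    (ha : ∀ b ≠ a, s'.arr b = s.arr b) (hi : s'.reg 10 = i) (hj : s'.reg 11 = j)
    (hacc : s'.reg 12 = acc) {e : Ex} (he : e.Wf c a) : e.eval s' = e.eval (s.at i j acc) := by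
  refine Ex.eval_congr (fun x hx h13 h14 => ?_) (fun b hb => by simp [ha b hb]) e he
  simp only [State.at_reg]
  split_ifs with h1 h2 h3
  · rw [h1, hi]
  · rw [h2, hj]
  · rw [h3, hacc]
  · exact hr x hx (by omega)

/-- `acc := init; for j < m: acc := step`, with `j` in register `11` and `acc` in register `12`. -/
def foldP (m : Ex) (init : ℕ) (step : Ex) : Prog :=
  .seq (setP 11 (.lit 0)) <| .seq (setP 12 (.lit init)) <| .seq (setP 14 m) <|
    .loop 11 14 <| .seq (setP 12 step) (setP 11 (.reg 11 + .lit 1))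

/-- A bound for the running time of a fold, up to the number of rounds. -/
def foldC (m step : Ex) : ℕ := m.time + step.time + 20

lemma runs_fold (hC : Cap W B 64) {s : State} (hs : s.Bd B) {i a : ℕ} (hi : s.reg 10 = i)
    {m step : Ex} {init : ℕ} (hm : m.Ok a) (hstep : step.Ok a) (hinit : init ≤ 64)
    {m' : ℕ} {f : ℕ → ℕ → ℕ} (hm' : m.eval (s.at i 0 init) = m')
    (hf : ∀ j < m', ∀ acc, step.eval (s.at i j acc) = f j acc)
    (hmB : m' ≤ B) (hfB : ∀ j ≤ m', foldN f init j ≤ B) :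
    Runs W (foldP m init step) s (foldC m step * (m' + 1)) fun s' =>
      s.SameRegs s' ∧ s'.arr = s.arr ∧ s'.reg 10 = i ∧ s'.reg 11 = m' ∧
        s'.reg 12 = foldN f init m' ∧ s'.Bd B ∧ s'.reg 13 = s.reg 13 := by
  have hB0 : init ≤ B := hinit.trans hC.lit
  have hB2 := hC.two
  have hlit : ∀ n, n ≤ 64 → (Ex.lit n).Wf 64 a := fun n hn => hn
  have hh : ∀ n, (Ex.lit n).height ≤ 300 := fun n => by simp [Ex.height]
  refine Runs.mono (Runs.seq (runs_set hC hs 11 (by norm_num) (.lit 0) (hlit 0 (by omega)) (hh 0)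
    (by simp)) fun s1 h1 => Runs.seq (runs_set hC h1.2 12 (by norm_num) (.lit init)
    (hlit init hinit) (hh _) (by simpa)) fun s2 h2 => ?_) (T := 3 + (3 + (m.time + 2 +
      (m' * ((step.time + 2) + 6 + 1) + 1)))) ?_ (fun _ h => h)
  · have hr2 : s.SameRegs s2 := fun x hx hx' => by
      rw [h2.1.1 x hx, h1.1.1 x hx, if_neg (by omega), if_neg (by omega)]
    have ha2 : s2.arr = s.arr := by rw [h2.1.2, h1.1.2]
    have h10 : s2.reg 10 = i := by
      rw [h2.1.1 10 (by norm_num), h1.1.1 10 (by norm_num)]; simpa using hi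
    have h11 : s2.reg 11 = 0 := by
      rw [h2.1.1 11 (by norm_num), h1.1.1 11 (by norm_num)]; simp
    have h12 : s2.reg 12 = init := by rw [h2.1.1 12 (by norm_num)]; simp
    have hme : m.eval s2 = m' := by
      rw [Ex.eval_at hr2 (fun b _ => by rw [ha2]) h10 h11 h12 hm.1, hm']
    refine Runs.seq (runs_set hC h2.2 14 (by norm_num) m hm.1 hm.2 (by omega)) fun s3 h3 => ?_
    let I : ℕ → State → Prop := fun j t => s.SameRegs t ∧ t.arr = s.arr ∧ t.reg 10 = i ∧
      t.reg 11 = j ∧ t.reg 12 = foldN f init j ∧ t.Bd B ∧ t.reg 13 = s.reg 13 ∧ t.reg 14 = m'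
    refine Runs.mono (Runs.loop I m' ?_ ?_ ?_) le_rfl fun t ht => ⟨ht.1, ht.2.1, ht.2.2.1,
      ht.2.2.2.1, ht.2.2.2.2.1, ht.2.2.2.2.2.1, ht.2.2.2.2.2.2.1⟩
    · rintro j hj t ⟨t1, t2, t3, t4, t5, t6, t8, t7⟩
      refine ⟨by omega, ?_⟩
      have hst : step.eval t = foldN f init (j + 1) := by
        rw [Ex.eval_at t1 (fun b _ => by rw [t2]) t3 t4 t5 hstep.1, hf j hj]; rfl
      refine Runs.seq (T₁ := step.time + 2) (T₂ := 6) (runs_set hC t6 12 (by norm_num) step hstep.1 hstep.2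
        (by rw [hst]; exact hfB _ (by omega))) fun u hu => ?_
      have hu11 : u.reg 11 = j := by rw [hu.1.1 11 (by norm_num)]; simpa using t4
      refine Runs.mono (runs_set hC hu.2 11 (by norm_num) (.reg 11 + .lit 1) (a := a)
        (Ex.wf_inc a (by norm_num) (by norm_num))
        (by decide) (by simp [hu11]; omega)) (by decide) fun w hw => ?_
      refine ⟨fun x hx hx' => ?_, ?_, ?_, ?_, ?_, hw.2, ?_, ?_⟩
      · rw [hw.1.1 x hx, hu.1.1 x hx, if_neg (by omega), if_neg (by omega), t1 x hx hx']
      · rw [hw.1.2, hu.1.2, t2]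
      · rw [hw.1.1 10 (by norm_num), hu.1.1 10 (by norm_num)]; simpa using t3
      · rw [hw.1.1 11 (by norm_num)]; simp [hu11]
      · rw [hw.1.1 12 (by norm_num), hu.1.1 12 (by norm_num)]; simpa using hst
      · rw [hw.1.1 13 (by norm_num), hu.1.1 13 (by norm_num)]; simpa using t8
      · rw [hw.1.1 14 (by norm_num), hu.1.1 14 (by norm_num)]; simpa using t7
    · rintro t ⟨-, -, -, t4, -, -, -, t7⟩
      omega
    · refine ⟨fun x hx hx' => ?_, ?_, ?_, ?_, ?_, h3.2, ?_, ?_⟩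
      · rw [h3.1.1 x hx, if_neg (by omega), hr2 x hx hx']
      · rw [h3.1.2, ha2]
      · rw [h3.1.1 10 (by norm_num)]; simpa using h10
      · rw [h3.1.1 11 (by norm_num)]; simpa using h11
      · rw [h3.1.1 12 (by norm_num)]; simpa [foldN] using h12
      · rw [h3.1.1 13 (by norm_num), h2.1.1 13 (by norm_num), h1.1.1 13 (by norm_num)]; simp
      · rw [h3.1.1 14 (by norm_num)]; simpa using hme
  · simp only [foldC]; nlinarith

/-- `for i < n: (fold over j < m); a[off + i] := post`, with `i` in register `10`. -/
def fillP (a : ℕ) (off n m : Ex) (init : ℕ) (step post : Ex) : Prog :=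
  .seq (setP 10 (.lit 0)) <| .seq (setP 11 (.lit 0)) <| .seq (setP 12 (.lit 0)) <|
    .seq (setP 13 n) <| .loop 10 13 <|
      .seq (foldP m init step) <| .seq (stoP a (off + .reg 10) post) (setP 10 (.reg 10 + .lit 1))

/-- A bound for the running time of a fill, up to the number of rounds. -/
def fillC (off n m step post : Ex) : ℕ :=
  m.time + step.time + off.time + n.time + post.time + 60


/-- None of the expressions reads the array being filled, so all of them can be evaluated in the
initial configuration with only the loop registers replaced; the cells are therefore independent of
each other. -/
lemma runs_fill (hC : Cap W B 64) {s : State} (hs : s.Bd B) {a : ℕ}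
    {off n m step post : Ex} {init : ℕ} (hoffk : off.Ok a) (hnk : n.Ok a) (hmk : m.Ok a)
    (hstepk : step.Ok a) (hpostk : post.Ok a) (hh : off.deg < 300) (hinit : init ≤ 64)
    {n' o M : ℕ} {m' : ℕ → ℕ} {f : ℕ → ℕ → ℕ → ℕ} {g : ℕ → ℕ → ℕ}
    (hn : n.eval (s.at 0 0 0) = n')
    (hm : ∀ i < n', m.eval (s.at i 0 init) = m' i)
    (hoff : ∀ i j acc, off.eval (s.at i j acc) = o)
    (hf : ∀ i < n', ∀ j < m' i, ∀ acc, step.eval (s.at i j acc) = f i j acc)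
    (hg : ∀ i < n', ∀ acc, post.eval (s.at i (m' i) acc) = g i acc)
    (hM : ∀ i < n', m' i ≤ M) (hnB : n' ≤ B) (hmB : M ≤ B)
    (hfB : ∀ i < n', ∀ j ≤ m' i, foldN (f i) init j ≤ B)
    (hgB : ∀ i < n', g i (foldN (f i) init (m' i)) ≤ B) :
    Runs W (fillP a off n m init step post) s
      (fillC off n m step post * (n' * (M + 1) + 1)) fun s' =>
      s.SameRegs s' ∧ (∀ b ≠ a, s'.arr b = s.arr b) ∧ (∀ x, s'.arr a x =
        if o ≤ x ∧ x < o + n' then g (x - o) (foldN (f (x - o)) init (m' (x - o)))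
        else s.arr a x) ∧ s'.Bd B := by
  have hB2 := hC.two
  have hlit : (Ex.lit 0).Wf 64 a := by simp [Ex.Wf]
  have hh0 : (Ex.lit 0).height ≤ 300 := by simp [Ex.height]
  refine Runs.mono (Runs.seq (runs_set hC hs 10 (by norm_num) (.lit 0) hlit hh0 (by simp))
    fun s1 h1 => Runs.seq (runs_set hC h1.2 11 (by norm_num) (.lit 0) hlit hh0 (by simp))
    fun s2 h2 => Runs.seq (runs_set hC h2.2 12 (by norm_num) (.lit 0) hlit hh0 (by simp))
    fun s3 h3 => ?_) (T := 3 + (3 + (3 + (n.time + 2 + (n' * (foldC m step * (M + 1) +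
      ((off.time + 3 + post.time + 1) + 6) + 1) + 1))))) ?_ (fun _ h => h)
  · have hr3 : s.SameRegs s3 := fun x hx hx' => by
      rw [h3.1.1 x hx, h2.1.1 x hx, h1.1.1 x hx, if_neg (by omega), if_neg (by omega),
        if_neg (by omega)]
    have ha3 : s3.arr = s.arr := by rw [h3.1.2, h2.1.2, h1.1.2]
    have h10 : s3.reg 10 = 0 := by
      rw [h3.1.1 10 (by norm_num), h2.1.1 10 (by norm_num), h1.1.1 10 (by norm_num)]; simp
    have h11 : s3.reg 11 = 0 := by
      rw [h3.1.1 11 (by norm_num), h2.1.1 11 (by norm_num)]; simp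
    have h12 : s3.reg 12 = 0 := by rw [h3.1.1 12 (by norm_num)]; simp
    have hne : n.eval s3 = n' := by
      rw [Ex.eval_at hr3 (fun b _ => by rw [ha3]) h10 h11 h12 hnk.1, hn]
    refine Runs.seq (runs_set hC h3.2 13 (by norm_num) n hnk.1 hnk.2 (by omega)) fun s4 h4 => ?_
    let I : ℕ → State → Prop := fun i t => s.SameRegs t ∧ (∀ b ≠ a, t.arr b = s.arr b) ∧
      t.reg 10 = i ∧ (∀ x, t.arr a x = if o ≤ x ∧ x < o + i then
        g (x - o) (foldN (f (x - o)) init (m' (x - o))) else s.arr a x) ∧ t.Bd B ∧ t.reg 13 = n'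
    refine Runs.mono (Runs.loop I n' ?_ ?_ ?_) le_rfl fun t ht => ⟨ht.1, ht.2.1, ht.2.2.2.1,
      ht.2.2.2.2.1⟩
    · rintro i hi t ⟨t1, t2, t3, t4, t5, t6⟩
      refine ⟨by omega, ?_⟩
      have hat : ∀ e : Ex, e.Ok a → ∀ j acc, e.eval (t.at i j acc) = e.eval (s.at i j acc) :=
        fun e he j acc => Ex.eval_congr (fun x hx _ _ => by
          simp only [State.at_reg]
          split_ifs
          · rfl
          · rfl
          · rfl
          · exact t1 x hx (by omega)) (fun b hb => by simp [t2 b hb]) e he.1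
      refine Runs.seq (T₁ := foldC m step * (M + 1)) (T₂ := (off.time + 3 + post.time + 1) + 6)
        (Runs.mono (runs_fold hC t5 t3 hmk hstepk hinit (by rw [hat m hmk, hm i hi])
          (fun j hj acc => by rw [hat step hstepk, hf i hi j hj acc]) ((hM i hi).trans hmB)
          (hfB i hi)) (Nat.mul_le_mul le_rfl (by have := hM i hi; omega)) (fun _ h => h)) ?_
      rintro u ⟨u1, u2, u3, u4, u5, u6, u7⟩
      have huo : ∀ e : Ex, e.Ok a → e.eval u = e.eval (s.at i (m' i) (foldN (f i) init (m' i))) :=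
        fun e he => Ex.eval_at (t1.trans u1) (fun b hb => by rw [u2, t2 b hb]) u3 u4 u5 he.1
      have hpe : post.eval u = g i (foldN (f i) init (m' i)) := by rw [huo post hpostk, hg i hi]
      have hoe : (off + .reg 10).eval u = o + i := by
        rw [Ex.eval_add, huo off hoffk, hoff]; simp [u3]
      have hofh : (off + .reg 10).height ≤ 300 := by
        have : (off + Ex.reg 10).height = max (off.deg + 1) (max off.height 1) := rfl
        have := hoffk.2
        omega
      refine Runs.seq (T₁ := off.time + 3 + post.time + 1) (T₂ := 6)
        (Runs.mono (runs_sto hC u6 a (off + .reg 10) post (a' := a) ⟨hoffk.1, by simp [Ex.Wf]⟩ hpostk.1 hofh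
          hpostk.2 (by rw [hpe]; exact hgB i hi)) le_rfl (fun _ h => h)) ?_
      rintro v ⟨⟨v1, v2⟩, v3⟩
      have hv10 : v.reg 10 = i := by rw [v1 10 (by norm_num), u3]
      refine Runs.mono (runs_set hC v3 10 (by norm_num) (.reg 10 + .lit 1) (a := a)
        (Ex.wf_inc a (by norm_num) (by norm_num)) (by decide) (by simp [hv10]; omega)) (by decide) fun w hw => ?_
      have ha : w.arr = v.arr := hw.1.2
      refine ⟨fun x hx hx' => ?_, fun b hb => ?_, ?_, fun x => ?_, hw.2, ?_⟩
      · rw [hw.1.1 x hx, if_neg (by omega), v1 x hx, u1 x hx hx', t1 x hx hx']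
      · ext x
        rw [ha, v2, if_neg (by tauto), u2, t2 b hb]
      · rw [hw.1.1 10 (by norm_num)]; simp [hv10]
      · rw [ha, v2, hoe, hpe, u2, t4]
        by_cases hx : x = o + i
        · subst hx; simp
        · rw [if_neg (by tauto)]
          congr 1
          simp only [eq_iff_iff]
          omega
      · rw [hw.1.1 13 (by norm_num), v1 13 (by norm_num)]
        simpa [u7] using t6
    · rintro t ⟨t1, t2, t3, t4, t5, t6⟩
      omega
    · refine ⟨fun x hx hx' => ?_, fun b _ => ?_, ?_, fun x => ?_, h4.2, ?_⟩
      · rw [h4.1.1 x hx, if_neg (by omega), hr3 x hx hx']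
      · rw [h4.1.2, ha3]
      · rw [h4.1.1 10 (by norm_num)]; simpa using h10
      · rw [h4.1.2, ha3, if_neg (by omega)]
      · rw [h4.1.1 13 (by norm_num)]; simpa using hne
  · have h1 : n' ≤ n' * (M + 1) := Nat.le_mul_of_pos_right _ (by omega)
    have h2 : n' * (foldC m step * (M + 1) + ((off.time + 3 + post.time + 1) + 6) + 1) =
        foldC m step * (n' * (M + 1)) + (off.time + post.time + 11) * n' := by ring
    rw [h2]
    have h3 := Nat.mul_le_mul_left (off.time + post.time + 11) h1
    simp only [fillC, foldC] at *
    nlinarith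


/-- `s'` arises from `s` by changing loop registers and the array `a`. -/
structure State.Keep (B a : ℕ) (s s' : State) : Prop where
  regs : ∀ y < 100, y < 10 ∨ 15 ≤ y → s'.reg y = s.reg y
  arrs : ∀ b ≠ a, s'.arr b = s.arr b
  bd : s'.Bd B

/-- A fill with sums. -/
lemma runs_sumFill (hC : Cap W B 64) {s : State} (hs : s.Bd B) {a : ℕ}
    {off n m step post : Ex} (hoffk : off.Ok a) (hnk : n.Ok a) (hmk : m.Ok a)
    (hstepk : step.Ok a) (hpostk : post.Ok a) (hh : off.deg < 300)
    {n' o M τ : ℕ} {m' : ℕ → ℕ} {t : ℕ → ℕ → ℕ} {g : ℕ → ℕ → ℕ}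
    (hn : n.eval (s.at 0 0 0) = n')
    (hm : ∀ i < n', m.eval (s.at i 0 0) = m' i)
    (hoff : ∀ i j acc, off.eval (s.at i j acc) = o)
    (hf : ∀ i < n', ∀ j < m' i, ∀ acc, step.eval (s.at i j acc) = acc + t i j)
    (hg : ∀ i < n', ∀ acc, post.eval (s.at i (m' i) acc) = g i acc)
    (hM : ∀ i < n', m' i ≤ M) (hnB : n' ≤ B) (hmB : M ≤ B)
    (ht : ∀ i < n', ∀ j < m' i, t i j ≤ τ) (hτ : M * τ ≤ B)
    (hgB : ∀ i < n', ∀ acc ≤ M * τ, g i acc ≤ B) :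
    Runs W (fillP a off n m 0 step post) s
      (fillC off n m step post * (n' * (M + 1) + 1)) fun s' =>
      s.Keep B a s' ∧ (∀ i < n', s'.arr a (o + i) = g i (∑ j ∈ Finset.range (m' i), t i j)) ∧
        ∀ x, x < o ∨ o + n' ≤ x → s'.arr a x = s.arr a x := by
  have hsum : ∀ i < n', ∀ j ≤ m' i, ∑ x ∈ Finset.range j, t i x ≤ M * τ := fun i hi j hj => by
    refine (Finset.sum_le_card_nsmul _ _ τ fun x hx => ht i hi x ?_).trans ?_
    · have := Finset.mem_range.1 hx; omega
    · simp only [Finset.card_range, smul_eq_mul]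
      exact Nat.mul_le_mul_right _ (hj.trans (hM i hi))
  refine (runs_fill hC hs hoffk hnk hmk hstepk hpostk hh (by norm_num) (f := fun i j acc =>
    acc + t i j) hn hm hoff hf hg hM hnB hmB (fun i hi j hj => ?_) fun i hi => ?_).mono le_rfl ?_
  · rw [foldN_add, zero_add]; exact (hsum i hi j hj).trans hτ
  · rw [foldN_add, zero_add]; exact hgB i hi _ (hsum i hi _ le_rfl)
  · rintro s' ⟨h1, h2, h3, h4⟩
    refine ⟨⟨h1, h2, h4⟩, fun i hi => ?_, fun x hx => ?_⟩
    · rw [h3, if_pos (by omega), Nat.add_sub_cancel_left, foldN_add, zero_add]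
    · rw [h3, if_neg (by omega)]

/-- A fill without inner loops. -/
def mapP (a : ℕ) (off n post : Ex) : Prog := fillP a off n (.lit 0) 0 (.lit 0) post

/-- A bound for the running time of `mapP`, up to the number of rounds. -/
def mapC (off n post : Ex) : ℕ := fillC off n (.lit 0) (.lit 0) post

lemma Ex.ok_lit (a n : ℕ) (h : n ≤ 64) : (Ex.lit n).Ok a := ⟨h, by simp [Ex.height]⟩

lemma runs_map (hC : Cap W B 64) {s : State} (hs : s.Bd B) {a : ℕ}
    {off n post : Ex} (hoffk : off.Ok a) (hnk : n.Ok a) (hpostk : post.Ok a) (hh : off.deg < 300)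
    {n' o : ℕ} {g : ℕ → ℕ} (hn : n.eval (s.at 0 0 0) = n')
    (hoff : ∀ i j acc, off.eval (s.at i j acc) = o)
    (hg : ∀ i < n', post.eval (s.at i 0 0) = g i) (hnB : n' ≤ B) (hgB : ∀ i < n', g i ≤ B) :
    Runs W (mapP a off n post) s (mapC off n post * (n' + 1)) fun s' =>
      s.Keep B a s' ∧ (∀ i < n', s'.arr a (o + i) = g i) ∧
        ∀ x, x < o ∨ o + n' ≤ x → s'.arr a x = s.arr a x := by
  refine (runs_fill hC hs hoffk hnk (Ex.ok_lit a 0 (by norm_num)) (Ex.ok_lit a 0 (by norm_num))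
    hpostk hh (by norm_num) (m' := fun _ => 0) (M := 0) (f := fun _ _ acc => acc)
    (g := fun i acc => post.eval (s.at i 0 acc)) hn
    (fun _ _ => rfl) hoff (by omega) (fun _ _ _ => rfl) (fun _ _ => le_rfl) hnB (by omega)
    (fun i hi j hj => ?_) fun i hi => ?_).mono (le_of_eq (by simp [mapC])) ?_
  · obtain rfl : j = 0 := by omega
    simp [foldN]
  · exact (hg i hi).trans_le (hgB i hi)
  · rintro s' ⟨h1, h2, h3, h4⟩
    refine ⟨⟨h1, h2, h4⟩, fun i hi => ?_, fun x hx => ?_⟩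
    · rw [h3, if_pos (by omega), Nat.add_sub_cancel_left]; exact hg i hi
    · rw [h3, if_neg (by omega)]

/-- A fill searching the last index with a property. -/
lemma runs_searchFill (hC : Cap W B 64) {s : State} (hs : s.Bd B) {a : ℕ}
    {off n m c e post : Ex} (hoffk : off.Ok a) (hnk : n.Ok a) (hmk : m.Ok a)
    (hstepk : (Ex.cond c (.reg 12) e).Ok a) (hpostk : post.Ok a) (hh : off.deg < 300)
    {n' o M τ m' : ℕ} {p : ℕ → ℕ → Prop} {v : ℕ → ℕ → ℕ} {g : ℕ → ℕ → ℕ}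
    (hn : n.eval (s.at 0 0 0) = n')
    (hm : ∀ i < n', m.eval (s.at i 0 0) = m')
    (hoff : ∀ i j acc, off.eval (s.at i j acc) = o)
    (hc : ∀ i < n', ∀ j < m', ∀ acc, c.eval (s.at i j acc) ≠ 0 ↔ p i j)
    (he : ∀ i < n', ∀ j < m', ∀ acc, e.eval (s.at i j acc) = v i j)
    (hg : ∀ i < n', ∀ acc, post.eval (s.at i m' acc) = g i acc)
    (hM : m' ≤ M) (hnB : n' ≤ B) (hmB : M ≤ B)
    (ht : ∀ i < n', ∀ j < m', v i j ≤ τ) (hτ : τ ≤ B)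
    (hgB : ∀ i < n', ∀ acc ≤ τ, g i acc ≤ B) :
    Runs W (fillP a off n m 0 (Ex.cond c (.reg 12) e) post) s
      (fillC off n m (Ex.cond c (.reg 12) e) post * (n' * (M + 1) + 1)) fun s' =>
      s.Keep B a s' ∧ (∀ i < n', (∃ j < m', p i j) →
        ∃ j < m', p i j ∧ s'.arr a (o + i) = g i (v i j)) ∧
        (∀ i < n', ∃ acc ≤ τ, s'.arr a (o + i) = g i acc) ∧
        ∀ x, x < o ∨ o + n' ≤ x → s'.arr a x = s.arr a x := by
  classical
  -- The accumulator is overwritten whenever the property holds, and it keeps the initial value `0`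
  -- if this never happens.
  let F : ℕ → ℕ → ℕ → ℕ := fun i j acc => if p i j then v i j else acc
  have hle : ∀ i < n', ∀ j ≤ m', foldN (F i) 0 j ≤ τ := by
    intro i hi j
    induction j with
    | zero => intro _; exact Nat.zero_le _
    | succ j ih =>
      intro hj
      simp only [foldN, F]
      split_ifs
      · exact ht i hi j (by omega)
      · exact ih (by omega)
  have hfind : ∀ i < n', ∀ N ≤ m', (∃ j < N, p i j) → ∃ j < N, p i j ∧ foldN (F i) 0 N = v i j := by
    intro i hi N
    induction N with
    | zero => rintro _ ⟨j, hj, _⟩; omega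
    | succ N ih =>
      rintro hN ⟨j, hj, hp⟩
      by_cases hpN : p i N
      · exact ⟨N, by omega, hpN, by simp [foldN, F, hpN]⟩
      · have hjN : j ≠ N := fun h => hpN (h ▸ hp)
        obtain ⟨j', hj', hp', hv⟩ := ih (by omega) ⟨j, by omega, hp⟩
        refine ⟨j', by omega, hp', ?_⟩
        simp only [foldN, F, if_neg hpN]
        exact hv
  refine (runs_fill hC hs hoffk hnk hmk hstepk hpostk hh (by norm_num) (m' := fun _ => m')
    (f := F) hn hm hoff (fun i hi j hj acc => ?_) hg (fun _ _ => hM) hnB hmB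
    (fun i hi j hj => (hle i hi j hj).trans hτ) fun i hi => hgB i hi _ (hle i hi _ le_rfl)).mono
    le_rfl ?_
  · rw [Ex.eval_cond, he i hi j hj]
    simp only [F, Ex.eval_reg, State.at_reg]
    by_cases hp : p i j
    · rw [if_pos hp, if_neg ((hc i hi j hj acc).2 hp)]
    · rw [if_neg hp, if_pos (by by_contra h; exact hp ((hc i hi j hj acc).1 h))]
      simp
  · rintro s' ⟨h1, h2, h3, h4⟩
    refine ⟨⟨h1, h2, h4⟩, fun i hi hex => ?_, fun i hi => ?_, fun x hx => ?_⟩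
    · obtain ⟨j, hj, hp, hv⟩ := hfind i hi m' le_rfl hex
      exact ⟨j, hj, hp, by rw [h3, if_pos (by omega), Nat.add_sub_cancel_left, hv]⟩
    · exact ⟨_, hle i hi m' le_rfl, by rw [h3, if_pos (by omega), Nat.add_sub_cancel_left]⟩
    · rw [h3, if_neg (by omega)]

/-- `x := e` after a fold. -/
def foldSetP (x : ℕ) (m : Ex) (init : ℕ) (step e : Ex) : Prog :=
  .seq (foldP m init step) (setP x e)

/-- A bound for the running time of `foldSetP`, up to the number of rounds. -/
def foldSetC (m step e : Ex) : ℕ := foldC m step + e.time + 2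

/-- `s'` arises from `s` by changing loop registers and setting register `x` to `v`. -/
structure State.KeepReg (B x v : ℕ) (s s' : State) : Prop where
  regs : ∀ y < 100, y < 10 ∨ 15 ≤ y → s'.reg y = if y = x then v else s.reg y
  arrs : s'.arr = s.arr
  bd : s'.Bd B

/-- No array is written here. The program does not use array `50`, so `Ok 50` imposes no actual
restriction on the arrays read. -/
lemma runs_foldSet (hC : Cap W B 64) {s : State} (hs : s.Bd B) {x : ℕ} (_ : x < 10 ∨ 15 ≤ x)
    (hx' : x < 100) {m step e : Ex} {init : ℕ} (hm : m.Ok 50) (hstep : step.Ok 50) (he : e.Ok 50)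
    (hinit : init ≤ 64) {m' v : ℕ} {f : ℕ → ℕ → ℕ} (hm' : ∀ i, m.eval (s.at i 0 init) = m')
    (hf : ∀ i, ∀ j < m', ∀ acc, step.eval (s.at i j acc) = f j acc)
    (hv : ∀ i, e.eval (s.at i m' (foldN f init m')) = v)
    (hmB : m' ≤ B) (hfB : ∀ j ≤ m', foldN f init j ≤ B) (hvB : v ≤ B) :
    Runs W (foldSetP x m init step e) s (foldSetC m step e * (m' + 1)) fun s' =>
      s.KeepReg B x v s' := by
  refine Runs.mono (Runs.seq (runs_fold hC hs rfl hm hstep hinit (hm' _) (hf _) hmB hfB)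
    fun s1 h1 => ?_) (T := foldC m step * (m' + 1) + (e.time + 2))
    (by simp only [foldSetC]; nlinarith) (fun _ h => h)
  obtain ⟨h1, h2, h3, h4, h5, h6, -⟩ := h1
  have hev : e.eval s1 = v := by
    rw [Ex.eval_at h1 (fun b _ => by rw [h2]) h3 h4 h5 he.1, hv]
  refine (runs_set hC h6 x hx' e he.1 he.2 (by omega)).mono le_rfl fun s2 h => ⟨fun y hy hy' => ?_,
    ?_, h.2⟩
  · rw [h.1.1 y hy, hev, h1 y hy hy']
  · rw [h.1.2, h2]

lemma runs_setReg (hC : Cap W B 64) {s : State} (hs : s.Bd B) {x : ℕ}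
    (hx' : x < 100) {e : Ex} (he : e.Ok 50) {v : ℕ} (hv : e.eval s = v) (hvB : v ≤ B) :
    Runs W (setP x e) s (e.time + 2) fun s' => s.KeepReg B x v s' :=
  (runs_set hC hs x hx' e he.1 he.2 (by omega)).mono le_rfl fun s2 h =>
    ⟨fun y hy _ => by rw [h.1.1 y hy, hv], h.1.2, h.2⟩

end NDColoring

namespace NDColoring

/-! ### Discrepancy -/

section Discrepancy

open Finset Real

variable {α : Type*} [DecidableEq α] {k : ℕ}

/-- The signed sum of row `i` for the colouring that is `1` on `X` and `-1` elsewhere. -/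
def signedSum (R : Fin k → Finset α) (O X : Finset α) (i : Fin k) : ℤ :=
  ∑ I ∈ O, if I ∈ R i then (if I ∈ X then 1 else -1) else 0

/-- This is the moment generating function of a sum of independent signs, times `2 ^ #O`. It factors
over the elements of `O`; elements off the row contribute `2`, the others `2 * cosh t`, and `cosh t
≤ exp (t ^ 2 / 2)`. -/
lemma sum_exp_signedSum_le (R : Fin k → Finset α) (O : Finset α) (i : Fin k) (t : ℝ) :
    ∑ X ∈ O.powerset, exp (t * signedSum R O X i) ≤ 2 ^ #O * exp (t ^ 2 * #O / 2) := by
  have h1 : ∀ X ∈ O.powerset, exp (t * signedSum R O X i) =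
      (∏ I ∈ X, exp (t * if I ∈ R i then 1 else 0)) *
        ∏ I ∈ O \ X, exp (t * if I ∈ R i then -1 else 0) := by
    intro X hX
    rw [mem_powerset] at hX
    rw [← exp_sum, ← exp_sum, ← exp_add, signedSum, ← sum_sdiff hX]
    congr 1
    push_cast
    rw [← mul_sum, ← mul_sum, mul_add, add_comm]
    congr 2
    · refine sum_congr rfl fun I hI => ?_
      simp [hI]
    · refine sum_congr rfl fun I hI => ?_
      simp [(mem_sdiff.1 hI).2]
  rw [sum_congr rfl h1, ← prod_add]
  calc ∏ I ∈ O, (exp (t * if I ∈ R i then 1 else 0) + exp (t * if I ∈ R i then -1 else 0))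
      ≤ ∏ _I ∈ O, 2 * exp (t ^ 2 / 2) := by
        refine prod_le_prod (fun _ _ => by positivity) fun I _ => ?_
        split_ifs
        · have := cosh_le_exp_half_sq t
          rw [cosh_eq] at this
          rw [mul_one, mul_neg_one]
          linarith
        · have : 1 ≤ exp (t ^ 2 / 2) := one_le_exp (by positivity)
          simp only [mul_zero, exp_zero]
          linarith
    _ = _ := by
        rw [prod_const, mul_pow, ← exp_nat_mul]
        congr 2
        ring

lemma signedSum_sdiff (R : Fin k → Finset α) (O X : Finset α) (i : Fin k) :
    signedSum R O (O \ X) i = - signedSum R O X i := by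
  rw [signedSum, signedSum, ← sum_neg_distrib]
  refine sum_congr rfl fun I hI => ?_
  simp only [mem_sdiff, hI, true_and]
  split_ifs <;> simp_all

/-- Random signs. -/
lemma exists_signedSum_le_of_exp (R : Fin k → Finset α) (O : Finset α) (t lam : ℝ)
    (ht : 0 ≤ t) (h : 2 * k * exp (t ^ 2 * #O / 2) < exp (t * lam)) :
    ∃ X, ∀ i, |(signedSum R O X i : ℝ)| ≤ lam := by
  by_contra! hcon
  -- Union bound in exponential form: some row violates the bound for `X`, and one of its two signs
  -- already contributes the whole left side.
  have h1 : ∀ X ∈ O.powerset, exp (t * lam) ≤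
      ∑ i, (exp (t * signedSum R O X i) + exp (t * signedSum R O (O \ X) i)) := by
    intro X _
    obtain ⟨i, hi⟩ := hcon X
    refine le_trans ?_ (single_le_sum (f := fun i => exp (t * signedSum R O X i) +
      exp (t * signedSum R O (O \ X) i)) (fun _ _ => by positivity) (mem_univ i))
    simp only [signedSum_sdiff]
    rcases le_abs.1 hi.le with h | h
    · exact le_add_of_le_of_nonneg (exp_le_exp.2 (by gcongr)) (by positivity)
    · exact le_add_of_nonneg_of_le (by positivity) (exp_le_exp.2 (by push_cast; gcongr))
  have h2 := sum_le_sum h1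
  -- Complementation in `O` reverses all signs, so both signs have the same total.
  have h3 : ∀ i : Fin k, ∑ X ∈ O.powerset, exp (t * signedSum R O (O \ X) i) =
      ∑ X ∈ O.powerset, exp (t * signedSum R O X i) := by
    intro i
    refine sum_bij' (fun X _ => O \ X) (fun X _ => O \ X) ?_ ?_ ?_ ?_ ?_
    · intro X _; simp
    · intro X _; simp
    · intro X hX; simpa using Finset.sdiff_sdiff_eq_self (mem_powerset.1 hX)
    · intro X hX; simpa using Finset.sdiff_sdiff_eq_self (mem_powerset.1 hX)
    · intro X _; rfl
  rw [sum_const, card_powerset, sum_comm] at h2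
  have h4 : ∑ i : Fin k, ∑ X ∈ O.powerset,
      (exp (t * signedSum R O X i) + exp (t * signedSum R O (O \ X) i)) ≤
      ∑ _i : Fin k, 2 * (2 ^ #O * exp (t ^ 2 * #O / 2)) := by
    refine sum_le_sum fun i _ => ?_
    rw [sum_add_distrib, h3]
    linarith [sum_exp_signedSum_le R O i t]
  rw [sum_const, card_univ, Fintype.card_fin] at h4
  have h5 := h2.trans h4
  simp only [nsmul_eq_mul] at h5
  push_cast at h5
  have h6 : (0 : ℝ) < 2 ^ #O := by positivity
  nlinarith

/-- Pigeonhole: a large family contains two disjoint subfamilies with equal row sums. -/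
lemma exists_balanced_pair (R : Fin k → Finset α) (O : Finset α) (s : ℕ)
    (hs : (s + 2) ^ k < 2 ^ (s + 1)) (hO : s < #O) :
    ∃ U U' : Finset α, U ⊆ O ∧ U' ⊆ O ∧ Disjoint U U' ∧ (U ∪ U').Nonempty ∧
      ∀ i, #(U ∩ R i) = #(U' ∩ R i) := by
  obtain ⟨O', hO', hc⟩ := exists_subset_card_eq (Nat.succ_le_of_lt hO)
  -- A subset of `s + 1` sets has row sums among `0, …, s + 1`, so the reduction modulo `s + 2`
  -- loses nothing.
  let F : Finset α → (Fin k → Fin (s + 2)) := fun X i =>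
    ⟨#(X ∩ R i) % (s + 2), Nat.mod_lt _ (by omega)⟩
  have hcard : #(univ : Finset (Fin k → Fin (s + 2))) < #O'.powerset := by
    rw [card_powerset, hc, card_univ]
    simpa using hs
  obtain ⟨X, hX, Y, hY, hne, hXY⟩ := exists_ne_map_eq_of_card_lt_of_maps_to hcard
    (f := F) (fun _ _ => mem_coe.2 (mem_univ _))
  rw [mem_powerset] at hX hY
  have hle : ∀ Z ⊆ O', ∀ i, #(Z ∩ R i) % (s + 2) = #(Z ∩ R i) := fun Z hZ i => by
    refine Nat.mod_eq_of_lt ?_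
    have := card_le_card (inter_subset_left.trans hZ : Z ∩ R i ⊆ O')
    omega
  -- Removing the common part makes the subfamilies disjoint and lowers both row sums by the same
  -- amount.
  refine ⟨X \ Y, Y \ X, sdiff_subset.trans (hX.trans hO'), sdiff_subset.trans (hY.trans hO'),
    ?_, ?_, fun i => ?_⟩
  · exact disjoint_sdiff_sdiff
  · by_contra h
    rw [not_nonempty_iff_eq_empty, union_eq_empty, sdiff_eq_empty_iff_subset,
      sdiff_eq_empty_iff_subset] at h
    exact hne (h.1.antisymm h.2)
  · have h1 : #(X ∩ R i) = #(Y ∩ R i) := by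
      have := congrArg Fin.val (congrFun hXY i)
      simpa only [F, hle X hX, hle Y hY] using this
    have h2 : #(X ∩ R i) = #((X \ Y) ∩ R i) + #((X ∩ Y) ∩ R i) := by
      rw [← card_union_of_disjoint]
      · congr 1; ext; simp; tauto
      · rw [disjoint_left]; simp; tauto
    have h3 : #(Y ∩ R i) = #((Y \ X) ∩ R i) + #((X ∩ Y) ∩ R i) := by
      rw [← card_union_of_disjoint]
      · congr 1; ext; simp; tauto
      · rw [disjoint_left]; simp; tauto
    omega

lemma signedSum_eq_card (R : Fin k → Finset α) (U U' : Finset α) (h : Disjoint U U') (X : Finset α)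
    (hU : U ⊆ X) (hU' : Disjoint U' X) (i : Fin k) :
    signedSum R (U ∪ U') X i = #(U ∩ R i) - #(U' ∩ R i) := by
  rw [signedSum, sum_union h]
  have h1 : ∑ I ∈ U, (if I ∈ R i then (if I ∈ X then (1 : ℤ) else -1) else 0) = #(U ∩ R i) := by
    rw [← filter_mem_eq_inter, card_filter]
    push_cast
    exact sum_congr rfl fun I hI => by simp [hU hI]
  have h2 : ∑ I ∈ U', (if I ∈ R i then (if I ∈ X then (1 : ℤ) else -1) else 0) =
      -#(U' ∩ R i) := by
    rw [← filter_mem_eq_inter, card_filter]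
    push_cast
    rw [← sum_neg_distrib]
    exact sum_congr rfl fun I hI => by
      have := disjoint_left.1 hU' hI
      by_cases h : I ∈ R i <;> simp [h, this]
  rw [h1, h2]
  ring

/-- A balanced pair gets opposite signs and contributes nothing to any row, so it can be split off
while more than `s` sets remain. Random signs then have to deal with only `s` sets, however large
the original family is. -/
lemma exists_signedSum_le (R : Fin k → Finset α) (s : ℕ) (t lam : ℝ)
    (hs : (s + 2) ^ k < 2 ^ (s + 1)) (ht : 0 ≤ t)
    (h : 2 * k * exp (t ^ 2 * s / 2) < exp (t * lam)) (O : Finset α) :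
    ∃ X, ∀ i, |(signedSum R O X i : ℝ)| ≤ lam := by
  induction O using Finset.strongInduction with
  | H O ih =>
    by_cases hO : #O ≤ s
    · refine exists_signedSum_le_of_exp R O t lam ht (lt_of_le_of_lt ?_ h)
      gcongr
    · obtain ⟨U, U', h1, h2, h3, h4, h5⟩ := exists_balanced_pair R O s hs (by omega)
      have hsub : U ∪ U' ⊆ O := union_subset h1 h2
      obtain ⟨X, hX⟩ := ih (O \ (U ∪ U')) (sdiff_ssubset hsub h4)
      refine ⟨(X \ (U ∪ U')) ∪ U, fun i => ?_⟩
      convert hX i using 3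
      rw [signedSum, ← sum_sdiff hsub]
      change _ + signedSum R (U ∪ U') _ i = _
      rw [signedSum_eq_card R U U' h3 _ subset_union_right _ i, h5 i, sub_self, add_zero, signedSum]
      · refine sum_congr rfl fun I hI => ?_
        simp only [mem_sdiff, mem_union, not_or] at hI
        simp [hI.2.1, hI.2.2]
      · rw [disjoint_union_right]
        exact ⟨disjoint_left.2 fun I hI => by simp [hI], h3.symm⟩

/-- Every family of sets has signed row sums of order `k ^ (9 / 16)`. -/
theorem exists_signedSum_le_of_pow (hk : 1 ≤ k) (R : Fin k → Finset α) (lam : ℕ)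
    (hl : 40 ^ 16 * k ^ 9 ≤ lam ^ 16) (O : Finset α) :
    ∃ X, ∀ i, |signedSum R O X i| ≤ lam := by
  have hk0 : (1 : ℝ) ≤ k := by exact_mod_cast hk
  -- Everything is a power of `y`. About `y ^ 17` sets survive the pigeonhole step, so a deviation
  -- of order `y ^ 9` has a squared ratio to the standard deviation of order `y`. This beats `log k
  -- = 16 * log y ≤ 16 * y`.
  set y : ℝ := (k : ℝ) ^ (1 / 16 : ℝ) with hy
  have hy1 : 1 ≤ y := one_le_rpow hk0 (by norm_num)
  have hyk : y ^ 16 = k := by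
    rw [hy, ← rpow_natCast, ← rpow_mul (by positivity)]; norm_num
  have hlam : 40 * y ^ 9 ≤ lam := by
    have : (40 * y ^ 9) ^ 16 ≤ (lam : ℝ) ^ 16 := by
      calc (40 * y ^ 9) ^ 16 = 40 ^ 16 * (y ^ 16) ^ 9 := by ring
        _ = 40 ^ 16 * (k : ℝ) ^ 9 := by rw [hyk]
        _ ≤ _ := by exact_mod_cast hl
    exact le_of_pow_le_pow_left₀ (by norm_num) (by positivity) this
  have hlogy : log y ≤ y := (log_le_sub_one_of_pos (by linarith)).trans (by linarith)
  have hlogk : log k = 16 * log y := by rw [← hyk, log_pow]; norm_num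
  have hlog2 : 0.69 < log 2 := by linarith [log_two_gt_d9]
  have hlog2' : log 2 < 0.7 := by linarith [log_two_lt_d9]
  -- The pigeonhole step needs `k * log (s + 2) < (s + 1) * log 2`; the left side is at most `22 * y
  -- ^ 17`, and `40 * 0.69 > 22`.
  set s : ℕ := ⌈40 * y ^ 17⌉₊ with hsdef
  have hs1 : (s : ℝ) < 40 * y ^ 17 + 1 := Nat.ceil_lt_add_one (by positivity)
  have hs0 : 40 * y ^ 17 ≤ s := Nat.le_ceil _
  have hy17 : 1 ≤ y ^ 17 := one_le_pow₀ hy1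
  have hy8 : 1 ≤ y ^ 8 := one_le_pow₀ hy1
  have hy16 : 1 ≤ y ^ 16 := one_le_pow₀ hy1
  have hs2 : (s + 2) ^ k < 2 ^ (s + 1) := by
    have : ((s + 2 : ℕ) : ℝ) ^ k < (2 : ℝ) ^ (s + 1) := by
      rw [← log_lt_log_iff (by positivity) (by positivity), log_pow, log_pow]
      have h1 : log ((s + 2 : ℕ) : ℝ) ≤ 7 * log 2 + 17 * y := by
        calc log ((s + 2 : ℕ) : ℝ) ≤ log (2 ^ 7 * y ^ 17) := by
              refine log_le_log (by positivity) ?_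
              push_cast; linarith
          _ = 7 * log 2 + 17 * log y := by
              rw [log_mul (by norm_num) (by positivity), log_pow, log_pow]; norm_num
          _ ≤ _ := by linarith
      have h2 : (k : ℝ) * log ((s + 2 : ℕ) : ℝ) ≤ y ^ 16 * (22 * y) := by
        rw [hyk]
        exact mul_le_mul_of_nonneg_left (by linarith) (by positivity)
      calc (k : ℝ) * log ((s + 2 : ℕ) : ℝ) ≤ 22 * y ^ 17 := by linarith [h2]
        _ < (40 * y ^ 17 + 1) * log 2 := by nlinarith
        _ ≤ ((s + 1 : ℕ) : ℝ) * log 2 := by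
            push_cast; exact mul_le_mul_of_nonneg_right (by linarith) (by linarith)
    exact_mod_cast this
  -- With `t = 1 / y ^ 8` the variance term is at most `20.5 * y` and `t * lam` is at least `40 *
  -- y`. The difference exceeds `log (2 * k) ≤ 0.7 + 16 * y`.
  obtain ⟨X, hX⟩ := exists_signedSum_le R s (1 / y ^ 8) lam hs2 (by positivity) (by
    have h2k : (2 * k : ℝ) = exp (log 2 + 16 * log y) := by
      rw [exp_add, exp_log (by norm_num), ← hlogk, exp_log (by linarith)]
    rw [h2k, ← exp_add, exp_lt_exp]
    have h1 : (1 / y ^ 8) ^ 2 * s / 2 ≤ 20.5 * y := by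
      have : (1 / y ^ 8) ^ 2 * s ≤ (1 / y ^ 8) ^ 2 * (41 * y ^ 17) := by
        gcongr; linarith
      have h2 : (1 / y ^ 8) ^ 2 * (41 * y ^ 17) = 41 * y := by field_simp
      linarith
    have h3 : 40 * y ≤ 1 / y ^ 8 * lam := by
      calc 40 * y = 1 / y ^ 8 * (40 * y ^ 9) := by field_simp
        _ ≤ _ := by gcongr
    linarith) O
  exact ⟨X, fun i => by exact_mod_cast hX i⟩

end Discrepancy

end NDColoring

namespace NDColoring

/-! ### Cover numbers -/

section Cover

open Finset

variable {k : ℕ} (T : TypeGraph k)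

/-- The vector `v` can be covered by `q` independent sets. -/
def Cov (v : Fin k → ℤ) (q : ℕ) : Prop :=
  ∃ x : Finset (Fin k) → ℕ, (∀ I, x I ≠ 0 → T.IsIndep I) ∧ ∑ I, x I ≤ q ∧
    ∀ i, v i ≤ ((∑ I with i ∈ I, x I : ℕ) : ℤ)

/-- The least number of independent sets that cover `v`. -/
noncomputable def cn (v : Fin k → ℤ) : ℕ := sInf {q | Cov T v q}

variable {T} {v w : Fin k → ℤ}

lemma isIndep_singleton (i : Fin k) : T.IsIndep {i} := by
  intro a ha b hb hab
  rw [mem_singleton] at ha hb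
  exact absurd (ha.trans hb.symm) hab

lemma cov_sum_toNat (v : Fin k → ℤ) : Cov T v (∑ i, (v i).toNat) := by
  refine ⟨fun I => ∑ i : Fin k, if I = {i} then (v i).toNat else 0, fun I hI => ?_, ?_, fun i => ?_⟩
  · have hI' : ∑ i : Fin k, (if I = {i} then (v i).toNat else 0) ≠ 0 := hI
    have : ∃ i, I = {i} := by
      by_contra! h
      exact hI' (sum_eq_zero fun i _ => if_neg (h i))
    obtain ⟨i, rfl⟩ := this
    exact isIndep_singleton i
  · rw [sum_comm]
    simp
  · have h1 : (v i).toNat ≤ ∑ I : Finset (Fin k) with i ∈ I,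
        ∑ j : Fin k, if I = {j} then (v j).toNat else 0 := by
      calc (v i).toNat = ∑ j : Fin k, if ({i} : Finset (Fin k)) = {j} then (v j).toNat else 0 := by simp
        _ ≤ _ := single_le_sum (f := fun I : Finset (Fin k) => ∑ j : Fin k,
            if I = {j} then (v j).toNat else 0)
            (fun _ _ => Nat.zero_le _) (by simp)
    exact (Int.self_le_toNat _).trans (by exact_mod_cast h1)

lemma Cov.mono {q q' : ℕ} (h : Cov T v q) (hw : w ≤ v) (hq : q ≤ q') : Cov T w q' := by
  obtain ⟨x, h1, h2, h3⟩ := h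
  exact ⟨x, h1, h2.trans hq, fun i => (hw i).trans (h3 i)⟩

lemma cov_iff {q : ℕ} : Cov T v q ↔ cn T v ≤ q := by
  refine ⟨fun h => Nat.sInf_le h, fun h => ?_⟩
  exact (Nat.sInf_mem (s := {q | Cov T v q}) ⟨_, cov_sum_toNat v⟩ : Cov T v (cn T v)).mono le_rfl h

lemma cov_cn (v : Fin k → ℤ) : Cov T v (cn T v) := cov_iff.2 le_rfl

lemma cn_mono (h : w ≤ v) : cn T w ≤ cn T v := cov_iff.1 ((cov_cn v).mono h le_rfl)

lemma cn_add_le (v w : Fin k → ℤ) : cn T (v + w) ≤ cn T v + cn T w := by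
  obtain ⟨x, h1, h2, h3⟩ := cov_cn (T := T) v
  obtain ⟨y, h4, h5, h6⟩ := cov_cn (T := T) w
  refine cov_iff.1 ⟨x + y, fun I hI => ?_, ?_, fun i => ?_⟩
  · by_cases h : x I = 0
    · exact h4 I (by simpa [h] using hI)
    · exact h1 I h
  · simp only [Pi.add_apply, sum_add_distrib]; omega
  · have := h3 i; have := h6 i
    simp only [Pi.add_apply, sum_add_distrib]; push_cast at *; omega

lemma cn_le_add_sum (d : Fin k → ℕ) (h : ∀ i, w i ≤ v i + d i) : cn T w ≤ cn T v + ∑ i, d i := by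
  have h1 := cn_add_le (T := T) v (w - v)
  rw [add_sub_cancel] at h1
  have h2 : cn T (w - v) ≤ ∑ i, (w i - v i).toNat := cov_iff.1 (cov_sum_toNat (w - v))
  have h3 : ∑ i, (w i - v i).toNat ≤ ∑ i, d i := sum_le_sum fun i _ => by
    have := h i; omega
  omega

lemma cn_le_sum (d : Fin k → ℕ) (h : ∀ i, w i ≤ d i) : cn T w ≤ ∑ i, d i :=
  (cov_iff.1 (cov_sum_toNat w)).trans (sum_le_sum fun i _ => by have := h i; omega)

lemma cn_eq_zero_iff : cn T v = 0 ↔ ∀ i, v i ≤ 0 := by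
  constructor
  · intro h i
    obtain ⟨x, -, h2, h3⟩ := cov_cn (T := T) v
    rw [h] at h2
    have h4 : ∑ I with i ∈ I, x I ≤ ∑ I, x I := sum_le_sum_of_subset (filter_subset _ _)
    have := h3 i
    omega
  · intro h
    have := cn_le_sum (T := T) (fun _ => 0) (w := v) (by simpa using h)
    simpa using this

/-- This is what level `0` of the dynamic program tests. No cover has to be searched for, since the
set of positive coordinates itself can be taken. -/
lemma cn_le_one_iff : cn T v ≤ 1 ↔
    (∀ i, v i ≤ 1) ∧ ∀ i j, i ≠ j → 0 < v i → 0 < v j → ¬ T.Adj i j := by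
  constructor
  · intro h
    obtain ⟨x, h1, h2, h3⟩ := cov_iff.2 h
    have h5 : ∀ i, 0 < v i → ∃ I, x I ≠ 0 ∧ i ∈ I := fun i hi => by
      have h6 : ∑ I with i ∈ I, x I ≠ 0 := by have := h3 i; omega
      obtain ⟨I, hI, hxI⟩ := exists_ne_zero_of_sum_ne_zero h6
      exact ⟨I, hxI, (mem_filter.1 hI).2⟩
    refine ⟨fun i => ?_, fun i j hij hi hj => ?_⟩
    · have h4 : ∑ I with i ∈ I, x I ≤ ∑ I, x I := sum_le_sum_of_subset (filter_subset _ _)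
      have := h3 i
      omega
    · obtain ⟨I, hI, hiI⟩ := h5 i hi
      obtain ⟨J, hJ, hjJ⟩ := h5 j hj
      have hIJ : I = J := by
        by_contra hne
        have : x I + x J ≤ ∑ I, x I := by
          rw [← sum_pair hne]; exact sum_le_sum_of_subset (subset_univ _)
        omega
      subst hIJ
      exact h1 I hI i hiI j hjJ hij
  · rintro ⟨h1, h2⟩
    refine cov_iff.1 ⟨fun I => if I = univ.filter (fun i => 0 < v i) then 1 else 0,
      fun I hI => ?_, ?_, fun i => ?_⟩
    · have : I = univ.filter (fun i => 0 < v i) := by by_contra h; simp [h] at hI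
      subst this
      intro a ha b hb hab
      exact h2 a b hab (mem_filter.1 ha).2 (mem_filter.1 hb).2
    · simp
    · by_cases hi : 0 < v i
      · have : 1 ≤ ∑ I with i ∈ I, if I = univ.filter (fun i => 0 < v i) then 1 else 0 := by
          refine le_trans ?_ (single_le_sum (f := fun I => if I = univ.filter (fun i => 0 < v i)
            then 1 else 0) (fun _ _ => Nat.zero_le _)
            (mem_filter.2 ⟨mem_univ (univ.filter (fun i => 0 < v i)), by simp [hi]⟩))
          simp
        exact (h1 i).trans (by exact_mod_cast this)
      · omega

/-- Splitting off `a` of the sets of a cover. -/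
lemma exists_le_sum_eq {ι : Type*} [Fintype ι] (x : ι → ℕ) (a : ℕ) (ha : a ≤ ∑ I, x I) :
    ∃ y ≤ x, ∑ I, y I = a := by
  classical
  induction a with
  | zero => exact ⟨0, fun _ => Nat.zero_le _, by simp⟩
  | succ a ih =>
    obtain ⟨y, hy, hsum⟩ := ih (by omega)
    obtain ⟨I, -, hI⟩ := exists_lt_of_sum_lt (s := univ) (f := y) (g := x) (by omega)
    refine ⟨y + Pi.single I 1, fun J => ?_, ?_⟩
    · by_cases h : J = I
      · subst h; simpa using hI
      · simpa [Pi.single_apply, h] using hy J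
    · simp [sum_add_distrib, hsum, Pi.single_apply]

lemma cn_le_of_le_sum {x : Finset (Fin k) → ℕ} (hx : ∀ I, x I ≠ 0 → T.IsIndep I)
    (h : ∀ i, v i ≤ ((∑ I with i ∈ I, x I : ℕ) : ℤ)) : cn T v ≤ ∑ I, x I :=
  cov_iff.1 ⟨x, hx, le_rfl, h⟩

/-- Splitting a vector into halves with respect to the cover number. -/
lemma exists_split_half (v : Fin k → ℤ) : ∃ v₁ v₂ : Fin k → ℤ, v₁ + v₂ = v ∧
    cn T v₁ ≤ cn T v / 2 ∧ cn T v₂ ≤ cn T v - cn T v / 2 ∧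
    ∀ i, (min (v i) 0 ≤ v₁ i ∧ v₁ i ≤ max (v i) 0) ∧ min (v i) 0 ≤ v₂ i ∧ v₂ i ≤ max (v i) 0 := by
  obtain ⟨x, h1, h2, h3⟩ := cov_cn (T := T) v
  have hsum : ∑ I, x I = cn T v := le_antisymm h2 (cn_le_of_le_sum h1 h3)
  obtain ⟨y, hy, hya⟩ := exists_le_sum_eq x (cn T v / 2) (by omega)
  let w₁ : Fin k → ℤ := fun i => ((∑ I with i ∈ I, y I : ℕ) : ℤ)
  let w₂ : Fin k → ℤ := fun i => ((∑ I with i ∈ I, (x I - y I) : ℕ) : ℤ)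
  have hw : ∀ i, v i ≤ w₁ i + w₂ i := fun i => by
    refine (h3 i).trans (le_of_eq ?_)
    simp only [w₁, w₂]
    rw [← Nat.cast_add, ← sum_add_distrib]
    congr 1
    exact sum_congr rfl fun I _ => by have := hy I; simp only at this; omega
  have hw₁ : ∀ i, 0 ≤ w₁ i := fun i => Int.natCast_nonneg _
  have hw₂ : ∀ i, 0 ≤ w₂ i := fun i => Int.natCast_nonneg _
  have hsub : ∑ I, (x I - y I) = cn T v - cn T v / 2 := by
    rw [← hya, ← hsum]
    exact sum_tsub_distrib _ fun I _ => hy I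
  -- The first part takes as much of the positive part of `v` as its sets cover; negative entries go
  -- entirely to the second part. So both parts stay between `0` and `v` in every coordinate.
  refine ⟨fun i => min (max (v i) 0) (w₁ i), fun i => v i - min (max (v i) 0) (w₁ i), ?_, ?_, ?_,
    fun i => ?_⟩
  · ext i; simp
  · rw [← hya]
    exact cn_le_of_le_sum (fun I hI => h1 I (by have : y I ≤ x I := hy I; omega)) fun i => min_le_right _ _
  · rw [← hsub]
    refine cn_le_of_le_sum (fun I hI => h1 I (by omega)) fun i => ?_
    have := hw i; have := hw₂ i
    change _ ≤ w₂ i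
    omega
  · have := hw₁ i
    refine ⟨⟨?_, ?_⟩, ?_, ?_⟩ <;> beta_reduce <;> omega

/-- Splitting a vector into two nearly equal vectors. -/
lemma exists_split_balanced (hk : 1 ≤ k) {lam : ℕ} (hl : 40 ^ 16 * k ^ 9 ≤ lam ^ 16)
    (v : Fin k → ℤ) : ∃ v₁ v₂ : Fin k → ℤ, v₁ + v₂ = v ∧ cn T v₁ + cn T v₂ ≤ cn T v ∧
      ∀ i, |2 * v₁ i - v i| ≤ lam + 1 := by
  obtain ⟨x, h1, h2, h3⟩ := cov_cn (T := T) v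
  let R : Fin k → Finset (Finset (Fin k)) := fun i => univ.filter (i ∈ ·)
  let O : Finset (Finset (Fin k)) := univ.filter fun I => x I % 2 = 1
  obtain ⟨X, hX⟩ := exists_signedSum_le_of_pow hk R lam hl O
  -- Each side gets half of the copies of a set; the odd copy goes to the side given by the signing.
  let y₁ : Finset (Fin k) → ℕ := fun I => x I / 2 + if x I % 2 = 1 ∧ I ∈ X then 1 else 0
  let y₂ : Finset (Fin k) → ℕ := fun I => x I / 2 + if x I % 2 = 1 ∧ I ∉ X then 1 else 0
  have hxy : ∀ I, y₁ I + y₂ I = x I := fun I => by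
    simp only [y₁, y₂]
    by_cases h : I ∈ X <;> by_cases h' : x I % 2 = 1 <;> simp [h, h'] <;> omega
  let w₁ : Fin k → ℤ := fun i => ((∑ I with i ∈ I, y₁ I : ℕ) : ℤ)
  let w₂ : Fin k → ℤ := fun i => ((∑ I with i ∈ I, y₂ I : ℕ) : ℤ)
  have hw : ∀ i, v i ≤ w₁ i + w₂ i := fun i => by
    refine (h3 i).trans (le_of_eq ?_)
    simp only [w₁, w₂]
    rw [← Nat.cast_add, ← sum_add_distrib]
    congr 1
    exact sum_congr rfl fun I _ => (hxy I).symm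
  have hd : ∀ i, |w₁ i - w₂ i| ≤ lam := fun i => by
    convert hX i using 2
    simp only [w₁, w₂, signedSum, O, R, sum_filter]
    push_cast
    rw [← sum_sub_distrib]
    refine sum_congr rfl fun I _ => ?_
    simp only [y₁, y₂, mem_filter, mem_univ, true_and]
    by_cases ha : i ∈ I <;> by_cases hb : I ∈ X <;> by_cases hc : x I % 2 = 1 <;>
      simp [ha, hb, hc]
  -- The value `v / 2` is clamped to the interval from `v - w₂` to `w₁`, which is nonempty because
  -- `v ≤ w₁ + w₂`. Membership in it says that each side covers its part, and `|w₁ - w₂| ≤ lam`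
  -- limits the effect of clamping.
  refine ⟨fun i => max (v i - w₂ i) (min (v i / 2) (w₁ i)),
    fun i => v i - max (v i - w₂ i) (min (v i / 2) (w₁ i)), ?_, ?_, fun i => ?_⟩
  · ext i; simp
  · have e1 : cn T (fun i => max (v i - w₂ i) (min (v i / 2) (w₁ i))) ≤ ∑ I, y₁ I :=
      cn_le_of_le_sum (fun I hI => h1 I (by have := hxy I; omega)) fun i => by
        have := hw i
        change _ ≤ w₁ i
        omega
    have e2 : cn T (fun i => v i - max (v i - w₂ i) (min (v i / 2) (w₁ i))) ≤ ∑ I, y₂ I :=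
      cn_le_of_le_sum (fun I hI => h1 I (by have := hxy I; omega)) fun i => by
        change _ ≤ w₂ i
        omega
    have e3 : ∑ I, x I = ∑ I, y₁ I + ∑ I, y₂ I := by
      rw [← sum_add_distrib]; exact sum_congr rfl fun I _ => (hxy I).symm
    omega
  · have := hw i
    have h5 := abs_le.1 (hd i)
    rw [abs_le]
    constructor <;> beta_reduce <;> omega

end Cover

end NDColoring

namespace NDColoring

/-! ### Digits -/

section Digits

open Finset

/-- The `i`-th digit in base `D`. -/
def dig (D i x : ℕ) : ℕ := x / D ^ i % D

lemma sum_range_mul_eq {M : Type*} [AddCommMonoid M] (f : ℕ → M) (a b : ℕ) :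
    ∑ x ∈ range (b * a), f x = ∑ j ∈ range b, ∑ i ∈ range a, f (j * a + i) := by
  induction b with
  | zero => simp
  | succ b ih => rw [Nat.succ_mul, sum_range_add, ih, sum_range_succ]

variable {D : ℕ}

lemma dig_lt (hD : 0 < D) (i x : ℕ) : dig D i x < D := Nat.mod_lt _ hD

lemma mod_pow_eq_sum_dig (n x : ℕ) : x % D ^ n = ∑ i ∈ range n, dig D i x * D ^ i := by
  induction n with
  | zero => simp [Nat.mod_one]
  | succ n ih => rw [Nat.mod_pow_succ, ih, sum_range_succ, dig, Nat.mul_comm (D ^ n)]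

lemma eq_sum_dig {n x : ℕ} (hx : x < D ^ n) : x = ∑ i ∈ range n, dig D i x * D ^ i := by
  rw [← mod_pow_eq_sum_dig, Nat.mod_eq_of_lt hx]

lemma sum_dig_lt {n : ℕ} {f : ℕ → ℕ} (hf : ∀ i < n, f i < D) :
    ∑ i ∈ range n, f i * D ^ i < D ^ n := by
  induction n with
  | zero => simp
  | succ n ih =>
    rw [sum_range_succ, pow_succ]
    have h1 := ih fun i hi => hf i (by omega)
    have h2 : (f n + 1) * D ^ n ≤ D * D ^ n := Nat.mul_le_mul_right _ (hf n (by omega))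
    nlinarith

lemma dig_sum {n : ℕ} {f : ℕ → ℕ} (hf : ∀ i < n, f i < D) {i : ℕ} (hi : i < n) :
    dig D i (∑ i ∈ range n, f i * D ^ i) = f i := by
  induction n with
  | zero => omega
  | succ n ih =>
    have hD : 0 < D := (Nat.zero_le _).trans_lt (hf 0 (by omega))
    have h1 := sum_dig_lt fun i hi => hf i (Nat.lt_succ_of_lt hi)
    rw [sum_range_succ]
    rcases Nat.lt_succ_iff_lt_or_eq.1 hi with h | rfl
    · rw [← ih (fun i hi => hf i (by omega)) h, dig, dig]
      obtain ⟨c, rfl⟩ := Nat.exists_eq_add_of_lt h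
      have : f (i + c + 1) * D ^ (i + c + 1) = D ^ i * (D * (f (i + c + 1) * D ^ c)) := by ring
      rw [this, Nat.add_mul_div_left _ _ (by positivity), Nat.add_mul_mod_self_left]
    · rw [dig, Nat.add_mul_div_right _ _ (by positivity), Nat.div_eq_of_lt h1, zero_add,
        Nat.mod_eq_of_lt (hf i (by omega))]

lemma dig_ext {n x y : ℕ} (hx : x < D ^ n) (hy : y < D ^ n)
    (h : ∀ i < n, dig D i x = dig D i y) : x = y := by
  rw [eq_sum_dig hx, eq_sum_dig hy]
  exact sum_congr rfl fun i hi => by rw [h i (mem_range.1 hi)]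

/-- All digits are less than half of the base. -/
def Half (D n x : ℕ) : Prop := ∀ i < n, dig D i x < D / 2

lemma add_eq_sum_dig {n x y : ℕ} (hx : x < D ^ n) (hy : y < D ^ n) :
    x + y = ∑ i ∈ range n, (dig D i x + dig D i y) * D ^ i := by
  conv_lhs => rw [eq_sum_dig hx, eq_sum_dig hy]
  rw [← sum_add_distrib]
  exact sum_congr rfl fun i _ => by ring

lemma add_lt_of_dig {n x y : ℕ} (hx : x < D ^ n) (hy : y < D ^ n)
    (h : ∀ i < n, dig D i x + dig D i y < D) : x + y < D ^ n := by
  rw [add_eq_sum_dig hx hy]; exact sum_dig_lt h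

lemma dig_add {n x y : ℕ} (hx : x < D ^ n) (hy : y < D ^ n)
    (h : ∀ i < n, dig D i x + dig D i y < D) {i : ℕ} (hi : i < n) :
    dig D i (x + y) = dig D i x + dig D i y := by
  rw [add_eq_sum_dig hx hy]; exact dig_sum h hi

/-- This is the purpose of using only half of the digits: two such codes are added without carries.
-/
lemma Half.add_lt {n x y : ℕ} (hx : Half D n x) (hy : Half D n y) :
    ∀ i < n, dig D i x + dig D i y < D := fun i hi => by
  have := hx i hi; have := hy i hi; omega

lemma dig_mod {n i x : ℕ} (hi : i < n) : dig D i (x % D ^ n) = dig D i x := by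
  rcases Nat.eq_zero_or_pos D with rfl | hD
  · simp [dig]
    rcases i with _ | i <;> rcases n with _ | n <;> simp_all
  · rw [mod_pow_eq_sum_dig, dig_sum (fun i _ => dig_lt hD i x) hi]

/-- The inner product of the digit vectors. -/
def dot (D n x y : ℕ) : ℕ := ∑ i ∈ range n, dig D i x * dig D i y

end Digits

/-! ### Characters and convolution -/

section Convolution

open Finset

variable {R : Type*} [CommRing R]

lemma geom_two_pow (z : R) (n : ℕ) :
    ∑ t ∈ range (2 ^ n), z ^ t = ∏ i ∈ range n, (1 + z ^ 2 ^ i) := by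
  induction n with
  | zero => simp
  | succ n ih =>
    rw [pow_succ, mul_two, sum_range_add, prod_range_succ, ← ih]
    simp only [pow_add]
    rw [← mul_sum]
    ring

/-- Only `-1` being a power of `w` is used, so the ring may have zero divisors. For `z = 2 ^ a * q`
with `q` odd and `a < d`, the geometric sum factors as in `geom_two_pow`, and the factor with index
`d - 1 - a` is `1 + (-1) ^ q = 0`. -/
lemma sum_char_eq {d : ℕ} {w : R} (hd : 1 ≤ d) (hw : w ^ 2 ^ (d - 1) = -1) (z : ℕ) :
    ∑ t ∈ range (2 ^ d), w ^ (t * z) = if 2 ^ d ∣ z then (2 ^ d : R) else 0 := by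
  have hwd : w ^ 2 ^ d = 1 := by
    obtain ⟨e, rfl⟩ := Nat.exists_eq_add_of_le' hd
    rw [Nat.add_sub_cancel] at hw
    rw [pow_succ, pow_mul, hw]; ring
  split_ifs with h
  · obtain ⟨c, rfl⟩ := h
    have : ∀ t ∈ range (2 ^ d), w ^ (t * (2 ^ d * c)) = 1 := fun t _ => by
      rw [show t * (2 ^ d * c) = 2 ^ d * (t * c) by ring, pow_mul, hwd, one_pow]
    rw [sum_congr rfl this]
    simp
  · have hz : z ≠ 0 := fun h0 => h (h0 ▸ dvd_zero _)
    obtain ⟨a, q, hq, rfl⟩ := Nat.exists_eq_two_pow_mul_odd hz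
    have had : a < d := by
      by_contra hcon
      exact h (Dvd.dvd.mul_right (pow_dvd_pow 2 (by omega)) q)
    simp only [mul_comm _ (2 ^ a * q), pow_mul]
    rw [geom_two_pow, prod_eq_zero (mem_range.2 (show d - 1 - a < d by omega))]
    rw [← pow_mul, ← pow_mul, show 2 ^ a * (q * 2 ^ (d - 1 - a)) = 2 ^ (d - 1) * q by
      rw [mul_left_comm, ← pow_add, mul_comm]; congr 2; omega, pow_mul, hw, hq.neg_one_pow]
    ring

/-- Splitting off the leading digit of `y` separates the sum, so the character sum over codes is a
product of one-digit sums. -/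
lemma sum_char_dig (D n : ℕ) (hD : 0 < D) (w : R) (z : ℕ → ℕ) :
    ∑ y ∈ range (D ^ n), w ^ (∑ i ∈ range n, dig D i y * z i) =
      ∏ i ∈ range n, ∑ t ∈ range D, w ^ (t * z i) := by
  induction n with
  | zero => simp
  | succ n ih =>
    rw [prod_range_succ, ← ih, pow_succ', sum_range_mul_eq, sum_comm, sum_mul]
    refine sum_congr rfl fun y hy => ?_
    rw [mul_sum]
    refine sum_congr rfl fun t ht => ?_
    rw [mem_range] at hy ht
    rw [sum_range_succ, pow_add]
    congr 1
    · congr 1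
      refine sum_congr rfl fun i hi => ?_
      rw [← dig_mod (mem_range.1 hi) (x := t * D ^ n + y), Nat.add_comm (t * D ^ n),
        Nat.add_mul_mod_self_right, Nat.mod_eq_of_lt hy]
    · rw [dig, mul_comm t, Nat.mul_add_div (by positivity), Nat.div_eq_of_lt hy, add_zero,
        Nat.mod_eq_of_lt ht]

/-- Orthogonality of characters. -/
lemma sum_kernel {d n : ℕ} {w : R} (hd : 1 ≤ d) (hw : w ^ 2 ^ (d - 1) = -1) {u v : ℕ}
    (hu : u < (2 ^ d) ^ n) (hv : v < (2 ^ d) ^ n) :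
    ∑ y ∈ range ((2 ^ d) ^ n), w ^ (dot (2 ^ d) n y u + (2 ^ d - 1) * dot (2 ^ d) n y v) =
      if u = v then (((2 ^ d) ^ n : ℕ) : R) else 0 := by
  have hpos : 0 < 2 ^ d := by positivity
  have h1 : ∀ y, dot (2 ^ d) n y u + (2 ^ d - 1) * dot (2 ^ d) n y v =
      ∑ i ∈ range n, dig (2 ^ d) i y * (dig (2 ^ d) i u + (2 ^ d - 1) * dig (2 ^ d) i v) := by
    intro y
    rw [dot, dot, mul_sum, ← sum_add_distrib]
    exact sum_congr rfl fun i _ => by ring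
  simp only [h1]
  rw [sum_char_dig (2 ^ d) n hpos w
    fun i => dig (2 ^ d) i u + (2 ^ d - 1) * dig (2 ^ d) i v]
  simp only [sum_char_eq hd hw]
  -- The factor `2 ^ d - 1` stands for `-1` in the exponent, and two digits that are congruent
  -- modulo the base are equal.
  have h2 : ∀ i, (2 ^ d ∣ dig (2 ^ d) i u + (2 ^ d - 1) * dig (2 ^ d) i v) ↔
      dig (2 ^ d) i u = dig (2 ^ d) i v := by
    intro i
    have ha := dig_lt hpos i u
    have hb := dig_lt hpos i v
    set a := dig (2 ^ d) i u
    set b := dig (2 ^ d) i v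
    generalize 2 ^ d = D at *
    have h3 : (D ∣ a + (D - 1) * b) ↔ (D : ℤ) ∣ a - b := by
      rw [← Int.natCast_dvd_natCast]
      push_cast [Nat.cast_sub (show 1 ≤ D by omega)]
      rw [show (a : ℤ) + (D - 1) * b = (a - b) + D * b by ring]
      exact dvd_add_left (Dvd.intro _ rfl)
    rw [h3]
    constructor
    · intro h
      have := Int.eq_zero_of_abs_lt_dvd h (by rw [abs_lt]; omega)
      omega
    · intro h; simp [h]
  simp only [h2]
  split_ifs with h
  · subst h; simp
  · have : ∃ i < n, dig (2 ^ d) i u ≠ dig (2 ^ d) i v := by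
      by_contra! hcon
      exact h (dig_ext hu hv hcon)
    obtain ⟨i, hi, hne⟩ := this
    exact prod_eq_zero (mem_range.2 hi) (by simp [hne])

lemma dot_add {D n y u v : ℕ} (hu : u < D ^ n) (hv : v < D ^ n) (h1 : Half D n u)
    (h2 : Half D n v) : dot D n y (u + v) = dot D n y u + dot D n y v := by
  simp only [dot]
  rw [← sum_add_distrib]
  refine sum_congr rfl fun i hi => ?_
  rw [dig_add hu hv (h1.add_lt h2) (mem_range.1 hi), mul_add]

/-- The number of pairs counted by the restricted convolution. -/
def pairCount (g : ℕ → ℕ) (P N tag ks v : ℕ) : ℕ :=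
  ∑ low ∈ range N, if tag * N + low ≤ ks ∧ ks - (tag * N + low) < P * N then
    ∑ u₁ ∈ range N, ∑ u₂ ∈ range N, if u₁ + u₂ = v then
      g ((tag * N + low) * N + u₁) * g ((ks - (tag * N + low)) * N + u₂) else 0 else 0

lemma index_lt {a b i j : ℕ} (hi : i < a) (hj : j < b) : i * b + j < a * b := by
  calc i * b + j < i * b + b := by omega
    _ = (i + 1) * b := by ring
    _ ≤ a * b := Nat.mul_le_mul_right _ hi

/-- For given `low` and `u₁` the value `v` leaves at most one choice of `u₂`. -/
lemma pairCount_le {g : ℕ → ℕ} {P N tag ks v : ℕ} (htag : tag < P)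
    (hg : ∀ X < P * N * N, g X ≤ 1) : pairCount g P N tag ks v ≤ N * N := by
  have h1 : ∀ low ∈ range N, (if tag * N + low ≤ ks ∧ ks - (tag * N + low) < P * N then
      ∑ u₁ ∈ range N, ∑ u₂ ∈ range N, if u₁ + u₂ = v then
        g ((tag * N + low) * N + u₁) * g ((ks - (tag * N + low)) * N + u₂) else 0 else 0) ≤ N := by
    intro low hlow
    split_ifs with hc
    · refine (sum_le_card_nsmul (range N) _ 1 fun u₁ hu₁ => ?_).trans (by simp)
      calc _ ≤ ∑ u₂ ∈ range N, if u₂ = v - u₁ then 1 else 0 := by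
            refine sum_le_sum fun u₂ hu₂ => ?_
            rw [mem_range] at hu₁ hu₂ hlow
            split_ifs with h h'
            · exact Nat.mul_le_mul (hg _ (index_lt (index_lt htag hlow) hu₁))
                (hg _ (index_lt hc.2 hu₂))
            · omega
            · omega
            · exact le_rfl
        _ ≤ 1 := by
            rw [sum_ite_eq']; split_ifs <;> omega
    · omega
  refine (sum_le_card_nsmul _ _ N h1).trans (by simp)

lemma pairCount_ne_zero_iff {g : ℕ → ℕ} {P N tag ks v : ℕ} :
    pairCount g P N tag ks v ≠ 0 ↔ ∃ low < N, ∃ u₁ < N, ∃ u₂ < N, tag * N + low ≤ ks ∧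
      ks - (tag * N + low) < P * N ∧ g ((tag * N + low) * N + u₁) ≠ 0 ∧
      g ((ks - (tag * N + low)) * N + u₂) ≠ 0 ∧ u₁ + u₂ = v := by
  rw [pairCount, Ne, sum_eq_zero_iff]
  push Not
  simp only [mem_range]
  refine exists_congr fun low => and_congr_right fun _ => ?_
  split_ifs with hc
  · rw [Ne, sum_eq_zero_iff]
    push Not
    simp only [mem_range]
    refine exists_congr fun u₁ => and_congr_right fun _ => ?_
    rw [Ne, sum_eq_zero_iff]
    push Not
    simp only [mem_range]
    refine exists_congr fun u₂ => and_congr_right fun _ => ?_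
    split_ifs with h
    · simp only [h, hc, Ne, mul_eq_zero, not_or, and_true, true_and]
    · simp [h]
  · simp only [ne_eq, not_true_eq_false, false_iff]
    rintro ⟨_, _, _, _, h1, h2, _⟩
    exact hc ⟨h1, h2⟩

/-- By orthogonality the inverse transform yields `N * pairCount` in `ZMod M`. The factor `N` can be
cancelled because `D` is coprime to `D ^ r + 1`, and the count is at most `N * N ≤ D ^ r < M`, so
its residue vanishes only if the count does. Primality of `M` plays no role. The tag of the first
summand stays fixed, so the result still tells which tags occur. -/
theorem conv_ne_zero_iff {d n r τ P : ℕ} (hd : 1 ≤ d) (hr : τ * 2 ^ (d - 1) = r) (hr1 : 1 ≤ r)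
    (hn : 2 * n ≤ r) {D N M : ℕ} (hD : D = 2 ^ d) (hN : N = D ^ n) (hM : M = D ^ r + 1)
    {g e e' hat S : ℕ → ℕ}
    (he : ∀ y < N, ∀ u < N, (e (y * N + u) : ZMod M) = ((D : ZMod M) ^ τ) ^ dot D n y u)
    (he' : ∀ y < N, ∀ u < N,
      (e' (y * N + u) : ZMod M) = ((D : ZMod M) ^ τ) ^ ((D - 1) * dot D n y u))
    (hhat : ∀ key < P * N, ∀ y < N,
      hat (key * N + y) = (∑ u ∈ range N, g (key * N + u) * e (y * N + u)) % M)
    (hS : ∀ tag < P, ∀ ks < 2 * P * N, ∀ y < N, S ((tag * (2 * P * N) + ks) * N + y) =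
      (∑ low ∈ range N, if tag * N + low ≤ ks ∧ ks - (tag * N + low) < P * N then
        hat ((tag * N + low) * N + y) * hat ((ks - (tag * N + low)) * N + y) else 0) % M)
    (hg : ∀ X < P * N * N, g X ≤ 1) (hhalf : ∀ X < P * N * N, g X ≠ 0 → Half D n (X % N))
    {tag ks v : ℕ} (htag : tag < P) (hks : ks < 2 * P * N) (hv : v < N) :
    (∑ y ∈ range N, S ((tag * (2 * P * N) + ks) * N + y) * e' (y * N + v)) % M ≠ 0 ↔
      pairCount g P N tag ks v ≠ 0 := by
  set w : ZMod M := (D : ZMod M) ^ τ with hwdef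
  have hw : w ^ 2 ^ (d - 1) = -1 := by
    rw [hwdef, ← pow_mul, hr]
    have : ((D ^ r + 1 : ℕ) : ZMod M) = 0 := by rw [← hM]; simp
    push_cast at this
    linear_combination this
  have hcast : ∀ x : ℕ, ((x % M : ℕ) : ZMod M) = x := fun x => ZMod.natCast_mod x M
  have hhat' : ∀ key < P * N, ∀ y < N, (hat (key * N + y) : ZMod M) =
      ∑ u ∈ range N, (g (key * N + u) : ZMod M) * w ^ dot D n y u := by
    intro key hkey y hy
    rw [hhat key hkey y hy, hcast]
    push_cast
    exact sum_congr rfl fun u hu => by rw [he y hy u (mem_range.1 hu)]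
  have key : ((∑ y ∈ range N, S ((tag * (2 * P * N) + ks) * N + y) * e' (y * N + v) : ℕ) : ZMod M) =
      ((N * pairCount g P N tag ks v : ℕ) : ZMod M) := by
    have h1 : ∀ y ∈ range N,
        ((S ((tag * (2 * P * N) + ks) * N + y) * e' (y * N + v) : ℕ) : ZMod M) =
        ∑ low ∈ range N, if tag * N + low ≤ ks ∧ ks - (tag * N + low) < P * N then
          ∑ u₁ ∈ range N, ∑ u₂ ∈ range N, ((g ((tag * N + low) * N + u₁) : ZMod M) *
            (g ((ks - (tag * N + low)) * N + u₂) : ZMod M)) *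
            w ^ (dot D n y u₁ + dot D n y u₂ + (D - 1) * dot D n y v) else 0 := by
      intro y hy
      rw [mem_range] at hy
      rw [Nat.cast_mul, hS tag htag ks hks y hy, hcast, he' y hy v hv]
      push_cast
      rw [sum_mul]
      refine sum_congr rfl fun low hlow => ?_
      split_ifs with hc
      · rw [hhat' _ (index_lt htag (mem_range.1 hlow)) y hy, hhat' _ hc.2 y hy, sum_mul_sum,
          sum_mul]
        refine sum_congr rfl fun u₁ _ => ?_
        rw [sum_mul]
        refine sum_congr rfl fun u₂ _ => ?_
        rw [pow_add, pow_add]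
        ring
      · simp
    rw [Nat.cast_sum, sum_congr rfl h1, sum_comm, pairCount]
    push_cast
    rw [mul_sum]
    refine sum_congr rfl fun low hlow => ?_
    rw [mem_range] at hlow
    split_ifs with hc
    · rw [sum_comm, mul_sum]
      refine sum_congr rfl fun u₁ hu₁ => ?_
      rw [sum_comm, mul_sum]
      refine sum_congr rfl fun u₂ hu₂ => ?_
      rw [mem_range] at hu₁ hu₂
      rw [← mul_sum]
      -- Only marked cells contribute. Their digits are below half of the base, so `dot` is additive
      -- on them and the orthogonality relation applies to `u₁ + u₂`.
      by_cases h0 : g ((tag * N + low) * N + u₁) ≠ 0 ∧ g ((ks - (tag * N + low)) * N + u₂) ≠ 0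
      · have e1 := hhalf _ (index_lt (index_lt htag hlow) hu₁) h0.1
        have e2 := hhalf _ (index_lt hc.2 hu₂) h0.2
        rw [Nat.mul_add_mod_self_right, Nat.mod_eq_of_lt hu₁] at e1
        rw [Nat.mul_add_mod_self_right, Nat.mod_eq_of_lt hu₂] at e2
        have e3 : ∀ y, dot D n y u₁ + dot D n y u₂ = dot D n y (u₁ + u₂) := fun y =>
          (dot_add (hN ▸ hu₁) (hN ▸ hu₂) e1 e2).symm
        have e4 : u₁ + u₂ < D ^ n := add_lt_of_dig (hN ▸ hu₁) (hN ▸ hu₂) (e1.add_lt e2)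
        simp only [e3]
        have := sum_kernel (n := n) hd hw (hD ▸ e4) (hD ▸ hN ▸ hv)
        rw [← hD, ← hN] at this
        rw [this]
        split_ifs <;> ring
      · have : (g ((tag * N + low) * N + u₁) : ZMod M) *
            (g ((ks - (tag * N + low)) * N + u₂) : ZMod M) = 0 := by
          by_cases h1 : g ((tag * N + low) * N + u₁) = 0
          · simp [h1]
          · have h2 : g ((ks - (tag * N + low)) * N + u₂) = 0 := by tauto
            simp [h2]
        rw [this]
        simp
    · simp
  have hcop : Nat.Coprime M N := by
    rw [hM, hN]
    refine Nat.Coprime.pow_right n ?_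
    obtain ⟨r', rfl⟩ := Nat.exists_eq_add_of_le' hr1
    rw [pow_succ', Nat.coprime_comm, Nat.coprime_mul_left_add_right]
    exact Nat.coprime_one_right D
  have hlt : pairCount g P N tag ks v < M := by
    refine (pairCount_le htag hg).trans_lt ?_
    rw [hM, hN, ← pow_add, ← two_mul]
    exact Nat.lt_succ_of_le (Nat.pow_le_pow_right (by rw [hD]; positivity) hn)
  rw [not_iff_not, ← Nat.dvd_iff_mod_eq_zero, ← ZMod.natCast_eq_zero_iff, key,
    ZMod.natCast_eq_zero_iff, hcop.dvd_mul_left]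
  exact ⟨fun h => Nat.eq_zero_of_dvd_of_lt h hlt, fun h => h ▸ dvd_zero _⟩

/-- No carry passes from the lowest block of digits into the keys, so adding keys and blocks
separately is the same as adding whole indices. This turns the transform into a statement on sumsets
of integers. -/
lemma pairCount_ne_zero_iff_index {g : ℕ → ℕ} {P N tag ks v D n : ℕ} (hN : N = D ^ n)
    (htag : tag < P) (hv : v < N)
    (hhalf : ∀ X < P * N * N, g X ≠ 0 → Half D n (X % N)) :
    pairCount g P N tag ks v ≠ 0 ↔ ∃ z < N * N, tag * (N * N) + z ≤ ks * N + v ∧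
      ks * N + v - (tag * (N * N) + z) < P * N * N ∧ g (tag * (N * N) + z) ≠ 0 ∧
      g (ks * N + v - (tag * (N * N) + z)) ≠ 0 := by
  rw [pairCount_ne_zero_iff]
  constructor
  · rintro ⟨low, hlow, u₁, hu₁, u₂, hu₂, h1, h2, h3, h4, h5⟩
    have e1 : tag * (N * N) + (low * N + u₁) = (tag * N + low) * N + u₁ := by ring
    obtain ⟨c, hc⟩ := Nat.exists_eq_add_of_le h1
    have e2 : ks * N + v = (tag * N + low) * N + u₁ + (c * N + u₂) := by
      rw [hc, ← h5]; ring
    have e3 : ks - (tag * N + low) = c := by omega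
    rw [e3] at h2 h4
    refine ⟨low * N + u₁, index_lt hlow hu₁, ?_⟩
    rw [e1, e2, Nat.add_sub_cancel_left]
    exact ⟨by omega, index_lt h2 hu₂, h3, h4⟩
  · rintro ⟨z, hz, h1, h2, h3, h4⟩
    have hN0 : 0 < N := by omega
    set X₂ := ks * N + v - (tag * (N * N) + z) with hX₂
    have hlow : z / N < N := Nat.div_lt_of_lt_mul hz
    have hu₁ : z % N < N := Nat.mod_lt _ hN0
    have hz' := Nat.div_add_mod z N
    have hX' := Nat.div_add_mod X₂ N
    have hu₂ : X₂ % N < N := Nat.mod_lt _ hN0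
    have e1 : tag * (N * N) + z = (tag * N + z / N) * N + z % N := by
      conv_lhs => rw [← hz']
      ring
    have hX₂lt : X₂ / N < P * N := Nat.div_lt_of_lt_mul (by rw [mul_comm]; exact h2)
    have g1 := hhalf _ (by rw [e1]; exact index_lt (index_lt htag hlow) hu₁) h3
    have g2 := hhalf _ h2 h4
    rw [e1, Nat.mul_add_mod_self_right, Nat.mod_mod] at g1
    have hlt : z % N + X₂ % N < N := by
      rw [hN]
      exact add_lt_of_dig (by rw [← hN]; exact hu₁) (by rw [← hN]; exact hu₂)
        (by rw [← hN]; exact g1.add_lt g2)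
    have e2 : ks * N + v = (tag * N + z / N + X₂ / N) * N + (z % N + X₂ % N) := by
      have : ks * N + v = (tag * (N * N) + z) + X₂ := by omega
      rw [this, e1]
      conv_lhs => rw [← hX']
      ring
    have e3 : ks = tag * N + z / N + X₂ / N := by
      have := congrArg (· / N) e2
      simpa [Nat.mul_add_div, Nat.div_eq_of_lt hv, Nat.div_eq_of_lt hlt, mul_comm _ N,
        Nat.mul_add_div hN0] using this
    have e4 : v = z % N + X₂ % N := by rw [e3] at e2; omega
    have e5 : ks - (tag * N + z / N) = X₂ / N := Nat.sub_eq_of_eq_add' e3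
    refine ⟨z / N, hlow, z % N, hu₁, X₂ % N, hu₂, e3 ▸ Nat.le_add_right _ _, by rw [e5]; exact hX₂lt, ?_, ?_,
      e4.symm⟩
    · rw [← e1]; exact h3
    · rw [e5, mul_comm, hX']; exact h4

end Convolution

end NDColoring

namespace NDColoring

/-! ### Colourings and covers -/

section Colorings

open Finset
open scoped Classical

variable {V : Type u} {G : SimpleGraph V} {k : ℕ}

/-- The number of colours a class needs. -/
noncomputable def NDDecomposition.demand (D : NDDecomposition G k) (i : Fin k) : ℕ :=
  if G.IsClique (D.cls i) then (D.cls i).ncard else 1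

lemma NDDecomposition.adj_iff (D : NDDecomposition G k) {u v : V} (h : D.part u ≠ D.part v) :
    D.typeGraph.Adj (D.part u) (D.part v) ↔ G.Adj u v := by
  simp only [typeGraph, if_neg h]
  refine ⟨fun H => H u rfl v rfl, fun H u' hu' v' hv' => ?_⟩
  rcases D.uniform _ _ h with h1 | h1
  · exact h1 u' v' hu' hv'
  · exact absurd H (h1 u v rfl rfl)

/-- The colours available to class `i`. -/
def Avail (L : List (Finset (Fin k))) (i : Fin k) (c : ℕ) : Prop := ∃ S, L[c]? = some S ∧ i ∈ S

lemma count_avail (L : List (Finset (Fin k))) (i : Fin k) :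
    Nat.count (Avail L i) L.length = L.countP (i ∈ ·) := by
  induction L with
  | nil => simp
  | cons a L ih =>
    rw [List.length_cons, Nat.count_succ', List.countP_cons, ← ih]
    congr 1
    · simp [Avail]

lemma avail_lt {L : List (Finset (Fin k))} {i : Fin k} {c : ℕ} (h : Avail L i c) :
    c < L.length := by
  obtain ⟨S, hS, -⟩ := h
  exact (List.getElem?_eq_some_iff.1 hS).1

lemma avail_finite (L : List (Finset (Fin k))) (i : Fin k) : (Set.ofPred (Avail L i)).Finite :=
  (Set.finite_lt_nat L.length).subset fun _ hc => avail_lt hc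

lemma card_avail (L : List (Finset (Fin k))) (i : Fin k) :
    #(avail_finite L i).toFinset = L.countP (i ∈ ·) := by
  rw [← count_avail, Nat.count_eq_card_filter_range]
  congr 1
  ext c
  simp only [Set.Finite.mem_toFinset, mem_filter, mem_range]
  exact ⟨fun h => ⟨avail_lt h, h⟩, fun h => h.2⟩

/-! ### Decoding a list of colors into a proper coloring -/

section Order

variable [Fintype V] [LinearOrder V]

lemma NDDecomposition.rank_lt (D : NDDecomposition G k) (v : V) :
    D.rank v < D.demand (D.part v) := by
  unfold rank demand
  split_ifs with h
  · refine Set.ncard_lt_ncard ?_ (Set.toFinite _)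
    refine ⟨fun u hu => hu.2, fun hcon => ?_⟩
    exact absurd (hcon (show v ∈ D.cls (D.part v) from rfl)).1 (lt_irrefl v)
  · omega

lemma NDDecomposition.rank_lt_rank (D : NDDecomposition G k) {u v : V} (huv : u < v)
    (hp : D.part u = D.part v) (hc : G.IsClique (D.cls (D.part v))) : D.rank u < D.rank v := by
  unfold rank
  rw [hp, if_pos hc, if_pos hc]
  refine Set.ncard_lt_ncard ?_ (Set.toFinite _)
  refine ⟨fun w hw => ⟨hw.1.trans huv, hw.2⟩, fun hcon => ?_⟩
  exact absurd (hcon (And.intro huv hp : u < v ∧ D.part u = D.part v)).1 (lt_irrefl u)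

lemma NDDecomposition.decode_avail (D : NDDecomposition G k) {L : List (Finset (Fin k))}
    (hL : ∀ i, D.demand i ≤ L.countP (i ∈ ·)) (v : V) : Avail L (D.part v) (D.decode L v) :=
  have h : D.rank v < #(avail_finite L (D.part v)).toFinset := by
    rw [card_avail]; exact (D.rank_lt v).trans_le (hL _)
  Nat.nth_mem_of_lt_card (avail_finite L (D.part v)) h

/-- Inside a clique class the ranks are distinct and `Nat.nth` is injective on them. Between
classes, a common color would place two adjacent types in one independent set. -/
lemma NDDecomposition.decode_ne (D : NDDecomposition G k) {L : List (Finset (Fin k))}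
    (hL : ∀ i, D.demand i ≤ L.countP (i ∈ ·)) (hI : ∀ S ∈ L, D.typeGraph.IsIndep S) {u v : V}
    (huv : G.Adj u v) : D.decode L u ≠ D.decode L v := by
  intro heq
  by_cases hp : D.part u = D.part v
  · have hcl : G.IsClique (D.cls (D.part v)) := by
      refine (D.homogeneous (D.part v)).resolve_right fun h => ?_
      exact h (show u ∈ {w | D.part w = D.part v} from hp)
        (show v ∈ {w | D.part w = D.part v} from rfl) huv.ne huv
    have hinj := Nat.nth_injOn (avail_finite L (D.part v))
    have hmem : ∀ w, D.part w = D.part v →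
        D.rank w ∈ Set.Iio #(avail_finite L (D.part v)).toFinset := fun w hw => by
      rw [card_avail, Set.mem_Iio]
      have := D.rank_lt w
      rw [hw] at this
      exact this.trans_le (hL _)
    have h1 : D.rank u = D.rank v := by
      refine hinj (hmem u hp) (hmem v rfl) ?_
      have : D.decode L u = Nat.nth (Avail L (D.part v)) (D.rank u) := by
        unfold decode; rw [hp]; rfl
      rw [← this, heq]; rfl
    rcases lt_trichotomy u v with h | h | h
    · exact absurd h1 (D.rank_lt_rank h hp hcl).ne
    · exact huv.ne h
    · exact absurd h1 (D.rank_lt_rank h hp.symm (hp ▸ hcl)).ne'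
  · obtain ⟨S, hS, huS⟩ := D.decode_avail hL u
    obtain ⟨S', hS', hvS'⟩ := D.decode_avail hL v
    rw [heq, hS', Option.some_inj] at hS
    subst hS
    exact hI S' (List.mem_of_getElem? hS') _ huS _ hvS' hp ((D.adj_iff hp).2 huv)

lemma NDDecomposition.decode_lt (D : NDDecomposition G k) {L : List (Finset (Fin k))}
    (hL : ∀ i, D.demand i ≤ L.countP (i ∈ ·)) (v : V) : D.decode L v < L.length :=
  avail_lt (D.decode_avail hL v)

end Order

/-! ### Chromatic number, cover number and the integer program -/

variable [Fintype V]

lemma NDDecomposition.one_le_ncard (D : NDDecomposition G k) (i : Fin k) :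
    1 ≤ (D.cls i).ncard := by
  obtain ⟨v, hv⟩ := D.surj i
  exact (Set.ncard_pos (Set.toFinite _)).2 ⟨v, hv⟩

lemma NDDecomposition.demand_le (D : NDDecomposition G k) (i : Fin k) :
    1 ≤ D.demand i ∧ D.demand i ≤ (D.cls i).ncard := by
  unfold demand
  have := D.one_le_ncard i
  split_ifs <;> omega

lemma NDDecomposition.sum_ncard (D : NDDecomposition G k) :
    ∑ i, (D.cls i).ncard = Fintype.card V := by
  rw [← card_univ, card_eq_sum_card_fiberwise (f := D.part) (t := univ) (by simp)]
  refine sum_congr rfl fun i _ => ?_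
  rw [← Set.ncard_coe_finset]
  congr 1
  ext v
  simp [cls]

lemma NDDecomposition.colorable_of_cov (D : NDDecomposition G k) {q : ℕ}
    (h : Cov D.typeGraph (fun i => D.demand i) q) : G.Colorable q := by
  -- Colorability does not involve an order; any order serves for the ranks.
  let _ : LinearOrder V := LinearOrder.lift' (Fintype.equivFin V) (Fintype.equivFin V).injective
  obtain ⟨x, h1, h2, h3⟩ := h
  let L : List (Finset (Fin k)) :=
    (univ : Finset (Finset (Fin k))).toList.flatMap fun I => List.replicate (x I) I
  have hlen : L.length = ∑ I, x I := by
    simp only [L, List.length_flatMap, List.length_replicate]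
    exact sum_map_toList _ _
  have hL : ∀ i, D.demand i ≤ L.countP (i ∈ ·) := fun i => by
    have : L.countP (i ∈ ·) = ∑ I with i ∈ I, x I := by
      simp only [L, List.countP_flatMap, sum_filter]
      rw [← sum_map_toList]
      congr 1
      refine List.map_congr_left fun I _ => ?_
      simp [List.countP_replicate]
    rw [this]
    exact Nat.cast_le.1 (h3 i)
  have hI : ∀ S ∈ L, D.typeGraph.IsIndep S := fun S hS => by
    simp only [L, List.mem_flatMap, List.mem_replicate] at hS
    obtain ⟨I, -, h, rfl⟩ := hS
    exact h1 S h
  exact SimpleGraph.Colorable.mono (hlen ▸ h2) ⟨SimpleGraph.Coloring.mk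
    (fun v => (⟨D.decode L v, D.decode_lt hL v⟩ : Fin L.length)) fun {u v} huv h =>
      D.decode_ne hL hI huv (congrArg Fin.val h)⟩

/-- Each color determines the set of classes in which it occurs, which is independent. A clique
class meets as many colors as it has vertices, and every class meets at least one. -/
lemma NDDecomposition.cov_of_colorable (D : NDDecomposition G k) {q : ℕ} (h : G.Colorable q) :
    Cov D.typeGraph (fun i => D.demand i) q := by
  obtain ⟨C⟩ := h
  let F : Fin q → Finset (Fin k) := fun c => univ.filter fun i => ∃ v, D.part v = i ∧ C v = c
  have hF : ∀ c, D.typeGraph.IsIndep (F c) := by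
    intro c i hi j hj hij
    simp only [F, mem_filter, mem_univ, true_and] at hi hj
    obtain ⟨u, rfl, hu⟩ := hi
    obtain ⟨v, rfl, hv⟩ := hj
    rw [D.adj_iff hij]
    exact fun hadj => C.valid hadj (hu.trans hv.symm)
  refine ⟨fun I => #{c | F c = I}, fun I hI => ?_, ?_, fun i => ?_⟩
  · obtain ⟨c, hc⟩ := card_ne_zero.1 hI
    rw [← (mem_filter.1 hc).2]
    exact hF c
  · rw [← card_eq_sum_card_fiberwise (f := F) (s := univ) (t := univ) (by simp)]
    simp
  · have h1 : ∑ I with i ∈ I, #{c | F c = I} = #{c | i ∈ F c} := by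
      rw [card_eq_sum_card_fiberwise (f := F) (s := univ.filter fun c => i ∈ F c)
        (t := univ.filter fun I => i ∈ I) (by intro c; simp)]
      refine sum_congr rfl fun I hI => ?_
      congr 1
      ext c
      simp only [mem_filter, mem_univ, true_and] at hI ⊢
      constructor
      · rintro rfl; exact ⟨hI, rfl⟩
      · exact fun h => h.2
    simp only [h1, Nat.cast_le]
    have h2 : #{c | i ∈ F c} = (C '' D.cls i).ncard := by
      rw [← Set.ncard_coe_finset]
      congr 1
      ext c
      simp [F, cls]
    rw [h2]
    unfold demand
    split_ifs with hc
    · rw [Set.InjOn.ncard_image]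
      intro u hu v hv huv
      by_contra hne
      exact C.valid (hc hu hv hne) huv
    · obtain ⟨v, hv⟩ := D.surj i
      exact (Set.ncard_pos (Set.toFinite _)).2 ⟨C v, v, hv, rfl⟩

theorem NDDecomposition.chromaticNumber_eq (D : NDDecomposition G k) :
    G.chromaticNumber = (cn D.typeGraph (fun i => D.demand i) : ℕ) := by
  refine le_antisymm (D.colorable_of_cov (cov_cn _)).chromaticNumber_le ?_
  obtain ⟨n, hn⟩ := ENat.ne_top_iff_exists.1
    (SimpleGraph.chromaticNumber_ne_top_iff_exists.2 ⟨_, D.colorable_of_cov (cov_cn _)⟩)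
  rw [← hn]
  exact_mod_cast cov_iff.1 (D.cov_of_colorable
    (SimpleGraph.chromaticNumber_le_iff_colorable.1 hn.symm.le))

theorem NDDecomposition.isLeast_ipValues (D : NDDecomposition G k) :
    IsLeast D.ipValues G.chromaticNumber := by
  rw [D.chromaticNumber_eq]
  constructor
  · obtain ⟨x, h1, h2, h3⟩ := cov_cn (T := D.typeGraph) (fun i => (D.demand i : ℤ))
    have hsum := h2.antisymm (cn_le_of_le_sum h1 h3)
    -- Every set of an optimal cover is replaced by a maximal independent set containing it; for
    -- other sets the choice of `J` is irrelevant, as they have multiplicity `0`.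
    have hmax : ∀ I, ∃ J, D.typeGraph.IsIndep I → I ⊆ J ∧ J ∈ D.typeGraph.maxIndep := fun I => by
      by_cases h : D.typeGraph.IsIndep I
      · obtain ⟨J, hJ, hJ'⟩ := Finite.exists_le_maximal h
        exact ⟨J, fun _ => ⟨hJ, by simp [TypeGraph.maxIndep, hJ']⟩⟩
      · exact ⟨∅, fun h' => absurd h' h⟩
    choose J hJ using hmax
    let y : Finset (Fin k) → ℕ := fun K => ∑ I with J I = K, x I
    have hcover : ∀ i, D.demand i ≤ ∑ K ∈ D.typeGraph.maxIndep with i ∈ K, y K := fun i => by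
      have hi : D.demand i ≤ ∑ I with i ∈ I, x I := Nat.cast_le.1 (h3 i)
      refine hi.trans ?_
      simp only [y]
      rw [sum_comm' (t' := univ.filter fun I => J I ∈ D.typeGraph.maxIndep ∧ i ∈ J I)
        (s' := fun I => {J I})]
      · simp only [sum_singleton]
        refine (sum_le_sum_of_ne_zero fun I hI hx => ?_)
        rw [mem_filter] at hI ⊢
        obtain ⟨hs, hm⟩ := hJ I (h1 I hx)
        exact ⟨mem_univ _, hm, hs hI.2⟩
      · intro K I
        simp only [mem_filter, mem_univ, true_and, mem_singleton]
        constructor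
        · rintro ⟨⟨ha, hb⟩, rfl⟩; exact ⟨rfl, ha, hb⟩
        · rintro ⟨rfl, ha, hb⟩; exact ⟨⟨ha, hb⟩, rfl⟩
    -- For independent classes `1 ≤ demand` is enough; this includes singletons, which are cliques
    -- as well.
    refine ⟨y, ⟨fun i hi => ?_, fun i _ => (D.demand_le i).1.trans (hcover i)⟩, ?_⟩
    · have := hcover i
      rwa [demand, if_pos hi] at this
    · rw [← hsum]
      congr 1
      simp only [y]
      rw [sum_comm' (t' := univ.filter fun I => J I ∈ D.typeGraph.maxIndep)
        (s' := fun I => {J I})]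
      · simp only [sum_singleton]
        symm
        refine sum_subset (filter_subset _ _) fun I _ hI => ?_
        by_contra hx
        exact hI (mem_filter.2 ⟨mem_univ _, (hJ I (h1 I hx)).2⟩)
      · intro K I
        simp only [mem_filter, mem_univ, true_and, mem_singleton]
        constructor
        · rintro ⟨ha, rfl⟩; exact ⟨rfl, ha⟩
        · rintro ⟨rfl, ha⟩; exact ⟨ha, rfl⟩
  · rintro m ⟨x, ⟨hx1, hx2⟩, rfl⟩
    norm_cast
    refine cov_iff.1 ⟨fun I => if I ∈ D.typeGraph.maxIndep then x I else 0, fun I hI => ?_, ?_,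
      fun i => ?_⟩
    · by_cases h : I ∈ D.typeGraph.maxIndep
      · exact (mem_filter.1 h).2.prop
      · simp [h] at hI
    · rw [sum_ite_mem, univ_inter]
    · have : ∑ I with i ∈ I, (if I ∈ D.typeGraph.maxIndep then x I else 0) =
          ∑ I ∈ D.typeGraph.maxIndep with i ∈ I, x I := by
        rw [← sum_filter]
        congr 1
        ext I; simp [and_comm]
      simp only [this, Nat.cast_le]
      unfold demand
      split_ifs with hc
      · exact hx1 i hc
      · exact hx2 i ((D.homogeneous i).resolve_left hc)

end Colorings

end NDColoring

namespace NDColoring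

/-! ### The levels of the dynamic program -/

section Levels

open Finset

variable {k : ℕ}

lemma dig_zero (D i : ℕ) : dig D i 0 = 0 := by simp [dig]

/-- The parameters of the dynamic program: the type graph, the demands `b`, the quarter `H` of the
base, the number `L` of levels and a bound `n` on the total demand. -/
structure Setup (k : ℕ) where
  T : TypeGraph k
  b : ℕ → ℕ
  H : ℕ
  L : ℕ
  n : ℕ

namespace Setup

variable (A : Setup k)

/-- The base of the digit representation. -/
def D : ℕ := 4 * A.H

/-- The number of relative costs. -/
def R : ℕ := k * A.D + 2

/-- The number of boxed vectors. -/
def Z : ℕ := A.D ^ k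

/-- The vector represented by `x` at level `l`. -/
def vec (l x : ℕ) : Fin k → ℤ := fun i => (A.b i / 2 ^ (A.L - l) : ℕ) - A.H + dig A.D i x

/-- The cover number of the vector represented by `x` at level `l`. -/
noncomputable def f (l x : ℕ) : ℕ := cn A.T (A.vec l x)

/-- The least cover number at level `l`. -/
noncomputable def m (l : ℕ) : ℕ := A.f l 0

/-- The digits of the offset between the levels `l` and `l + 1`. -/
def off (l i : ℕ) : ℕ := A.H + A.b i / 2 ^ (A.L - (l + 1)) % 2

/-- The offset between the levels `l` and `l + 1`. -/
def del (l : ℕ) : ℕ := ∑ i ∈ range k, A.off l i * A.D ^ i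

/-- Admissibility of the parameters. -/
structure Good : Prop where
  pos : 1 ≤ k
  large : 40 ^ 16 * k ^ 9 ≤ (A.H - 2) ^ 16
  two : 4 ≤ A.H
  le : ∀ i < k, A.b i ≤ A.n
  sum_le : ∑ i ∈ range k, A.b i ≤ A.n
  one_le : 1 ≤ A.n
  lt : 4 * A.n * A.R < 2 ^ A.L

variable {A} {l x : ℕ}

lemma Good.D_pos (h : A.Good) : 0 < A.D := by have := h.two; unfold D; omega

lemma half_lt (hx : Half A.D k x) {i : ℕ} (hi : i < k) : dig A.D i x < 2 * A.H := by
  have := hx i hi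
  have hD : A.D = 4 * A.H := rfl
  omega

lemma half_zero (h : A.Good) : Half A.D k 0 := fun i _ => by
  rw [dig_zero]; have := h.two; unfold D; omega

lemma Good.m_le_f (_ : A.Good) (l x : ℕ) : A.m l ≤ A.f l x := cn_mono fun i => by
  simp only [vec, dig_zero]; push_cast; omega

lemma Good.sum_dig_le (_ : A.Good) (hx : Half A.D k x) : ∑ i : Fin k, dig A.D i x ≤ k * (2 * A.H) := by
  refine (sum_le_card_nsmul _ _ (2 * A.H) fun i _ => (half_lt hx i.2).le).trans ?_
  simp

lemma Good.f_le (h : A.Good) (l : ℕ) (hx : Half A.D k x) : A.f l x ≤ A.m l + k * (2 * A.H) := by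
  refine (cn_le_add_sum (v := A.vec l 0) (fun i : Fin k => dig A.D i x) fun i => ?_).trans
    (Nat.add_le_add_left (h.sum_dig_le hx) _)
  simp only [vec, dig_zero]; push_cast; omega

lemma b_div (hl : l < A.L) (i : ℕ) : A.b i / 2 ^ (A.L - (l + 1)) =
    2 * (A.b i / 2 ^ (A.L - l)) + A.b i / 2 ^ (A.L - (l + 1)) % 2 := by
  have : A.b i / 2 ^ (A.L - l) = A.b i / 2 ^ (A.L - (l + 1)) / 2 := by
    rw [Nat.div_div_eq_div_mul, ← pow_succ]
    congr 2
    omega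
  omega

/-- Twice the least vector of level `l` falls short of the least vector of level `l + 1` by `H` plus
one binary digit of the demand in each coordinate; singletons cover this deficit. -/
lemma Good.m_succ_le (_ : A.Good) (hl : l < A.L) : A.m (l + 1) ≤ 2 * A.m l + k * (A.H + 1) := by
  have h1 : cn A.T (A.vec l 0 + A.vec l 0) ≤ 2 * A.m l := by
    rw [two_mul]; exact cn_add_le _ _
  refine (cn_le_add_sum (v := A.vec l 0 + A.vec l 0) (fun _ => A.H + 1) fun i => ?_).trans ?_
  · have := b_div hl i
    have h2 : A.b i / 2 ^ (A.L - (l + 1)) % 2 < 2 := Nat.mod_lt _ (by norm_num)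
    simp only [vec, dig_zero, Pi.add_apply]
    omega
  · simp only [sum_const, card_univ, Fintype.card_fin, smul_eq_mul]
    omega

lemma Good.k_H_le (h : A.Good) : k * (2 * A.H) + k * (A.H + 1) + 2 ≤ A.R := by
  have := h.two
  unfold R D
  nlinarith [h.pos]

/-- This justifies the choice of `R`: the costs of level `l + 1`, taken relative to `2 * m l`, stay
within the searched range. -/
lemma Good.f_succ_le (h : A.Good) (hl : l < A.L) (hx : Half A.D k x) : A.f (l + 1) x + 2 ≤ 2 * A.m l + A.R := by
  have := h.f_le (l + 1) hx
  have := h.m_succ_le hl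
  have := h.k_H_le
  omega

/-- Unless the scaled demands vanish, the level is large. -/
lemma Good.big (h : A.Good) (hl : l ≤ A.L) (hb : ∃ i < k, A.b i / 2 ^ (A.L - l) ≠ 0) : 4 * A.R < 2 ^ l := by
  obtain ⟨i, hi, hne⟩ := hb
  have h1 : 2 ^ (A.L - l) ≤ A.b i := by
    by_contra hcon
    exact hne (Nat.div_eq_of_lt (by omega))
  have h2 := h.le i hi
  have h3 : 2 ^ A.L = 2 ^ (A.L - l) * 2 ^ l := by rw [← pow_add]; congr 1; omega
  have h4 := h.lt
  have h5 := h.one_le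
  rw [h3] at h4
  have h6 : 2 ^ (A.L - l) * 2 ^ l ≤ A.n * 2 ^ l := Nat.mul_le_mul_right _ (h1.trans h2)
  by_contra hcon
  push Not at hcon
  have : A.n * 2 ^ l ≤ A.n * (4 * A.R) := Nat.mul_le_mul_left _ hcon
  nlinarith

lemma Good.sum_div_le (h : A.Good) (hl : l ≤ A.L) : 4 * ∑ i : Fin k, A.b i / 2 ^ (A.L - l) ≤ 2 ^ l := by
  have h3 : 2 ^ A.L = 2 ^ (A.L - l) * 2 ^ l := by rw [← pow_add]; congr 1; omega
  have h1 : 2 ^ (A.L - l) * ∑ i : Fin k, A.b i / 2 ^ (A.L - l) ≤ A.n := by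
    rw [mul_sum]
    refine (sum_le_sum fun i _ => Nat.mul_div_le _ _).trans ?_
    rw [Fin.sum_univ_eq_sum_range]
    exact h.sum_le
  have h4 := h.lt
  have h5 : 2 ≤ A.R := by unfold R; omega
  have h6 : 4 * A.n ≤ 4 * A.n * A.R := Nat.le_mul_of_pos_right _ (by omega)
  have h7 : 2 ^ (A.L - l) * (4 * ∑ i : Fin k, A.b i / 2 ^ (A.L - l)) < 2 ^ (A.L - l) * 2 ^ l := by
    rw [← h3]
    calc _ = 4 * (2 ^ (A.L - l) * ∑ i : Fin k, A.b i / 2 ^ (A.L - l)) := by ring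
      _ ≤ 4 * A.n := Nat.mul_le_mul_left _ h1
      _ < _ := by omega
  exact (Nat.lt_of_mul_lt_mul_left h7).le

/-- Covering by singletons is already cheap enough: the scaled demands contribute at most a quarter
of `2 ^ l`, and the width of the box less than half of it. At such levels the cap `2 ^ l` excludes
nothing. -/
lemma Good.f_le_pow (h : A.Good) (hl : l ≤ A.L) (hx : Half A.D k x) (hb : 2 * A.R < 2 ^ l) :
    A.f l x ≤ 2 ^ l := by
  have h1 : A.f l x ≤ ∑ i : Fin k, (A.b i / 2 ^ (A.L - l) + A.H) := cn_le_sum _ fun i => by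
    have := half_lt hx i.2
    simp only [vec]; push_cast; omega
  rw [sum_add_distrib] at h1
  have h2 := h.sum_div_le hl
  have h3 := h.k_H_le
  simp only [sum_const, card_univ, Fintype.card_fin, smul_eq_mul] at h1
  have h4 : k * A.H ≤ k * (2 * A.H) := Nat.mul_le_mul_left _ (by omega)
  omega

lemma Good.m_le_pow (h : A.Good) (hl : l ≤ A.L) : A.m l ≤ 2 ^ l := by
  by_cases hb : ∃ i < k, A.b i / 2 ^ (A.L - l) ≠ 0
  · exact h.f_le_pow hl (half_zero h) (by have := h.big hl hb; omega)
  · push Not at hb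
    have : A.m l = 0 := cn_eq_zero_iff.2 fun i => by
      simp only [vec, dig_zero, hb i i.2]; omega
    rw [this]; exact Nat.zero_le _

lemma Good.exists_vec_eq (_ : A.Good) {v : Fin k → ℤ}
    (hv : ∀ i : Fin k, (A.b i / 2 ^ (A.L - l) : ℕ) - (A.H : ℤ) ≤ v i ∧
      v i < (A.b i / 2 ^ (A.L - l) : ℕ) + A.H) :
    ∃ x < A.Z, Half A.D k x ∧ A.vec l x = v := by
  let g : ℕ → ℕ := fun i =>
    if hi : i < k then (v ⟨i, hi⟩ - (A.b i / 2 ^ (A.L - l) : ℕ) + A.H).toNat else 0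
  have hg : ∀ i < k, g i < 2 * A.H := fun i hi => by
    have := hv ⟨i, hi⟩
    simp only [g, dif_pos hi] at this ⊢
    omega
  have hg' : ∀ i < k, g i < A.D := fun i hi => by have := hg i hi; unfold D; omega
  refine ⟨∑ i ∈ range k, g i * A.D ^ i, sum_dig_lt hg', fun i hi => ?_, ?_⟩
  · rw [dig_sum hg' hi]
    have := hg i hi
    unfold D; omega
  · ext i
    have := hv i
    simp only [vec]
    rw [dig_sum hg' i.2]
    simp only [g, dif_pos i.2, Fin.eta]
    omega

lemma Good.off_lt (h : A.Good) (l i : ℕ) : A.off l i < A.D := by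
  have h2 : A.b i / 2 ^ (A.L - (l + 1)) % 2 < 2 := Nat.mod_lt _ (by norm_num)
  have := h.two
  unfold off D
  omega

lemma Good.del_lt (h : A.Good) (l : ℕ) : A.del l < A.Z := sum_dig_lt fun i _ => h.off_lt l i

lemma Good.dig_del (h : A.Good) {i : ℕ} (hi : i < k) : dig A.D i (A.del l) = A.off l i :=
  dig_sum (fun i _ => h.off_lt l i) hi

lemma Good.dig_add_del_lt (h : A.Good) (hx : Half A.D k x) :
    ∀ i < k, dig A.D i x + dig A.D i (A.del l) < A.D := fun i hi => by
  rw [h.dig_del hi]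
  have h2 : A.b i / 2 ^ (A.L - (l + 1)) % 2 < 2 := Nat.mod_lt _ (by norm_num)
  have := half_lt hx hi
  have := h.two
  have hD : A.D = 4 * A.H := rfl
  unfold off
  omega

lemma Good.add_del_lt (h : A.Good) (hxZ : x < A.Z) (hx : Half A.D k x) : x + A.del l < A.Z :=
  add_lt_of_dig hxZ (h.del_lt l) (h.dig_add_del_lt hx)

/-- In each coordinate the equation of vectors says that two digits add up to a digit plus that of
the offset. Both additions are free of carries, so this is the equation of the codes. -/
lemma Good.add_eq_iff (h : A.Good) (hl : l < A.L) {x₁ x₂ : ℕ} (hxZ : x < A.Z) (hx : Half A.D k x)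
    (hZ₁ : x₁ < A.Z) (h₁ : Half A.D k x₁) (hZ₂ : x₂ < A.Z) (h₂ : Half A.D k x₂) :
    x₁ + x₂ = x + A.del l ↔ A.vec l x₁ + A.vec l x₂ = A.vec (l + 1) x := by
  have key : A.vec l x₁ + A.vec l x₂ = A.vec (l + 1) x ↔
      ∀ i < k, dig A.D i x₁ + dig A.D i x₂ = dig A.D i x + dig A.D i (A.del l) := by
    rw [funext_iff]
    constructor
    · intro H i hi
      have := H ⟨i, hi⟩
      have := b_div hl i
      rw [h.dig_del hi]
      simp only [vec, Pi.add_apply, off] at *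
      omega
    · intro H i
      have := H i i.2
      rw [h.dig_del i.2] at this
      have := b_div hl i
      simp only [vec, Pi.add_apply, off] at *
      omega
  rw [key]
  constructor
  · intro H i hi
    rw [← dig_add hZ₁ hZ₂ (h₁.add_lt h₂) hi, H, dig_add hxZ (h.del_lt l) (h.dig_add_del_lt hx) hi]
  · intro H
    rw [add_eq_sum_dig hZ₁ hZ₂, add_eq_sum_dig hxZ (h.del_lt l)]
    exact sum_congr rfl fun i hi => by rw [H i (mem_range.1 hi)]

/-- There are two regimes. If some scaled demand is nonzero at level `l + 1`, the balanced splitting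
is used, and the level is so high that the cap `2 ^ l` holds by itself. Otherwise the boxes of both
levels are centered at `0`, every part of a vector lies in the box, and the cover number is halved
to respect the cap. -/
lemma Good.exists_split (h : A.Good) (hl : l < A.L) (hxZ : x < A.Z) (hx : Half A.D k x)
    (hf : A.f (l + 1) x ≤ 2 ^ (l + 1)) : ∃ x₁ x₂, (x₁ < A.Z ∧ Half A.D k x₁) ∧
      (x₂ < A.Z ∧ Half A.D k x₂) ∧ x₁ + x₂ = x + A.del l ∧
      A.f l x₁ + A.f l x₂ ≤ A.f (l + 1) x ∧ A.f l x₁ ≤ 2 ^ l ∧ A.f l x₂ ≤ 2 ^ l := by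
  have hpow : 2 ^ (l + 1) = 2 * 2 ^ l := by rw [pow_succ]; ring
  by_cases hb : ∃ i < k, A.b i / 2 ^ (A.L - (l + 1)) ≠ 0
  · have hbig := h.big hl hb
    have hlarge : 40 ^ 16 * k ^ 9 ≤ (A.H - 2) ^ 16 := h.large
    -- With discrepancy `H - 2` one has `|2 * v₁ - v| ≤ H - 1`, and `v` is within `H` of its center;
    -- half of the total deviation, including the binary digit of the demand, keeps both parts in
    -- the box.
    obtain ⟨v₁, v₂, hv, hc, hd⟩ := exists_split_balanced (T := A.T) h.pos hlarge (A.vec (l + 1) x)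
    have h2 := h.two
    have hcast : ((A.H - 2 : ℕ) : ℤ) = A.H - 2 := by omega
    have hr : ∀ i : Fin k, ((A.b i / 2 ^ (A.L - l) : ℕ) - (A.H : ℤ) ≤ v₁ i ∧
        v₁ i < (A.b i / 2 ^ (A.L - l) : ℕ) + A.H) ∧
        ((A.b i / 2 ^ (A.L - l) : ℕ) - (A.H : ℤ) ≤ v₂ i ∧
        v₂ i < (A.b i / 2 ^ (A.L - l) : ℕ) + A.H) := fun i => by
      have e1 := abs_le.1 (hd i)
      have e2 := congrFun hv i
      have e3 := b_div hl i
      have e4 := half_lt hx i.2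
      have e5 : A.b i / 2 ^ (A.L - (l + 1)) % 2 < 2 := Nat.mod_lt _ (by norm_num)
      rw [hcast] at e1
      simp only [vec, Pi.add_apply] at e1 e2
      omega
    obtain ⟨x₁, hx₁, hh₁, rfl⟩ := h.exists_vec_eq fun i => (hr i).1
    obtain ⟨x₂, hx₂, hh₂, rfl⟩ := h.exists_vec_eq fun i => (hr i).2
    exact ⟨x₁, x₂, ⟨hx₁, hh₁⟩, ⟨hx₂, hh₂⟩, (h.add_eq_iff hl hxZ hx hx₁ hh₁ hx₂ hh₂).2 hv, hc,
      h.f_le_pow hl.le hh₁ (by omega), h.f_le_pow hl.le hh₂ (by omega)⟩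
  · push Not at hb
    obtain ⟨v₁, v₂, hv, hc₁, hc₂, hd⟩ := exists_split_half (T := A.T) (A.vec (l + 1) x)
    have h2 := h.two
    have hr : ∀ i : Fin k, ((A.b i / 2 ^ (A.L - l) : ℕ) - (A.H : ℤ) ≤ v₁ i ∧
        v₁ i < (A.b i / 2 ^ (A.L - l) : ℕ) + A.H) ∧
        ((A.b i / 2 ^ (A.L - l) : ℕ) - (A.H : ℤ) ≤ v₂ i ∧
        v₂ i < (A.b i / 2 ^ (A.L - l) : ℕ) + A.H) := fun i => by
      have e1 := hd i
      have e3 := b_div hl i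
      have e4 := half_lt hx i.2
      have e5 := hb i i.2
      simp only [vec] at e1
      omega
    obtain ⟨x₁, hx₁, hh₁, rfl⟩ := h.exists_vec_eq fun i => (hr i).1
    obtain ⟨x₂, hx₂, hh₂, rfl⟩ := h.exists_vec_eq fun i => (hr i).2
    unfold f at *
    exact ⟨x₁, x₂, ⟨hx₁, hh₁⟩, ⟨hx₂, hh₂⟩, (h.add_eq_iff hl hxZ hx hx₁ hh₁ hx₂ hh₂).2 hv,
      by omega, by omega, by omega⟩

/-- Both parts of a splitting cost at least `m l`. Consequently the truncated differences with `2 *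
m l` that occur below are exact. -/
lemma Good.two_m_le (h : A.Good) (hl : l < A.L) (hxZ : x < A.Z) (hx : Half A.D k x)
    (hf : A.f (l + 1) x ≤ 2 ^ (l + 1)) : 2 * A.m l ≤ A.f (l + 1) x := by
  obtain ⟨x₁, x₂, -, -, -, h1, -, -⟩ := h.exists_split hl hxZ hx hf
  have := h.m_le_f l x₁
  have := h.m_le_f l x₂
  omega

lemma Good.Z_pos (h : A.Good) : 0 < A.Z := pow_pos h.D_pos k

lemma Good.two_m_le_m (h : A.Good) (hl : l < A.L) : 2 * A.m l ≤ A.m (l + 1) :=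
  h.two_m_le hl h.Z_pos (half_zero h) (h.m_le_pow hl)

/-- The table at level `l`: cell `c * Z + x` tells whether the vector of `x` has a cover with at
most `c` sets more than the least one. -/
def Tab (A : Setup k) (l X : ℕ) : Prop :=
  Half A.D k (X % A.Z) ∧ A.f l (X % A.Z) ≤ A.m l + X / A.Z ∧ A.f l (X % A.Z) ≤ 2 ^ l

/-- The table at level `l + 1` is the sumset of the table at level `l` with itself. -/
theorem Good.sumset_iff (h : A.Good) (hl : l < A.L) (hxZ : x < A.Z) (hx : Half A.D k x) {c X : ℕ}
    (hc : c < 2 * A.R - 1) (hX : X = c * A.Z + (x + A.del l)) :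
    (∃ Y, Y ≤ X ∧ Y < A.R * A.Z ∧ X - Y < A.R * A.Z ∧ A.Tab l Y ∧ A.Tab l (X - Y)) ↔
      A.f (l + 1) x ≤ 2 * A.m l + c ∧ A.f (l + 1) x ≤ 2 ^ (l + 1) := by
  have hZ := h.Z_pos
  have hxd := h.add_del_lt (l := l) hxZ hx
  have hpow : 2 ^ (l + 1) = 2 * 2 ^ l := by rw [pow_succ]; ring
  constructor
  · rintro ⟨Y, hY, hY1, hY2, ⟨t1, t2, t3⟩, ⟨t4, t5, t6⟩⟩
    set W := X - Y with hW
    have hZ₁ := Nat.mod_lt Y hZ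
    have hZ₂ := Nat.mod_lt W hZ
    -- No carry leaves the vector part, so costs and vectors add up separately.
    have hsum : Y % A.Z + W % A.Z < A.Z := add_lt_of_dig hZ₁ hZ₂ (t1.add_lt t4)
    have e1 : X = (Y / A.Z + W / A.Z) * A.Z + (Y % A.Z + W % A.Z) := by
      have a1 := Nat.div_add_mod Y A.Z
      have a2 := Nat.div_add_mod W A.Z
      have : X = Y + W := by omega
      rw [this, add_mul, mul_comm (Y / A.Z), mul_comm (W / A.Z)]
      omega
    have e2 : c = Y / A.Z + W / A.Z := by
      have := congrArg (· / A.Z) (hX.symm.trans e1)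
      simpa [mul_comm _ A.Z, Nat.mul_add_div hZ, Nat.div_eq_of_lt hsum,
        Nat.div_eq_of_lt hxd] using this
    have e3 : Y % A.Z + W % A.Z = x + A.del l := by
      rw [hX, e2] at e1; omega
    have e4 := (h.add_eq_iff hl hxZ hx hZ₁ t1 hZ₂ t4).1 e3
    have e5 : A.f (l + 1) x ≤ A.f l (Y % A.Z) + A.f l (W % A.Z) := by
      unfold f; rw [← e4]; exact cn_add_le _ _
    generalize Y / A.Z = p at *
    generalize W / A.Z = q at *
    omega
  · rintro ⟨h1, h2⟩
    obtain ⟨x₁, x₂, ⟨hx₁, hh₁⟩, ⟨hx₂, hh₂⟩, h3, h4, h5, h6⟩ := h.exists_split hl hxZ hx h2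
    have e1 := h.m_le_f l x₁
    have e2 := h.m_le_f l x₂
    have e3 := h.f_le l hh₁
    have e4 := h.f_le l hh₂
    have e5 := h.k_H_le
    obtain ⟨c₁, c₂, hc₁, hc₂, hcc, hf₁, hf₂⟩ : ∃ c₁ c₂, c₁ < A.R ∧ c₂ < A.R ∧ c₁ + c₂ = c ∧
        A.f l x₁ ≤ A.m l + c₁ ∧ A.f l x₂ ≤ A.m l + c₂ := by
      -- The first summand gets what the second does not need, up to the largest admissible cost `R
      -- - 1`; the rest fits into the second because `c ≤ 2 * R - 2`.
      refine ⟨min (A.R - 1) (c - (A.f l x₂ - A.m l)),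
        c - min (A.R - 1) (c - (A.f l x₂ - A.m l)), ?_⟩
      omega
    have hXY : X - (c₁ * A.Z + x₁) = c₂ * A.Z + x₂ := by
      rw [hX, ← h3, ← hcc, add_mul]; omega
    refine ⟨c₁ * A.Z + x₁, ?_, index_lt hc₁ hx₁, ?_, ?_, ?_⟩
    · rw [hX, ← h3, ← hcc, add_mul]; omega
    · rw [hXY]; exact index_lt hc₂ hx₂
    · simp only [Tab, Nat.mod_eq_of_lt hx₁, mul_comm _ A.Z,
        Nat.mul_add_div hZ, Nat.div_eq_of_lt hx₁, add_zero, Nat.mul_add_mod_self_left]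
      exact ⟨hh₁, hf₁, h5⟩
    · rw [hXY]
      simp only [Tab, Nat.mod_eq_of_lt hx₂, mul_comm _ A.Z,
        Nat.mul_add_div hZ, Nat.div_eq_of_lt hx₂, add_zero, Nat.mul_add_mod_self_left]
      exact ⟨hh₂, hf₂, h6⟩

/-- A minimal sum decomposes optimally. -/
lemma Good.witness (h : A.Good) (hl : l < A.L) (hxZ : x < A.Z) (hx : Half A.D k x) {X Y : ℕ}
    (hf : A.f (l + 1) x ≤ 2 ^ (l + 1))
    (hX : X = (A.f (l + 1) x - 2 * A.m l) * A.Z + (x + A.del l)) (hY : Y ≤ X)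
    (t : A.Tab l Y) (t' : A.Tab l (X - Y)) :
    Y % A.Z + (X - Y) % A.Z = x + A.del l ∧
      A.f l (Y % A.Z) + A.f l ((X - Y) % A.Z) ≤ A.f (l + 1) x := by
  obtain ⟨t1, t2, t3⟩ := t
  obtain ⟨t4, t5, t6⟩ := t'
  have hZ := h.Z_pos
  have hxd := h.add_del_lt (l := l) hxZ hx
  have h2m := h.two_m_le hl hxZ hx hf
  set W := X - Y with hW
  have hZ₁ := Nat.mod_lt Y hZ
  have hZ₂ := Nat.mod_lt W hZ
  have hsum : Y % A.Z + W % A.Z < A.Z := add_lt_of_dig hZ₁ hZ₂ (t1.add_lt t4)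
  have e1 : X = (Y / A.Z + W / A.Z) * A.Z + (Y % A.Z + W % A.Z) := by
    have a1 := Nat.div_add_mod Y A.Z
    have a2 := Nat.div_add_mod W A.Z
    have : X = Y + W := by omega
    rw [this, add_mul, mul_comm (Y / A.Z), mul_comm (W / A.Z)]
    omega
  have e2 : A.f (l + 1) x - 2 * A.m l = Y / A.Z + W / A.Z := by
    have := congrArg (· / A.Z) (hX.symm.trans e1)
    simpa [mul_comm _ A.Z, Nat.mul_add_div hZ, Nat.div_eq_of_lt hsum,
      Nat.div_eq_of_lt hxd] using this
  have e3 : Y % A.Z + W % A.Z = x + A.del l := by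
    rw [hX, e2] at e1; omega
  refine ⟨e3, ?_⟩
  generalize Y / A.Z = p at *
  generalize W / A.Z = q at *
  omega

/-- The table at level `0`. -/
lemma Good.f_zero_iff (h : A.Good) (c : ℕ) : (A.f 0 x ≤ A.m 0 + c ∧ A.f 0 x ≤ 2 ^ 0) ↔
    (c ≠ 0 ∨ ∀ i < k, dig A.D i x ≤ A.H) ∧ (∀ i < k, dig A.D i x ≤ A.H + 1) ∧
      ∀ i j : Fin k, i ≠ j → A.H < dig A.D i x → A.H < dig A.D j x → ¬ A.T.Adj i j := by
  -- By `Good.big` a nonzero scaled demand at level `0` would force `4 * R < 1`.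
  have hb : ∀ i < k, A.b i / 2 ^ (A.L - 0) = 0 := by
    by_contra! hcon
    have := h.big (Nat.zero_le _) hcon
    have := h.k_H_le
    omega
  have hv : ∀ i : Fin k, A.vec 0 x i = dig A.D i x - A.H := fun i => by
    simp only [vec, hb i i.2]; omega
  have hm : A.m 0 = 0 := cn_eq_zero_iff.2 fun i => by
    simp only [vec, hb i i.2, dig_zero]; omega
  have h0 : A.f 0 x = 0 ↔ ∀ i < k, dig A.D i x ≤ A.H := by
    refine cn_eq_zero_iff.trans ⟨fun H i hi => ?_, fun H i => ?_⟩
    · have := H ⟨i, hi⟩; rw [hv] at this; simp only at this; omega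
    · have := H i i.2; rw [hv]; omega
  have h1 : A.f 0 x ≤ 1 ↔ (∀ i < k, dig A.D i x ≤ A.H + 1) ∧
      ∀ i j : Fin k, i ≠ j → A.H < dig A.D i x → A.H < dig A.D j x → ¬ A.T.Adj i j := by
    refine cn_le_one_iff.trans (and_congr ⟨fun H i hi => ?_, fun H i => ?_⟩ ?_)
    · have := H ⟨i, hi⟩; rw [hv] at this; simp only at this; omega
    · have := H i i.2; rw [hv]; omega
    · refine forall_congr' fun i => forall_congr' fun j => forall_congr' fun _ => ?_
      rw [hv, hv]
      simp only [sub_pos, Nat.cast_lt]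
  rw [← h0, ← h1, hm, pow_zero]
  omega

/-- The code of the demand vector at the last level. -/
def Mid (A : Setup k) : ℕ := ∑ i ∈ range k, A.H * A.D ^ i

lemma Good.H_lt (h : A.Good) (i : ℕ) (_ : i < k) : A.H < A.D := by have := h.two; unfold D; omega

lemma Good.Mid_lt (h : A.Good) : A.Mid < A.Z := sum_dig_lt h.H_lt

lemma Good.Mid_half (h : A.Good) : Half A.D k A.Mid := fun i hi => by
  rw [Mid, dig_sum h.H_lt hi]; have := h.two; unfold D; omega

lemma Good.vec_Mid (h : A.Good) (i : Fin k) : A.vec A.L A.Mid i = A.b i := by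
  simp only [vec, Mid, Nat.sub_self, pow_zero, Nat.div_one]
  rw [dig_sum h.H_lt i.2]
  ring

lemma Good.Mid_le_pow (h : A.Good) : A.f A.L A.Mid ≤ 2 ^ A.L := by
  refine h.f_le_pow le_rfl h.Mid_half ?_
  have := h.lt
  have := h.one_le
  nlinarith

end Setup

end Levels

end NDColoring

namespace NDColoring

/-! ### Running times in terms of the length of a program -/

/-- The number of instructions. -/
def Prog.len : Prog → ℕ
  | skip => 1
  | const _ _ => 1
  | arith _ _ _ _ => 1
  | load _ _ _ => 1
  | store _ _ _ => 1
  | seq p q => p.len + q.len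
  | branch _ _ p q => p.len + q.len + 1
  | loop _ _ p => p.len + 1

/-- Compiled expressions contain no loops, so their time is their length. -/
lemma Ex.len_comp (e : Ex) : ∀ d, (e.comp d).len = e.time := by
  induction e with
  | lit n => intro d; rfl
  | reg x => intro d; rfl
  | get a e ih => intro d; simp only [comp, Prog.len, ih, time]
  | bin o e f ihe ihf => intro d; simp only [comp, Prog.len, ihe, ihf, time]

lemma len_setP (x : ℕ) (e : Ex) : (setP x e).len = e.time + 2 := by
  simp only [setP, Prog.len, Ex.len_comp]

/-- Bounding all constants by the program length means that none has to be tracked: the final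
constant depends only on the length of `Program.main`. -/
lemma fillC_le (a : ℕ) (off n m : Ex) (init : ℕ) (step post : Ex) :
    fillC off n m step post ≤ 60 * (fillP a off n m init step post).len := by
  have : (off + .reg 10).time = off.time + 2 + 1 := rfl
  simp only [fillC, fillP, foldP, stoP, len_setP, Prog.len, Ex.len_comp]
  omega

lemma foldSetC_le (x : ℕ) (m : Ex) (init : ℕ) (step e : Ex) :
    foldSetC m step e ≤ 60 * (foldSetP x m init step e).len := by
  simp only [foldSetC, foldC, foldSetP, foldP, len_setP, Prog.len]
  omega

/-- The program halts within `U` steps up to a factor depending on its length. -/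
def Within (W U : ℕ) (p : Prog) (s : State) (Q : State → Prop) : Prop :=
  Runs W p s (60 * p.len * U) Q

section Within

variable {W U : ℕ} {p q : Prog} {s : State} {Q Q' : State → Prop}

lemma Runs.within {c t : ℕ} (h : Runs W p s (c * t) Q) (hc : c ≤ 60 * p.len) (ht : t ≤ U) :
    Within W U p s Q := h.mono (Nat.mul_le_mul hc ht) fun _ h => h

lemma Within.mono {U' : ℕ} (h : Within W U p s Q) (hU : U ≤ U') (hQ : ∀ s', Q s' → Q' s') :
    Within W U' p s Q' := Runs.mono h (Nat.mul_le_mul_left _ hU) hQ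

lemma Within.seq (h : Within W U p s Q) (hq : ∀ s₁, Q s₁ → Within W U q s₁ Q') :
    Within W U (.seq p q) s Q' :=
  Runs.mono (Runs.seq h hq) (by rw [Prog.len]; exact le_of_eq (by ring)) fun _ h => h

/-- The `n + 1` tests are paid for by the one instruction that the loop adds to the length. -/
lemma Within.loop {y z : ℕ} (I : ℕ → State → Prop) (n : ℕ) (hU : 1 ≤ U)
    (hstep : ∀ j < n, ∀ s, I j s → s.reg y < s.reg z ∧ Within W U p s (I (j + 1)))
    (hend : ∀ s, I n s → ¬ s.reg y < s.reg z) (h0 : I 0 s) :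
    Within W (U * (n + 1)) (.loop y z p) s (I n) := by
  refine Runs.mono (Runs.loop I n hstep hend h0) ?_ fun _ h => h
  rw [Prog.len]
  have h1 : n + 1 ≤ U * (n + 1) := Nat.le_mul_of_pos_left _ hU
  have h2 : 60 * (p.len + 1) * (U * (n + 1)) =
    n * (60 * p.len * U) + 60 * p.len * U + 60 * (U * (n + 1)) := by ring
  rw [h2, mul_add]
  omega

lemma within_set {B : ℕ} (hC : Cap W B 64) (hs : s.Bd B) {x : ℕ} (hx : x < 100) {e : Ex}
    (he : e.Ok 50) {v : ℕ} (hv : e.eval s = v) (hvB : v ≤ B) (hU : 1 ≤ U) :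
    Within W U (setP x e) s (s.KeepReg B x v) := by
  refine Runs.mono (runs_setReg hC hs hx he hv hvB) ?_ fun _ h => h
  rw [len_setP]
  nlinarith

end Within

/-! ### The parameters of the program -/

namespace Setup

open Finset

variable {k : ℕ} (A : Setup k)

/-- The number of digits handled by one transform. -/
def kap (_ : Setup k) : ℕ := k / 3

/-- The length of the transform. -/
def N : ℕ := A.D ^ A.kap

/-- The number of tags. -/
def P : ℕ := A.R * A.D ^ (k - 2 * A.kap)

/-- The exponent of the root of unity. -/
def tau : ℕ := 4 * A.kap / A.D + 1

/-- The modulus is `D ^ rr + 1`. -/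
def rr : ℕ := A.tau * (A.D / 2)

/-- The modulus. -/
def M : ℕ := A.D ^ A.rr + 1

/-- A bound for the parameters. -/
def Q : ℕ := k + A.D + A.Z + A.P + A.M + 2 ^ A.L + A.n + 64

/-- A bound for all numbers. -/
def B : ℕ := A.Q ^ 12

/-- The unit of the running time. -/
def U : ℕ := 8 * (A.P * A.P * (A.N * A.N * A.N))

/-- The base is a power of two. -/
def IsBin : Prop := ∃ d, A.D = 2 ^ d

variable {A}

/-- A table index is read as a tag, consisting of the cost and the leading `k - 2 * kap` digits,
followed by two blocks of `kap` digits. Only the last block is transformed. -/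
lemma PNN : A.P * A.N * A.N = A.R * A.Z := by
  have : k = (k - 2 * A.kap) + A.kap + A.kap := by unfold kap; omega
  rw [P, N, Z, mul_assoc, mul_assoc, ← pow_add, ← pow_add]
  congr 2
  omega

lemma R_pos : 2 ≤ A.R := by unfold R; omega

lemma Good.N_pos (h : A.Good) : 0 < A.N := pow_pos h.D_pos _

lemma Good.R_le_P (h : A.Good) : A.R ≤ A.P := Nat.le_mul_of_pos_right _ (pow_pos h.D_pos _)

lemma Good.k_le_R (h : A.Good) : k ≤ A.R := by
  have := Nat.le_mul_of_pos_right k h.D_pos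
  unfold R; omega

lemma Good.D_le_R (h : A.Good) : A.D ≤ A.R := by
  have := Nat.le_mul_of_pos_left A.D h.pos
  unfold R; omega

lemma Good.N_le_P (h : A.Good) : A.N ≤ A.P := by
  calc A.N ≤ A.D ^ (k - 2 * A.kap) := Nat.pow_le_pow_right h.D_pos (by unfold kap; omega)
    _ ≤ A.P := Nat.le_mul_of_pos_left _ (by have := A.R_pos; omega)

lemma Good.N_le_Z (h : A.Good) : A.N ≤ A.Z :=
  Nat.pow_le_pow_right h.D_pos (by unfold kap; omega)

lemma Good.Z_le (_ : A.Good) : A.Z ≤ A.P * A.N * A.N := by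
  rw [PNN]; exact Nat.le_mul_of_pos_left _ (by have := A.R_pos; omega)

lemma Good.M_ge (h : A.Good) : 2 ≤ A.M := by
  have : 0 < A.D ^ A.rr := pow_pos h.D_pos _
  unfold M; omega

/-- The rounding up in `tau` serves this bound, by which counts up to `N * N` stay below the
modulus. -/
lemma Good.two_kap_le (h : A.Good) : 2 * A.kap ≤ A.rr := by
  have h4 : A.D = 4 * A.H := rfl
  have h5 := h.two
  have h1 := Nat.lt_div_mul_add (a := 4 * A.kap) h.D_pos
  have h2 : A.rr * 2 = (4 * A.kap / A.D) * A.D + A.D := by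
    unfold rr tau
    have : A.D / 2 * 2 = A.D := by omega
    rw [mul_assoc, this]; ring
  omega

/-- Together with a base linear in `k` this keeps the modulus at `O(k log k)` bits. -/
lemma rr_le : A.rr ≤ 2 * k + A.D := by
  have h4 : A.D = 4 * A.H := rfl
  have h1 := Nat.div_mul_le_self (4 * A.kap) A.D
  have h2 : A.rr * 2 = (4 * A.kap / A.D) * A.D + A.D := by
    unfold rr tau
    have : A.D / 2 * 2 = A.D := by omega
    rw [mul_assoc, this]; ring
  have : A.kap ≤ k := by unfold kap; omega
  omega

lemma Good.one_le_rr (h : A.Good) : 1 ≤ A.rr := by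
  have h4 : A.D = 4 * A.H := rfl
  have h5 := h.two
  exact Nat.mul_pos (Nat.succ_pos _) (by omega)

lemma Q_ge : 64 ≤ A.Q := by unfold Q; generalize 2 ^ A.L = t; omega

/-- Sizes are tracked as exponents of `Q`; no stored number or fold bound needs more than the
twelfth power. -/
lemma le_pow {x p : ℕ} (hx : x ≤ A.Q ^ p) (hp : p ≤ 12) : x ≤ A.B :=
  hx.trans (Nat.pow_le_pow_right (by have := A.Q_ge; omega) hp)

lemma le_Q {x : ℕ} (hx : x ≤ A.Q) : x ≤ A.Q ^ 1 := by simpa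

lemma mul_Q {x y p q : ℕ} (hx : x ≤ A.Q ^ p) (hy : y ≤ A.Q ^ q) : x * y ≤ A.Q ^ (p + q) := by
  rw [pow_add]; exact Nat.mul_le_mul hx hy

lemma add_Q {x y p q : ℕ} (hx : x ≤ A.Q ^ (p + 1)) (hy : y ≤ A.Q ^ (q + 1)) :
    x + y ≤ A.Q ^ (p + 1 + (q + 1)) :=
  Op.eval_le_pow (by have := A.Q_ge; omega) .add (by omega) (by omega) hx hy

lemma lit_Q {x : ℕ} (hx : x ≤ 64) : x ≤ A.Q ^ 1 := le_Q (hx.trans A.Q_ge)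
lemma k_Q : k ≤ A.Q ^ 1 := le_Q (by unfold Q; generalize 2 ^ A.L = t; omega)
lemma D_Q : A.D ≤ A.Q ^ 1 := le_Q (by unfold Q; generalize 2 ^ A.L = t; omega)
lemma Z_Q : A.Z ≤ A.Q ^ 1 := le_Q (by unfold Q; generalize 2 ^ A.L = t; omega)
lemma P_Q : A.P ≤ A.Q ^ 1 := le_Q (by unfold Q; generalize 2 ^ A.L = t; omega)
lemma M_Q : A.M ≤ A.Q ^ 1 := le_Q (by unfold Q; generalize 2 ^ A.L = t; omega)
lemma L_Q : 2 ^ A.L ≤ A.Q ^ 1 := le_Q (by unfold Q; generalize 2 ^ A.L = t; omega)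
lemma n_Q : A.n ≤ A.Q ^ 1 := le_Q (by unfold Q; generalize 2 ^ A.L = t; omega)
lemma Good.N_Q (h : A.Good) : A.N ≤ A.Q ^ 1 := h.N_le_Z.trans Z_Q
lemma Good.R_Q (h : A.Good) : A.R ≤ A.Q ^ 1 := h.R_le_P.trans P_Q

lemma Good.one_le_U (h : A.Good) : 1 ≤ A.U := by
  have h1 := h.N_pos
  have h2 : 0 < A.P := by have := h.R_le_P; have := A.R_pos; omega
  unfold U
  have : 0 < A.P * A.P * (A.N * A.N * A.N) := by positivity
  omega

end Setup

end NDColoring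

namespace NDColoring

/-! ### The program -/

namespace Ex

/-- Powers with a fixed exponent. -/
def pow (e : Ex) : ℕ → Ex
  | 0 => lit 1
  | n + 1 => e.pow n * e

@[simp] lemma eval_pow (s : State) (e : Ex) (n : ℕ) : (e.pow n).eval s = e.eval s ^ n := by
  induction n with
  | zero => rfl
  | succ n ih => rw [pow, eval_mul, ih, pow_succ]

abbrev rk : Ex := .reg 0
abbrev rD : Ex := .reg 2
abbrev rkap : Ex := .reg 3
abbrev rN : Ex := .reg 4
abbrev rZ : Ex := .reg 5
abbrev rP : Ex := .reg 6
abbrev rR : Ex := .reg 7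
abbrev rM : Ex := .reg 8
abbrev rw : Ex := .reg 9
abbrev ri : Ex := .reg 10
abbrev rj : Ex := .reg 11
abbrev racc : Ex := .reg 12
abbrev rL : Ex := .reg 15
abbrev rl : Ex := .reg 16
abbrev rsh : Ex := .reg 17
abbrev rm : Ex := .reg 18
abbrev rdel : Ex := .reg 19
abbrev rpw : Ex := .reg 21
abbrev rmid : Ex := .reg 22
abbrev rx : Ex := .reg 28
abbrev rmu : Ex := .reg 29
abbrev rwit : Ex := .reg 30

/-- The quarter of the base. -/
abbrev rH : Ex := rD / .lit 4

/-- The digit of `x` at position `i`; array `5` holds the powers of the base. -/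
abbrev digit (i x : Ex) : Ex := (x / .get 5 i) % rD

end Ex

namespace Program

open Ex

/-- Comparing sixteenth powers avoids roots. The factor `320` is written as `64 * 5` because
literals are limited to `64`; it equals `8 * 40`, where `8` accounts for the passage from the base
to `H - 2`. -/
def baseP : Prog := foldSetP 2 (rk + lit 16) 16
  (cond (lt (racc.pow 16) ((lit 64 * lit 5).pow 16 * rk.pow 9)) racc (lit 2 * racc)) racc
def kapP : Prog := setP 3 (rk / lit 3)
def lenP : Prog := foldSetP 4 rkap 1 (racc * rD) racc
def sizeP : Prog := foldSetP 5 rk 1 (racc * rD) racc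
def costP : Prog := setP 7 (rk * rD + lit 2)
def tagsP : Prog := foldSetP 6 (rk - lit 2 * rkap) 1 (racc * rD) (rR * racc)
def rootP : Prog := foldSetP 9 (lit 4 * rkap / rD + lit 1) 1 (racc * rD) racc
def modP : Prog :=
  foldSetP 8 ((lit 4 * rkap / rD + lit 1) * (rD / lit 2)) 1 (racc * rD) (racc + lit 1)
def totalP : Prog := foldSetP 20 rk 0 (racc + get 0 rj) (lit 4 * racc * rR + lit 1)
def doubleP : Prog := .seq (setP 21 (lit 2 * rpw)) (setP 15 (rL + lit 1))

/-- The computation of the parameters. -/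
def paramP : Prog :=
  .seq baseP <| .seq kapP <| .seq lenP <| .seq sizeP <| .seq costP <| .seq tagsP <| .seq rootP <|
    .seq modP <| .seq totalP <| .seq (setP 21 (lit 1)) <| .loop 21 20 doubleP

def demandP : Prog := mapP 4 (lit 0) rk (cond (get 1 (ri * rk + ri)) (lit 1) (get 0 ri))
def powerP : Prog := fillP 5 (lit 0) rk ri 1 (racc * rD) racc
def unityP : Prog := fillP 6 (lit 0) rD ri 1 ((racc * rw) % rM) racc
def dotP : Prog := fillP 18 (lit 0) (rN * rN) rkap 0
  (racc + digit rj (ri / rN) * digit rj (ri % rN)) racc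
def charP : Prog := mapP 7 (lit 0) (rN * rN) (get 6 (get 18 ri % rD))
def charInvP : Prog := mapP 8 (lit 0) (rN * rN) (get 6 (((rD - lit 1) * get 18 ri) % rD))
def validP : Prog :=
  fillP 9 (lit 0) rZ rk 0 (racc + isZero (lt (digit rj ri) (rD / lit 2))) (isZero racc)
def posP : Prog := fillP 19 (lit 0) rZ rk 0 (racc + lt rH (digit rj ri)) racc
def badP : Prog := fillP 21 (lit 0) rZ (rk * rk) 0
  (racc + (lt (rH + lit 1) (digit (rj / rk) ri) +
    (lt (rj / rk) (rj % rk) + lt (rj % rk) (rj / rk)) * (lt rH (digit (rj / rk) ri) *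
      lt rH (digit (rj % rk) ri) * get 1 rj))) racc
def tableP : Prog := mapP 10 (lit 0) (rR * rZ) (get 9 (ri % rZ) * isZero (get 21 (ri % rZ)) *
  cond (ri / rZ) (isZero (get 19 (ri % rZ))) (lit 1))

/-- The computation of the demands and the characters. -/
def charsP : Prog :=
  .seq demandP <| .seq powerP <| .seq unityP <| .seq dotP <| .seq charP charInvP

/-- The computation of the table of level `0`. -/
def marksP : Prog := .seq validP <| .seq posP <| .seq badP tableP

/-- Cells of arrays `12` and `13` are indexed by the tag of the first summand, the sum of both keys,
and a block of `kap` digits. A sum of two keys lies below `2 * P * N`, which gives the size of the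
middle part. -/
abbrev rtag : Ex := ri / rN / (lit 2 * rP * rN)
abbrev rks : Ex := ri / rN % (lit 2 * rP * rN)
abbrev rkey : Ex := rtag * rN + rj

def halveP : Prog := setP 21 (rpw / lit 2)
def deltaP : Prog := foldSetP 19 rk 0 (racc + (rH + get 4 rj / rpw % lit 2) * get 5 rj) racc
def saveP : Prog := stoP 17 rl rdel
def hatP : Prog := fillP 11 (lit 0) (rP * rN * rN) rN 0
  (racc + get 10 (ri / rN * rN + rj) * get 7 (ri % rN * rN + rj)) (racc % rM)
-- Keeping the tag apart while summing over the middle block costs only space; the number of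
-- operations is that of summing over all keys, and the tag is what makes witnesses cheap to find.
def prodP : Prog := fillP 12 (lit 0) (rP * (lit 2 * rP * rN) * rN) rN 0
  (racc + isZero (lt rks rkey) * lt (rks - rkey) (rP * rN) *
    (get 11 (rkey * rN + ri % rN) * get 11 ((rks - rkey) * rN + ri % rN))) (racc % rM)
def convP : Prog := fillP 13 (lit 0) (rP * (lit 2 * rP * rN) * rN) rN 0
  (racc + get 12 (ri / rN * rN + rj) * get 8 (rj * rN + ri % rN)) (isZero (isZero (racc % rM)))
def anyP : Prog := fillP 14 (lit 0) (lit 2 * rP * rN * rN) rP 0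
  (racc + get 13 (rj * (lit 2 * rP * rN * rN) + ri)) racc
-- Marks are monotone in the cost, so the least marked cost equals the number of unmarked ones.
def shiftP : Prog := foldSetP 17 (lit 2 * rR - lit 1) 0
  (racc + isZero (get 14 (rj * rZ + rdel))) racc
def sumP : Prog := fillP 20 (lit 0) rZ (lit 2 * rR - lit 1) 0
  (racc + isZero (get 14 (rj * rZ + (ri + rdel)))) (racc * rZ + (ri + rdel))
-- Witnesses are located in two stages: `P` tags are tried, and then the `N * N` codes with the tag
-- found, instead of `P * N * N` codes for each vector.
def tagP : Prog := fillP 22 (lit 0) rZ rP 0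
  (cond (get 13 (rj * (lit 2 * rP * rN * rN) + get 20 ri)) racc rj) racc
abbrev rcand : Ex := get 22 ri * (rN * rN) + rj
def witP : Prog := fillP 15 (rl * rZ) rZ (rN * rN) 0
  (cond (isZero (lt (get 20 ri) rcand) * lt (get 20 ri - rcand) (rR * rZ) *
    (get 10 rcand * get 10 (get 20 ri - rcand))) racc rcand) (racc % rZ)
-- Costs in the sumset are relative to twice the old minimum; the shift makes them relative to the
-- new one.
def nextP : Prog := mapP 10 (lit 0) (rR * rZ)
  (get 9 (ri % rZ) * isZero (isZero (get 14 (ri + rsh * rZ + rdel))))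

/-- The computation of the sumset of the current table with itself. -/
def transformP : Prog := .seq hatP <| .seq prodP <| .seq convP anyP

/-- The choice of the witnesses. -/
def searchP : Prog := .seq shiftP <| .seq sumP <| .seq tagP witP

/-- The computation of the next table. -/
def advanceP : Prog := .seq nextP <| .seq (setP 18 (lit 2 * rm + rsh)) (setP 16 (rl + lit 1))

/-- The passage from a level to the next one. -/
def levelP : Prog := .seq halveP <| .seq deltaP <| .seq saveP <| .seq transformP <| .seq searchP advanceP

def midP : Prog := foldSetP 22 rk 0 (racc + rH * get 5 rj) racc
def valueP : Prog := foldSetP 1 rR 0 (racc + isZero (get 10 (rj * rZ + rmid))) (rm + racc)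
-- For multiplicity `0` the stored witness may be meaningless and address a cell outside the row;
-- this is harmless, as only `0` is added there.
def scatterP : Prog :=
  .seq (setP 29 (get 16 ((rl + lit 1) * rZ + rx))) <| .seq (setP 30 (get 15 (rl * rZ + rx))) <|
    .seq (stoP 16 (rl * rZ + rwit) (get 16 (rl * rZ + rwit) + rmu)) <|
      .seq (stoP 16 (rl * rZ + (rx + get 17 rl - rwit))
        (get 16 (rl * rZ + (rx + get 17 rl - rwit)) + rmu)) (setP 28 (rx + lit 1))

/-- The passage from the multiplicities at a level to those at the preceding one. -/
def backP : Prog :=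
  .seq (setP 16 (rl - lit 1)) <| .seq (setP 28 (lit 0)) <| .loop 28 5 scatterP

/-- Vectors without positive entries need no color; dropping them keeps the number of colors below
the total cost. -/
def sizesP : Prog := mapP 2 (lit 0) rZ (get 16 ri * isZero (isZero (get 19 ri)))
def classesP : Prog := mapP 3 (lit 0) (rZ * rk) (lt rH (digit (ri % rk) (ri / rk)))

/-- The computation of the result from the tables. -/
def outputP : Prog :=
  .seq midP <| .seq valueP <| .seq (stoP 16 (rl * rZ + rmid) (lit 1)) <| .seq (.loop 27 16 backP) <|
    .seq sizesP <| .seq classesP <| setP 0 rZ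

/-- The program. -/
def main : Prog := .seq paramP <| .seq charsP <| .seq marksP <| .seq (.loop 16 15 levelP) outputP

end Program

/-! ### The choice of the base and the other parameters -/

namespace Setup

open Finset

variable {k : ℕ}

/-- The base: the least power of two from `16` on with a large enough power. -/
def base (k : ℕ) : ℕ :=
  foldN (fun _ acc => if acc ^ 16 < (64 * 5) ^ 16 * k ^ 9 then 2 * acc else acc) 16 (k + 16)

/-- Invariant of the search: beyond the initial value the target is exceeded by at most one
doubling, and either all rounds so far were doublings or the target has been reached. -/
lemma base_aux (k n : ℕ) : ∃ d, 4 ≤ d ∧ d ≤ n + 4 ∧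
    foldN (fun _ acc => if acc ^ 16 < (64 * 5) ^ 16 * k ^ 9 then 2 * acc else acc) 16 n = 2 ^ d ∧
    (d = 4 ∨ (2 ^ d) ^ 16 ≤ 2 ^ 16 * ((64 * 5) ^ 16 * k ^ 9)) ∧
    (d = n + 4 ∨ (64 * 5) ^ 16 * k ^ 9 ≤ (2 ^ d) ^ 16) := by
  generalize hX : (64 * 5) ^ 16 * k ^ 9 = X
  induction n with
  | zero => exact ⟨4, by norm_num, by norm_num, by norm_num [foldN], Or.inl rfl, Or.inl rfl⟩
  | succ n ih =>
    obtain ⟨d, h1, h2, h3, h4, h5⟩ := ih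
    simp only [foldN]
    rw [h3]
    split_ifs with h
    · refine ⟨d + 1, by omega, by omega, by rw [pow_succ' 2 d], Or.inr ?_, ?_⟩
      · rw [pow_succ' 2 d, mul_pow]
        exact Nat.mul_le_mul_left _ h.le
      · rcases h5 with h5 | h5
        · left; omega
        · omega
    · exact ⟨d, h1, by omega, rfl, h4, Or.inr (by omega)⟩

lemma base_spec (k : ℕ) : ∃ d, 4 ≤ d ∧ d ≤ k + 20 ∧ base k = 2 ^ d ∧
    (d = 4 ∨ (2 ^ d) ^ 16 ≤ 2 ^ 16 * ((64 * 5) ^ 16 * k ^ 9)) ∧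
    (64 * 5) ^ 16 * k ^ 9 ≤ (2 ^ d) ^ 16 := by
  obtain ⟨d, h1, h2, h3, h4, h5⟩ := base_aux k (k + 16)
  refine ⟨d, h1, by omega, h3, h4, h5.elim (fun h => ?_) id⟩
  -- Even if all `k + 16` rounds double, the value `2 ^ (k + 20)` is beyond the target.
  have e1 : k ^ 9 ≤ (2 ^ k) ^ 16 := by
    have : k < 2 ^ k := Nat.lt_two_pow_self
    calc k ^ 9 ≤ (2 ^ k) ^ 9 := Nat.pow_le_pow_left this.le 9
      _ ≤ (2 ^ k) ^ 16 := Nat.pow_le_pow_right (by positivity) (by norm_num)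
  have e2 : 2 ^ d = 2 ^ 20 * 2 ^ k := by rw [h, ← pow_add]; congr 1; omega
  rw [e2, mul_pow (2 ^ 20)]
  exact Nat.mul_le_mul (Nat.pow_le_pow_left (by norm_num) 16) e1

/-- The parameters used for a type graph. -/
noncomputable def ofType (T : TypeGraph k) : Setup k where
  T := T
  b i := open Classical in
    if h : i < k then (if T.Adj ⟨i, h⟩ ⟨i, h⟩ then T.weight ⟨i, h⟩ else 1) else 0
  H := base k / 4
  L := Nat.clog 2 (4 * (∑ i, T.weight i) * (k * base k + 2) + 1)
  n := ∑ i, T.weight i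

variable (T : TypeGraph k)

lemma ofType_D : (ofType T).D = base k := by
  obtain ⟨d, h1, -, h3, -⟩ := base_spec k
  have : (4 : ℕ) ∣ base k := by
    rw [h3]; exact (pow_dvd_pow 2 (show 2 ≤ d by omega) : 2 ^ 2 ∣ 2 ^ d)
  exact Nat.mul_div_cancel' this

lemma ofType_R : (ofType T).R = k * base k + 2 := by rw [R, ofType_D]

lemma ofType_L : (ofType T).L = Nat.clog 2 (4 * (ofType T).n * (ofType T).R + 1) := by
  rw [ofType_R]; rfl

lemma ofType_isBin : (ofType T).IsBin := by
  obtain ⟨d, h1, -, h3, -⟩ := base_spec k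
  exact ⟨d, by rw [ofType_D, h3]⟩

lemma ofType_good (hk : 1 ≤ k) (hw : ∀ i, 1 ≤ T.weight i) : (ofType T).Good := by
  have hD := ofType_D T
  obtain ⟨d, h1, -, h3, -, h5⟩ := base_spec k
  have h16 : 16 ≤ base k := by
    rw [h3]; exact (Nat.pow_le_pow_right (by norm_num) h1 : 2 ^ 4 ≤ 2 ^ d)
  have hH : (ofType T).H = base k / 4 := rfl
  have hb : ∀ i (hi : i < k), (ofType T).b i ≤ T.weight ⟨i, hi⟩ := fun i hi => by
    simp only [ofType, dif_pos hi]
    split_ifs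
    · exact le_rfl
    · exact hw _
  have hsum : ∑ i ∈ range k, (ofType T).b i ≤ (ofType T).n := by
    rw [← Fin.sum_univ_eq_sum_range]
    exact sum_le_sum fun i _ => hb i i.2
  refine ⟨hk, ?_, by omega, fun i hi => ?_, hsum, ?_, ?_⟩
  -- As `H ≥ 4`, the base `4 * H` is at most `8 * (H - 2)`, which reduces `320 = 8 * 40` to the
  -- constant `40` of the discrepancy bound.
  · have e : base k ≤ 8 * ((ofType T).H - 2) := by unfold D at hD; omega
    have e2 : _ ≤ (8 * ((ofType T).H - 2)) ^ 16 :=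
      h5.trans (by rw [← h3]; exact Nat.pow_le_pow_left e 16)
    rw [mul_pow 8, show (64 * 5) ^ 16 = 8 ^ 16 * 40 ^ 16 by norm_num, mul_assoc] at e2
    exact Nat.le_of_mul_le_mul_left e2 (by norm_num)
  · exact (single_le_sum (fun _ _ => Nat.zero_le _) (mem_range.2 hi)).trans hsum
  · exact (hw ⟨0, hk⟩).trans (single_le_sum (f := T.weight) (fun _ _ => Nat.zero_le _) (mem_univ _))
  · have := Nat.le_pow_clog (by norm_num : 1 < 2) (4 * (ofType T).n * (ofType T).R + 1)
    rw [← ofType_L] at this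
    omega

end Setup

end NDColoring

namespace NDColoring

/-! ### Loop schemes with time measured by program length -/

section Wrappers

variable {W B U : ℕ} {s : State}

lemma within_sumFill (hC : Cap W B 64) (hs : s.Bd B) {a : ℕ}
    {off n m step post : Ex} (hoffk : off.Ok a) (hnk : n.Ok a) (hmk : m.Ok a)
    (hstepk : step.Ok a) (hpostk : post.Ok a) (hh : off.deg < 300)
    {n' o M τ : ℕ} {m' : ℕ → ℕ} {t : ℕ → ℕ → ℕ} {g : ℕ → ℕ → ℕ}
    (hn : n.eval (s.at 0 0 0) = n')
    (hm : ∀ i < n', m.eval (s.at i 0 0) = m' i)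
    (hoff : ∀ i j acc, off.eval (s.at i j acc) = o)
    (hf : ∀ i < n', ∀ j < m' i, ∀ acc, step.eval (s.at i j acc) = acc + t i j)
    (hg : ∀ i < n', ∀ acc, post.eval (s.at i (m' i) acc) = g i acc)
    (hM : ∀ i < n', m' i ≤ M) (hnB : n' ≤ B) (hmB : M ≤ B)
    (ht : ∀ i < n', ∀ j < m' i, t i j ≤ τ) (hτ : M * τ ≤ B)
    (hgB : ∀ i < n', ∀ acc ≤ M * τ, g i acc ≤ B) (hU : n' * (M + 1) + 1 ≤ U) :
    Within W U (fillP a off n m 0 step post) s fun s' =>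
      s.Keep B a s' ∧ (∀ i < n', s'.arr a (o + i) = g i (∑ j ∈ Finset.range (m' i), t i j)) ∧
        ∀ x, x < o ∨ o + n' ≤ x → s'.arr a x = s.arr a x :=
  (runs_sumFill hC hs hoffk hnk hmk hstepk hpostk hh hn hm hoff hf hg hM hnB hmB ht hτ hgB).within
    (fillC_le _ _ _ _ _ _ _) hU

lemma within_map (hC : Cap W B 64) (hs : s.Bd B) {a : ℕ}
    {off n post : Ex} (hoffk : off.Ok a) (hnk : n.Ok a) (hpostk : post.Ok a) (hh : off.deg < 300)
    {n' o : ℕ} {g : ℕ → ℕ} (hn : n.eval (s.at 0 0 0) = n')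
    (hoff : ∀ i j acc, off.eval (s.at i j acc) = o)
    (hg : ∀ i < n', post.eval (s.at i 0 0) = g i) (hnB : n' ≤ B) (hgB : ∀ i < n', g i ≤ B)
    (hU : n' + 1 ≤ U) :
    Within W U (mapP a off n post) s fun s' =>
      s.Keep B a s' ∧ (∀ i < n', s'.arr a (o + i) = g i) ∧
        ∀ x, x < o ∨ o + n' ≤ x → s'.arr a x = s.arr a x :=
  (runs_map hC hs hoffk hnk hpostk hh hn hoff hg hnB hgB).within (fillC_le _ _ _ _ _ _ _) hU

lemma within_searchFill (hC : Cap W B 64) (hs : s.Bd B) {a : ℕ}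
    {off n m c e post : Ex} (hoffk : off.Ok a) (hnk : n.Ok a) (hmk : m.Ok a)
    (hstepk : (Ex.cond c (.reg 12) e).Ok a) (hpostk : post.Ok a) (hh : off.deg < 300)
    {n' o M τ m' : ℕ} {p : ℕ → ℕ → Prop} {v : ℕ → ℕ → ℕ} {g : ℕ → ℕ → ℕ}
    (hn : n.eval (s.at 0 0 0) = n')
    (hm : ∀ i < n', m.eval (s.at i 0 0) = m')
    (hoff : ∀ i j acc, off.eval (s.at i j acc) = o)
    (hc : ∀ i < n', ∀ j < m', ∀ acc, c.eval (s.at i j acc) ≠ 0 ↔ p i j)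
    (he : ∀ i < n', ∀ j < m', ∀ acc, e.eval (s.at i j acc) = v i j)
    (hg : ∀ i < n', ∀ acc, post.eval (s.at i m' acc) = g i acc)
    (hM : m' ≤ M) (hnB : n' ≤ B) (hmB : M ≤ B)
    (ht : ∀ i < n', ∀ j < m', v i j ≤ τ) (hτ : τ ≤ B)
    (hgB : ∀ i < n', ∀ acc ≤ τ, g i acc ≤ B) (hU : n' * (M + 1) + 1 ≤ U) :
    Within W U (fillP a off n m 0 (Ex.cond c (.reg 12) e) post) s fun s' =>
      s.Keep B a s' ∧ (∀ i < n', (∃ j < m', p i j) →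
        ∃ j < m', p i j ∧ s'.arr a (o + i) = g i (v i j)) ∧
        (∀ i < n', ∃ acc ≤ τ, s'.arr a (o + i) = g i acc) ∧
        ∀ x, x < o ∨ o + n' ≤ x → s'.arr a x = s.arr a x :=
  (runs_searchFill hC hs hoffk hnk hmk hstepk hpostk hh hn hm hoff hc he hg hM hnB hmB ht hτ
    hgB).within (fillC_le _ _ _ _ _ _ _) hU

lemma within_foldSet (hC : Cap W B 64) (hs : s.Bd B) {x : ℕ} (hx : x < 10 ∨ 15 ≤ x)
    (hx' : x < 100) {m step e : Ex} {init : ℕ} (hm : m.Ok 50) (hstep : step.Ok 50) (he : e.Ok 50)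
    (hinit : init ≤ 64) {m' v : ℕ} {f : ℕ → ℕ → ℕ} (hm' : ∀ i, m.eval (s.at i 0 init) = m')
    (hf : ∀ i, ∀ j < m', ∀ acc, step.eval (s.at i j acc) = f j acc)
    (hv : ∀ i, e.eval (s.at i m' (foldN f init m')) = v)
    (hmB : m' ≤ B) (hfB : ∀ j ≤ m', foldN f init j ≤ B) (hvB : v ≤ B) (hU : m' + 1 ≤ U) :
    Within W U (foldSetP x m init step e) s (s.KeepReg B x v) :=
  (runs_foldSet hC hs hx hx' hm hstep he hinit hm' hf hv hmB hfB hvB).within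
    (foldSetC_le _ _ _ _ _) hU

lemma within_powFold (hC : Cap W B 64) (hs : s.Bd B) {x : ℕ} (hx : x < 10 ∨ 15 ≤ x)
    (hx' : x < 100) {m e : Ex} (hm : m.Ok 50) (he : e.Ok 50) {m' D v : ℕ}
    (hm' : ∀ i, m.eval (s.at i 0 1) = m') (hD : s.reg 2 = D) (hD0 : 0 < D)
    (hv : ∀ i, e.eval (s.at i m' (D ^ m')) = v) (hmB : m' ≤ B) (hDB : D ^ m' ≤ B) (hvB : v ≤ B)
    (hU : m' + 1 ≤ U) :
    Within W U (foldSetP x m 1 (.racc * .rD) e) s (s.KeepReg B x v) :=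
  within_foldSet hC hs hx hx' hm (by decide) he (by norm_num) hm'
    (f := fun _ acc => acc * D) (fun i j _ acc => by simp [hD])
    (fun i => by rw [foldN_mul, one_mul, hv i]) hmB
    (fun j hj => by rw [foldN_mul, one_mul]; exact (Nat.pow_le_pow_right hD0 hj).trans hDB) hvB hU

lemma within_sumFold (hC : Cap W B 64) (hs : s.Bd B) {x : ℕ} (hx : x < 10 ∨ 15 ≤ x)
    (hx' : x < 100) {m step e : Ex} (hm : m.Ok 50) (hstep : step.Ok 50) (he : e.Ok 50)
    {m' v : ℕ} {t : ℕ → ℕ} (hm' : ∀ i, m.eval (s.at i 0 0) = m')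
    (hf : ∀ i, ∀ j < m', ∀ acc, step.eval (s.at i j acc) = acc + t j)
    (hv : ∀ i, e.eval (s.at i m' (∑ j ∈ Finset.range m', t j)) = v)
    (hmB : m' ≤ B) (htB : ∑ j ∈ Finset.range m', t j ≤ B) (hvB : v ≤ B) (hU : m' + 1 ≤ U) :
    Within W U (foldSetP x m 0 step e) s (s.KeepReg B x v) :=
  within_foldSet hC hs hx hx' hm hstep he (by norm_num) hm' hf
    (fun i => by rw [foldN_add, zero_add, hv i]) hmB
    (fun j hj => by
      rw [foldN_add, zero_add]
      exact (Finset.sum_le_sum_of_subset (Finset.range_mono hj)).trans htB) hvB hU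

lemma within_fill (hC : Cap W B 64) (hs : s.Bd B) {a : ℕ}
    {off n m step post : Ex} {init : ℕ} (hoffk : off.Ok a) (hnk : n.Ok a) (hmk : m.Ok a)
    (hstepk : step.Ok a) (hpostk : post.Ok a) (hh : off.deg < 300) (hinit : init ≤ 64)
    {n' M : ℕ} {m' : ℕ → ℕ} {f : ℕ → ℕ → ℕ → ℕ} {g : ℕ → ℕ → ℕ}
    (hn : n.eval (s.at 0 0 0) = n')
    (hm : ∀ i < n', m.eval (s.at i 0 init) = m' i)
    (hoff : ∀ i j acc, off.eval (s.at i j acc) = 0)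
    (hf : ∀ i < n', ∀ j < m' i, ∀ acc, step.eval (s.at i j acc) = f i j acc)
    (hg : ∀ i < n', ∀ acc, post.eval (s.at i (m' i) acc) = g i acc)
    (hM : ∀ i < n', m' i ≤ M) (hnB : n' ≤ B) (hmB : M ≤ B)
    (hfB : ∀ i < n', ∀ j ≤ m' i, foldN (f i) init j ≤ B)
    (hgB : ∀ i < n', g i (foldN (f i) init (m' i)) ≤ B) (hU : n' * (M + 1) + 1 ≤ U) :
    Within W U (fillP a off n m init step post) s fun s' =>
      s.Keep B a s' ∧ ∀ i < n', s'.arr a i = g i (foldN (f i) init (m' i)) :=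
  ((runs_fill hC hs hoffk hnk hmk hstepk hpostk hh hinit hn hm hoff hf hg hM hnB hmB hfB
    hgB).mono le_rfl fun s' h => ⟨⟨h.1, h.2.1, h.2.2.2⟩, fun i hi => by
      rw [h.2.2.1, if_pos ⟨Nat.zero_le _, by omega⟩, Nat.sub_zero]⟩).within
    (fillC_le _ _ _ _ _ _ _) hU

lemma within_sto (hC : Cap W B 64) (hs : s.Bd B) (a : ℕ) {e f : Ex} (hw : e.Ok 50) (hw' : f.Ok 50)
    {m v : ℕ} (he : e.eval s = m) (hf : f.eval s = v) (hv : v ≤ B) (hU : 1 ≤ U) :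
    Within W U (stoP a e f) s fun s' => s.IsSto a m v s' ∧ s'.Bd B := by
  subst he hf
  refine Runs.mono (runs_sto hC hs a e f hw.1 hw'.1 hw.2 hw'.2 hv) ?_ fun _ h => h
  simp only [stoP, Prog.len, Ex.len_comp]
  nlinarith

end Wrappers

/-! ### The computation of the parameters -/

namespace Setup

open Finset Program

variable {k : ℕ} {A : Setup k} {s s' : State} {W : ℕ}

/-- The registers holding the parameters. -/
structure Regs (A : Setup k) (s : State) : Prop where
  r0 : s.reg 0 = k
  r2 : s.reg 2 = A.D
  r3 : s.reg 3 = A.kap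
  r4 : s.reg 4 = A.N
  r5 : s.reg 5 = A.Z
  r6 : s.reg 6 = A.P
  r7 : s.reg 7 = A.R
  r8 : s.reg 8 = A.M
  r9 : s.reg 9 = A.D ^ A.tau
  r15 : s.reg 15 = A.L
  r27 : s.reg 27 = 0

lemma Regs.congr (h : A.Regs s)
    (hs : ∀ y < 100, y < 10 ∨ 15 ≤ y → y < 16 ∨ y = 27 → s'.reg y = s.reg y) : A.Regs s' := by
  refine ⟨?_, ?_, ?_, ?_, ?_, ?_, ?_, ?_, ?_, ?_, ?_⟩ <;>
    rw [hs _ (by norm_num) (by norm_num) (by norm_num)]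
  exacts [h.r0, h.r2, h.r3, h.r4, h.r5, h.r6, h.r7, h.r8, h.r9, h.r15, h.r27]

lemma Good.R_le_U (h : A.Good) : 8 * A.R ≤ A.U := by
  have h1 := h.N_pos
  have h2 : 0 < A.P := by have := h.R_le_P; have := A.R_pos; omega
  have h3 : A.P * 1 ≤ A.P * (A.P * (A.N * A.N * A.N)) := Nat.mul_le_mul_left _ (by
    have : 0 < A.P * (A.N * A.N * A.N) := by positivity
    omega)
  have h4 := h.R_le_P
  rw [← mul_assoc] at h3
  unfold U
  omega

lemma Good.D_ge (h : A.Good) : 16 ≤ A.D := by have := h.two; unfold D; omega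

lemma foldN_mono {f : ℕ → ℕ → ℕ} (h : ∀ j acc, acc ≤ f j acc) {init j n : ℕ} (hj : j ≤ n) :
    foldN f init j ≤ foldN f init n := by
  induction hj with
  | refl => exact le_rfl
  | step _ ih => exact ih.trans (h _ _)

set_option maxRecDepth 4000 in
theorem within_param (h : A.Good) (hC : Cap W A.B 64) (hD : A.D = base k)
    (hL : A.L = Nat.clog 2 (4 * A.n * A.R + 1)) (hs : s.Bd A.B) (h0 : s.reg 0 = k)
    (hreg : ∀ x ≠ 0, s.reg x = 0) (hn : ∑ i ∈ range k, s.arr 0 i = A.n) :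
    Within W (A.U * (A.L + 1)) paramP s fun s' => A.Regs s' ∧ s'.reg 16 = 0 ∧ s'.reg 18 = 0 ∧
      s'.reg 21 = 2 ^ A.L ∧ s'.arr = s.arr ∧ s'.Bd A.B := by
  have hU := h.R_le_U
  have hUL : A.U * 1 ≤ A.U * (A.L + 1) := Nat.mul_le_mul_left _ (by omega)
  have hR := h.k_le_R
  have hR2 : 2 * k + A.D ≤ A.R := by
    have := h.D_ge
    have := h.pos
    unfold R; nlinarith
  have hD16 := h.D_ge
  have hk := h.pos
  have hkap : A.kap ≤ k := by unfold kap; omega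
  have hrr := A.rr_le
  have htau : A.tau ≤ A.rr := Nat.le_mul_of_pos_right _ (by omega)
  have hDM : ∀ j ≤ A.rr, A.D ^ j ≤ A.Q ^ 1 := fun j hj =>
    ((Nat.pow_le_pow_right h.D_pos hj).trans (Nat.le_succ _)).trans A.M_Q
  have hDZ : ∀ j ≤ k, A.D ^ j ≤ A.Q ^ 1 := fun j hj =>
    (Nat.pow_le_pow_right h.D_pos hj).trans A.Z_Q
  have hDP : A.D ^ (k - 2 * A.kap) ≤ A.Q ^ 1 := hDZ _ (by omega)
  have hRQ := h.R_Q
  refine Within.seq (within_foldSet hC hs (by norm_num) (by norm_num) (by decide) (by decide)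
    (by decide) (by norm_num) (m' := k + 16) (v := A.D)
    (f := fun _ acc => if acc ^ 16 < (64 * 5) ^ 16 * k ^ 9 then 2 * acc else acc)
    (fun i => by simp [h0]) (fun i j _ acc => ?_) (fun i => ?_)
    (A.le_pow (h.R_Q.trans' (by omega)) (by norm_num)) (fun j hj => ?_)
    (A.le_pow A.D_Q (by norm_num)) (by omega)) fun s1 h1 => ?_
  · simp only [Ex.eval_cond, Ex.eval_lt, Ex.eval_pow, Ex.eval_mul, Ex.eval_lit, Ex.eval_reg,
      State.at_reg, h0]
    split_ifs <;> simp_all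
  · simp only [Ex.eval_reg, State.at_reg]
    exact hD.symm
  · refine (foldN_mono (fun _ acc => ?_) hj).trans (hD.symm.trans_le (A.le_pow A.D_Q (by norm_num)))
    split_ifs <;> omega
  refine Within.seq (within_set hC h1.bd (x := 3) (v := A.kap) (by norm_num) (by decide)
    (by simp [h1.regs, h0, kap]) (A.le_pow (k_Q.trans' hkap) (by norm_num)) (by omega))
    fun s2 h2 => ?_
  refine Within.seq (within_powFold hC h2.bd (x := 4) (by norm_num) (by norm_num) (by decide)
    (by decide) (m' := A.kap) (D := A.D) (v := A.N) (by simp [h2.regs]) (by simp [h2.regs, h1.regs])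
    h.D_pos (by simp [N]) (A.le_pow (k_Q.trans' hkap) (by norm_num))
    (A.le_pow (hDZ _ hkap) (by norm_num)) (A.le_pow h.N_Q (by norm_num)) (by omega)) fun s3 h3 => ?_
  refine Within.seq (within_powFold hC h3.bd (x := 5) (by norm_num) (by norm_num) (by decide)
    (by decide) (m' := k) (D := A.D) (v := A.Z) (by simp [h3.regs, h2.regs, h1.regs, h0])
    (by simp [h3.regs, h2.regs, h1.regs])
    h.D_pos (by simp [Z]) (A.le_pow k_Q (by norm_num))
    (A.le_pow (hDZ _ le_rfl) (by norm_num)) (A.le_pow Z_Q (by norm_num)) (by omega)) fun s4 h4 => ?_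
  refine Within.seq (within_set hC h4.bd (x := 7) (v := A.R) (by norm_num) (by decide)
    (by simp [h4.regs, h3.regs, h2.regs, h1.regs, h0, R]) (A.le_pow h.R_Q (by norm_num)) (by omega))
    fun s5 h5 => ?_
  refine Within.seq (within_powFold hC h5.bd (x := 6) (by norm_num) (by norm_num) (by decide)
    (by decide) (m' := k - 2 * A.kap) (D := A.D) (v := A.P)
    (by simp [h5.regs, h4.regs, h3.regs, h2.regs, h1.regs, h0])
    (by simp [h5.regs, h4.regs, h3.regs, h2.regs, h1.regs])
    h.D_pos (by simp [h5.regs, P]) (A.le_pow (k_Q.trans' (by omega)) (by norm_num))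
    (A.le_pow hDP (by norm_num)) (A.le_pow P_Q (by norm_num)) (by omega)) fun s6 h6 => ?_
  refine Within.seq (within_powFold hC h6.bd (x := 9) (by norm_num) (by norm_num) (by decide)
    (by decide) (m' := A.tau) (D := A.D) (v := A.D ^ A.tau)
    (by simp [h6.regs, h5.regs, h4.regs, h3.regs, h2.regs, h1.regs, tau])
    (by simp [h6.regs, h5.regs, h4.regs, h3.regs, h2.regs, h1.regs])
    h.D_pos (by simp) (A.le_pow (h.R_Q.trans' (by omega)) (by norm_num))
    (A.le_pow (hDM _ htau) (by norm_num)) (A.le_pow (hDM _ htau) (by norm_num)) (by omega))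
    fun s7 h7 => ?_
  refine Within.seq (within_powFold hC h7.bd (x := 8) (by norm_num) (by norm_num) (by decide)
    (by decide) (m' := A.rr) (D := A.D) (v := A.M)
    (by simp [h7.regs, h6.regs, h5.regs, h4.regs, h3.regs, h2.regs, h1.regs, tau, rr])
    (by simp [h7.regs, h6.regs, h5.regs, h4.regs, h3.regs, h2.regs, h1.regs])
    h.D_pos (by simp [M]) (A.le_pow (h.R_Q.trans' (by omega)) (by norm_num))
    (A.le_pow (hDM _ le_rfl) (by norm_num)) (A.le_pow M_Q (by norm_num)) (by omega))
    fun s8 h8 => ?_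
  have hbound : 4 * A.n * A.R + 1 ≤ A.B := A.le_pow
    (add_Q (p := 2) (q := 0) (mul_Q (mul_Q (lit_Q (by norm_num)) n_Q) h.R_Q) (lit_Q (by norm_num)))
    (by norm_num)
  have ha8 : s8.arr = s.arr := by
    rw [h8.arrs, h7.arrs, h6.arrs, h5.arrs, h4.arrs, h3.arrs, h2.arrs, h1.arrs]
  refine Within.seq (within_sumFold hC h8.bd (x := 20) (by norm_num) (by norm_num) (by decide)
    (by decide) (by decide) (m' := k) (v := 4 * A.n * A.R + 1) (t := s.arr 0)
    (by simp [h8.regs, h7.regs, h6.regs, h5.regs, h4.regs, h3.regs, h2.regs, h1.regs, h0])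
    (by simp [ha8]) (fun i => by simp [h8.regs, h7.regs, h6.regs, h5.regs, hn])
    (A.le_pow k_Q (by norm_num)) (by rw [hn]; exact A.le_pow n_Q (by norm_num)) hbound (by omega))
    fun s9 h9 => ?_
  refine Within.seq (within_set hC h9.bd (x := 21) (v := 1) (by norm_num) (by decide)
    rfl (A.le_pow (A.lit_Q (x := 1) (by norm_num)) (by norm_num)) (by omega))
    fun s10 h10 => ?_
  have hpow : ∀ j ≤ A.L, 2 ^ j ≤ A.B := fun j hj =>
    (Nat.pow_le_pow_right (by norm_num) hj).trans (A.le_pow L_Q (by norm_num))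
  -- Register `21` is doubled until it reaches `4 * n * R + 1`, and register `15` counts the
  -- doublings; their number is the binary ceiling logarithm.
  refine Within.mono (Within.loop (fun j t => (∀ y < 100, y < 10 ∨ 15 ≤ y → y ≠ 15 → y ≠ 21 →
    t.reg y = s9.reg y) ∧ t.reg 15 = j ∧ t.reg 21 = 2 ^ j ∧ t.arr = s.arr ∧ t.Bd A.B) A.L
    h.one_le_U (fun j hj t ht => ?_) (fun t ht => ?_) ?_) le_rfl fun t ht => ?_
  · obtain ⟨t1, t2, t3, t4, t5⟩ := ht
    refine ⟨?_, Within.seq (within_set hC t5 (x := 21) (v := 2 ^ (j + 1)) (by norm_num) (by decide)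
      (by simp [t3, pow_succ']) (hpow _ hj) h.one_le_U) fun t' h' =>
      Within.mono (within_set hC h'.bd (x := 15) (v := j + 1) (by norm_num) (by decide)
      (by simp [h'.regs, t2]) ((Nat.lt_two_pow_self).le.trans (hpow _ hj)) h.one_le_U) le_rfl
      fun t'' h'' => ⟨fun y hy hy' h15 h21 => ?_, ?_, ?_, ?_, h''.bd⟩⟩
    · rw [t3, t1 20 (by norm_num) (by norm_num) (by norm_num) (by norm_num)]
      simp only [h9.regs 20 (by norm_num) (by norm_num), if_true]
      rw [hL] at hj
      exact (Nat.lt_clog_iff_pow_lt (by norm_num)).1 hj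
    · rw [h''.regs y hy hy', if_neg h15, h'.regs y hy hy', if_neg h21, t1 y hy hy' h15 h21]
    · simp [h''.regs]
    · simp [h''.regs, h'.regs]
    · rw [h''.arrs, h'.arrs, t4]
  · obtain ⟨t1, t2, t3, t4, t5⟩ := ht
    rw [t3, t1 20 (by norm_num) (by norm_num) (by norm_num) (by norm_num)]
    simp only [h9.regs 20 (by norm_num) (by norm_num), if_true]
    rw [hL, not_lt]
    exact Nat.le_pow_clog (by norm_num) _
  · refine ⟨fun y hy hy' h15 h21 => ?_, ?_, ?_, ?_, h10.bd⟩
    · rw [h10.regs y hy hy', if_neg h21]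
    · simp [h10.regs, h9.regs, h8.regs, h7.regs, h6.regs, h5.regs, h4.regs, h3.regs, h2.regs,
        h1.regs, hreg]
    · simp [h10.regs]
    · rw [h10.arrs, h9.arrs, ha8]
  -- Registers `16`, `18` and `27` have not been written; their initial zeros serve as the level,
  -- the least cost at level `0`, and a constant zero.
  · obtain ⟨t1, t2, t3, t4, t5⟩ := ht
    refine ⟨⟨?_, ?_, ?_, ?_, ?_, ?_, ?_, ?_, ?_, t2, ?_⟩, ?_, ?_, t3, t4, t5⟩ <;>
      rw [t1 _ (by norm_num) (by norm_num) (by norm_num) (by norm_num)] <;>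
      simp [h9.regs, h8.regs, h7.regs, h6.regs, h5.regs, h4.regs, h3.regs, h2.regs, h1.regs, hreg,
        h0]

end Setup

end NDColoring

namespace NDColoring

lemma index_div {N y u : ℕ} (hu : u < N) : (y * N + u) / N = y := by
  rw [mul_comm, Nat.mul_add_div (by omega), Nat.div_eq_of_lt hu, add_zero]

lemma index_mod {N y u : ℕ} (hu : u < N) : (y * N + u) % N = u := by
  rw [Nat.mul_add_mod_self_right, Nat.mod_eq_of_lt hu]

lemma div_pow_mod (D i x : ℕ) : x / D ^ i % D = dig D i x := rfl

lemma foldN_mulMod {w M : ℕ} (hM : 2 ≤ M) (n : ℕ) :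
    foldN (fun _ acc => acc * w % M) 1 n = w ^ n % M := by
  induction n with
  | zero => simp [foldN, Nat.mod_eq_of_lt hM]
  | succ n ih => rw [foldN, ih, pow_succ, Nat.mod_mul_mod]

/-! ### The computation of the tables -/

namespace Setup

open Finset Program

variable {k : ℕ} {A : Setup k} {s s' : State} {W : ℕ}

lemma Regs.keep {B a : ℕ} (h : A.Regs s) (hs : s.Keep B a s') : A.Regs s' :=
  h.congr fun y hy hy' _ => hs.regs y hy hy'

/-- Raising `D ^ tau` to the power `D / 2` gives `D ^ rr`, which is `-1` modulo `D ^ rr + 1`. -/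
lemma Good.root_pow (_ : A.Good) : ((A.D : ZMod A.M) ^ A.tau) ^ A.D = 1 := by
  have h1 : ((A.D : ZMod A.M) ^ A.tau) ^ (A.D / 2) = -1 := by
    rw [← pow_mul]
    have : ((A.D ^ A.rr + 1 : ℕ) : ZMod A.M) = 0 := ZMod.natCast_self A.M
    push_cast at this
    rw [rr] at this
    linear_combination this
  have h2 : A.D = A.D / 2 * 2 := by unfold D; omega
  calc _ = (((A.D : ZMod A.M) ^ A.tau) ^ (A.D / 2)) ^ 2 := by rw [← pow_mul _ (A.D / 2), ← h2]
    _ = 1 := by rw [h1]; ring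

/-- Exponents only matter modulo `D`, so a list of `D` powers of the root provides all character
values. -/
lemma Good.cast_root (h : A.Good) (e : ℕ) :
    (((A.D ^ A.tau) ^ (e % A.D) % A.M : ℕ) : ZMod A.M) = ((A.D : ZMod A.M) ^ A.tau) ^ e := by
  rw [ZMod.natCast_mod]
  push_cast
  conv_rhs => rw [← Nat.div_add_mod e A.D, pow_add, pow_mul, h.root_pow, one_pow, one_mul]

/-- The tables of the demands and the characters. -/
structure Chars (A : Setup k) (s : State) : Prop where
  a4 : ∀ i < k, s.arr 4 i = A.b i
  a5 : ∀ i < k, s.arr 5 i = A.D ^ i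
  a7 : ∀ y < A.N, ∀ u < A.N,
    (s.arr 7 (y * A.N + u) : ZMod A.M) = ((A.D : ZMod A.M) ^ A.tau) ^ dot A.D A.kap y u
  a7_lt : ∀ i < A.N * A.N, s.arr 7 i < A.M
  a8 : ∀ y < A.N, ∀ u < A.N,
    (s.arr 8 (y * A.N + u) : ZMod A.M) = ((A.D : ZMod A.M) ^ A.tau) ^ ((A.D - 1) * dot A.D A.kap y u)
  a8_lt : ∀ i < A.N * A.N, s.arr 8 i < A.M

lemma Chars.congr (h : A.Chars s)
    (ha : ∀ b, b = 4 ∨ b = 5 ∨ b = 7 ∨ b = 8 → s'.arr b = s.arr b) : A.Chars s' := by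
  obtain ⟨h4, h5, h7, h7', h8, h8'⟩ := h
  refine ⟨?_, ?_, ?_, ?_, ?_, ?_⟩
  · rwa [ha 4 (by norm_num)]
  · rwa [ha 5 (by norm_num)]
  · rwa [ha 7 (by norm_num)]
  · rwa [ha 7 (by norm_num)]
  · rwa [ha 8 (by norm_num)]
  · rwa [ha 8 (by norm_num)]

open Classical in
/-- The auxiliary tables. -/
structure Env (A : Setup k) (s : State) : Prop where
  regs : A.Regs s
  chars : A.Chars s
  a9 : ∀ x < A.Z, s.arr 9 x = if Half A.D k x then 1 else 0
  a19 : ∀ x < A.Z, s.arr 19 x = ∑ i ∈ range k, if A.H < dig A.D i x then 1 else 0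
  a16 : ∀ m, s.arr 16 m = 0
  bd : s.Bd A.B

lemma Env.congr (h : A.Env s) (hr : A.Regs s')
    (ha : ∀ b, b = 4 ∨ b = 5 ∨ b = 7 ∨ b = 8 ∨ b = 9 ∨ b = 16 ∨ b = 19 → s'.arr b = s.arr b)
    (hb : s'.Bd A.B) : A.Env s' := by
  obtain ⟨-, hc, h9, h19, h16, -⟩ := h
  refine ⟨hr, hc.congr fun b hb => ha b (by omega), ?_, ?_, ?_, hb⟩
  · rwa [ha 9 (by norm_num)]
  · rwa [ha 19 (by norm_num)]
  · rwa [ha 16 (by norm_num)]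

lemma Env.keep {a : ℕ} (h : A.Env s) (hs : s.Keep A.B a s')
    (ha : a ∉ [4, 5, 7, 8, 9, 16, 19]) : A.Env s' :=
  h.congr (h.regs.keep hs) (fun b hb => hs.arrs b (by rintro rfl; simp at ha; omega)) hs.bd

lemma Env.keepReg {x v : ℕ} (h : A.Env s) (hs : s.KeepReg A.B x v s') (hx : 16 ≤ x)
    (hx' : x ≠ 27) : A.Env s' :=
  h.congr (h.regs.congr fun y hy hy' hy'' => by rw [hs.regs y hy hy', if_neg (by omega)])
    (fun b _ => by rw [hs.arrs]) hs.bd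

lemma le_unit {a b c d e : ℕ} (ha : a ≤ A.P) (hb : b ≤ A.P) (hc : c ≤ A.N)
    (hd : d ≤ A.N) (he : e ≤ A.N) : a * b * (c * d * e) ≤ A.P * A.P * (A.N * A.N * A.N) := by
  gcongr

lemma Good.one_le_P (h : A.Good) : 1 ≤ A.P := by have := h.R_le_P; have := A.R_pos; omega

theorem within_chars (h : A.Good) (hC : Cap W A.B 64) (hr : A.Regs s) (hs : s.Bd A.B)
    (hb : ∀ i < k, (if s.arr 1 (i * k + i) = 0 then 1 else s.arr 0 i) = A.b i) :
    Within W A.U charsP s fun s' => A.Chars s' ∧ s'.Bd A.B ∧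
      (∀ y < 100, y < 10 ∨ 15 ≤ y → s'.reg y = s.reg y) ∧ s'.arr 1 = s.arr 1 ∧
      s'.arr 16 = s.arr 16 := by
  have hU := h.R_le_U
  have hkR := h.k_le_R
  have hDR := h.D_le_R
  have hRP := h.R_le_P
  have hP1 := h.one_le_P
  have hN1 : 1 ≤ A.N := h.N_pos
  have hZ1 : 0 < A.Z := h.Z_pos
  have hk := h.pos
  have hkap : A.kap ≤ k := by unfold kap; omega
  have hM := h.M_ge
  have hkB : k ≤ A.B := A.le_pow k_Q (by norm_num)
  have hNNB : A.N * A.N ≤ A.B := A.le_pow (mul_Q h.N_Q h.N_Q) (by norm_num)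
  have hZB : A.Z ≤ A.B := A.le_pow Z_Q (by norm_num)
  have hMB : A.M ≤ A.B := A.le_pow M_Q (by norm_num)
  have hdQ : ∀ i x, dig A.D i x ≤ A.Q ^ 1 := fun i x => (dig_lt h.D_pos i x).le.trans D_Q
  have hS : A.U = 8 * (A.P * A.P * (A.N * A.N * A.N)) := rfl
  have u1 := A.le_unit (a := A.kap) (b := 1) (c := A.N) (d := A.N) (e := 1) (by omega) hP1 le_rfl
    le_rfl hN1
  have u2 := A.le_unit (a := 1) (b := 1) (c := A.N) (d := A.N) (e := 1) hP1 hP1 le_rfl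
    le_rfl hN1
  have u3 := A.le_unit (a := 1) (b := 1) (c := 1) (d := 1) (e := 1) hP1 hP1 hN1 hN1 hN1
  have u4 : A.Z * (A.R * A.P) ≤ A.P * A.P * (A.N * A.N * A.N) := by
    calc A.Z * (A.R * A.P) = A.R * A.Z * A.P := by ring
      _ = A.P * A.P * (A.N * A.N * 1) := by rw [← PNN]; ring
      _ ≤ _ := A.le_unit le_rfl le_rfl le_rfl le_rfl hN1
  have u5 : A.Z * (k * k) ≤ A.Z * (A.R * A.P) := by gcongr; omega
  have u6 : A.Z * 1 ≤ A.Z * (A.R * A.P) := Nat.mul_le_mul_left _ (by nlinarith)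
  have u7 : A.Z * (k * 1) ≤ A.Z * (A.R * A.P) := by gcongr
  have u8 : A.Z * (A.R * 1) ≤ A.Z * (A.R * A.P) := by gcongr
  have u9 : k * k ≤ A.P * A.P * (A.N * A.N * A.N) := by
    simpa using A.le_unit (a := k) (b := k) (c := 1) (d := 1) (e := 1) (by omega) (by omega) hN1 hN1 hN1
  have u10 : A.D * A.D ≤ A.P * A.P * (A.N * A.N * A.N) := by
    simpa using A.le_unit (a := A.D) (b := A.D) (c := 1) (d := 1) (e := 1) (by omega) (by omega) hN1 hN1 hN1
  obtain ⟨hr0, hr2, hr3, hr4, hr5, hr6, hr7, hr8, hr9, hr15, hr27⟩ := hr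
  refine Within.seq (within_map hC hs (a := 4) (by decide) (by decide) (by decide) (by decide)
    (n' := k) (o := 0) (g := A.b) (by simp [hr0]) (by simp)
    (fun i hi => by simp [hr0, hb i hi]) hkB
    (fun i hi => (h.le i hi).trans (A.le_pow n_Q (by norm_num))) (by omega)) fun s1 h1 => ?_
  obtain ⟨k1, v1, -⟩ := h1
  refine Within.seq (within_fill hC k1.bd (a := 5) (by decide) (by decide) (by decide) (by decide)
    (by decide) (by decide) (by norm_num) (n' := k) (M := k) (m' := fun i => i)
    (f := fun _ _ acc => acc * A.D) (g := fun _ acc => acc) (by simp [k1.regs, hr0]) (by simp)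
    (by simp) (by simp [k1.regs, hr2]) (by simp) (fun i hi => hi.le) hkB hkB
    (fun i hi j hj => ?_) (fun i hi => ?_) ?_) fun s2 h2 => ?_
  · rw [foldN_mul, one_mul]
    exact (Nat.pow_le_pow_right h.D_pos (by omega)).trans hZB
  · rw [foldN_mul, one_mul]
    exact (Nat.pow_le_pow_right h.D_pos (by omega)).trans hZB
  · have : k * (k + 1) + 1 = k * k + k + 1 := by ring
    omega
  obtain ⟨k2, v2⟩ := h2
  simp only [foldN_mul, one_mul] at v2
  refine Within.seq (within_fill hC k2.bd (a := 6) (by decide) (by decide) (by decide) (by decide)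
    (by decide) (by decide) (by norm_num) (n' := A.D) (M := A.D) (m' := fun i => i)
    (f := fun _ _ acc => acc * A.D ^ A.tau % A.M) (g := fun _ acc => acc)
    (by simp [k2.regs, k1.regs, hr2]) (by simp)
    (by simp) (by simp [k2.regs, k1.regs, hr8, hr9]) (by simp) (fun i hi => hi.le)
    (A.le_pow D_Q (by norm_num)) (A.le_pow D_Q (by norm_num))
    (fun i hi j hj => ?_) (fun i hi => ?_) ?_) fun s3 h3 => ?_
  · rw [foldN_mulMod hM]
    exact (Nat.mod_lt _ (by omega)).le.trans hMB
  · rw [foldN_mulMod hM]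
    exact (Nat.mod_lt _ (by omega)).le.trans hMB
  · have : A.D * (A.D + 1) + 1 = A.D * A.D + A.D + 1 := by ring
    omega
  obtain ⟨k3, v3⟩ := h3
  simp only [foldN_mulMod hM] at v3
  have p3 : ∀ i < k, s3.arr 5 i = A.D ^ i := fun i hi => by rw [k3.arrs 5 (by norm_num), v2 i hi]
  refine Within.seq (within_sumFill hC k3.bd (a := 18) (by decide) (by decide) (by decide)
    (by decide) (by decide) (by decide) (n' := A.N * A.N) (o := 0) (M := A.kap) (τ := A.Q ^ 2)
    (m' := fun _ => A.kap) (t := fun i j => dig A.D j (i / A.N) * dig A.D j (i % A.N))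
    (g := fun _ acc => acc) (by simp [k3.regs, k2.regs, k1.regs, hr4])
    (by simp [k3.regs, k2.regs, k1.regs, hr3]) (by simp) (fun i hi j hj acc => ?_) (by simp)
    (by simp) hNNB (hkap.trans hkB) (fun i hi j hj => mul_Q (hdQ _ _) (hdQ _ _))
    (A.le_pow (mul_Q (k_Q.trans' hkap) le_rfl) (by norm_num))
    (fun i hi acc hacc => hacc.trans (A.le_pow (mul_Q (k_Q.trans' hkap) le_rfl) (by norm_num))) ?_)
    fun s4 h4 => ?_
  · simp [k3.regs, k2.regs, k1.regs, hr2, hr4, p3 j (by omega), div_pow_mod]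
  · have : A.N * A.N * (A.kap + 1) + 1 = A.kap * 1 * (A.N * A.N * 1) + 1 * 1 * (A.N * A.N * 1) + 1 := by ring
    omega
  obtain ⟨k4, v4, -⟩ := h4
  simp only [zero_add] at v1 v4
  have hD0 := h.D_pos
  have hNN : A.N * A.N + 1 ≤ A.U := by
    have : A.N * A.N + 1 = 1 * 1 * (A.N * A.N * 1) + 1 := by ring
    omega
  have v3' : ∀ i < A.D, s4.arr 6 i = (A.D ^ A.tau) ^ i % A.M := fun i hi => by
    rw [k4.arrs 6 (by norm_num), v3 i hi]
  refine Within.seq (within_map hC k4.bd (a := 7) (by decide) (by decide) (by decide) (by decide)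
    (n' := A.N * A.N) (o := 0) (g := fun i =>
      (A.D ^ A.tau) ^ (dot A.D A.kap (i / A.N) (i % A.N) % A.D) % A.M)
    (by simp [k4.regs, k3.regs, k2.regs, k1.regs, hr4]) (by simp)
    (fun i hi => ?_) hNNB
    (fun i hi => (Nat.mod_lt _ (by omega)).le.trans hMB) hNN) fun s5 h5 => ?_
  · simp only [Ex.eval_get, Ex.eval_mod, Ex.eval_reg, State.at_reg, State.at_arr]
    simp only [k4.regs, k3.regs, k2.regs, k1.regs, hr2, v4 i hi, Nat.reduceLT, Nat.reduceLeDiff, true_or,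
      if_true, Nat.reduceEqDiff, if_false]
    rw [v3' _ (Nat.mod_lt _ hD0)]
    rfl
  obtain ⟨k5, v5, -⟩ := h5
  refine Within.mono (within_map hC k5.bd (a := 8) (by decide) (by decide) (by decide) (by decide)
    (n' := A.N * A.N) (o := 0) (g := fun i =>
      (A.D ^ A.tau) ^ (((A.D - 1) * dot A.D A.kap (i / A.N) (i % A.N)) % A.D) % A.M)
    (by simp [k5.regs, k4.regs, k3.regs, k2.regs, k1.regs, hr4]) (by simp)
    (fun i hi => ?_) hNNB
    (fun i hi => (Nat.mod_lt _ (by omega)).le.trans hMB) hNN) le_rfl fun s6 h6 => ?_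
  · simp only [Ex.eval_get, Ex.eval_mod, Ex.eval_mul, Ex.eval_sub, Ex.eval_lit, Ex.eval_reg,
      State.at_reg, State.at_arr]
    simp only [k5.regs, k4.regs, k3.regs, k2.regs, k1.regs, hr2, k5.arrs 18 (by norm_num),
      k5.arrs 6 (by norm_num), v4 i hi, Nat.reduceLT, Nat.reduceLeDiff, true_or,
      if_true, Nat.reduceEqDiff, if_false]
    rw [v3' _ (Nat.mod_lt _ hD0)]
    rfl
  obtain ⟨k6, v6, -⟩ := h6
  simp only [zero_add] at v5 v6
  have q6 : ∀ y < 100, y < 10 ∨ 15 ≤ y → s6.reg y = s.reg y := fun y hy hy' => by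
    rw [k6.regs y hy hy', k5.regs y hy hy', k4.regs y hy hy', k3.regs y hy hy', k2.regs y hy hy',
      k1.regs y hy hy']
  refine ⟨⟨fun i hi => ?_, fun i hi => ?_, fun y hy u hu => ?_, fun i hi => ?_,
    fun y hy u hu => ?_, fun i hi => ?_⟩, k6.bd, q6, ?_, ?_⟩
  · rw [k6.arrs 4 (by norm_num), k5.arrs 4 (by norm_num),
      k4.arrs 4 (by norm_num), k3.arrs 4 (by norm_num), k2.arrs 4 (by norm_num), v1 i hi]
  · rw [k6.arrs 5 (by norm_num), k5.arrs 5 (by norm_num), k4.arrs 5 (by norm_num), p3 i hi]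
  · rw [k6.arrs 7 (by norm_num), v5 _ (index_lt hy hu), index_div hu, index_mod hu, h.cast_root]
  · rw [k6.arrs 7 (by norm_num), v5 _ hi]
    exact Nat.mod_lt _ (by omega)
  · rw [v6 _ (index_lt hy hu), index_div hu, index_mod hu, h.cast_root]
  · rw [v6 _ hi]
    exact Nat.mod_lt _ (by omega)
  · rw [k6.arrs 1 (by norm_num), k5.arrs 1 (by norm_num), k4.arrs 1 (by norm_num),
      k3.arrs 1 (by norm_num), k2.arrs 1 (by norm_num), k1.arrs 1 (by norm_num)]
  · rw [k6.arrs 16 (by norm_num), k5.arrs 16 (by norm_num), k4.arrs 16 (by norm_num),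
      k3.arrs 16 (by norm_num), k2.arrs 16 (by norm_num), k1.arrs 16 (by norm_num)]

open Classical in
-- The factors are the conditions of `Good.f_zero_iff` in the arithmetic form in which the program
-- evaluates them.
lemma Good.tab_zero_eq (h : A.Good) (X : ℕ) : (if Half A.D k (X % A.Z) then 1 else 0) *
    (if (∀ i < k, dig A.D i (X % A.Z) ≤ A.H + 1) ∧ ∀ i j : Fin k, i ≠ j →
      A.H < dig A.D i (X % A.Z) → A.H < dig A.D j (X % A.Z) → ¬ A.T.Adj i j then 1 else 0) *
    (if X / A.Z = 0 then (if ∀ i < k, dig A.D i (X % A.Z) ≤ A.H then 1 else 0) else 1) =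
    if A.Tab 0 X then 1 else 0 := by
  have key := h.f_zero_iff (x := X % A.Z) (X / A.Z)
  rw [or_iff_not_imp_left, not_not] at key
  rw [if_congr (show A.Tab 0 X ↔ _ from and_congr_right fun _ => key) rfl rfl]
  split_ifs <;> first | rfl | (exfalso; tauto)

open Classical in
theorem within_marks (h : A.Good) (hC : Cap W A.B 64) (hr : A.Regs s) (hs : s.Bd A.B)
    (hc : A.Chars s)
    (hadj : ∀ i j : Fin k, s.arr 1 (i * k + j) = if A.T.Adj i j then 1 else 0)
    (h16 : ∀ m, s.arr 16 m = 0) :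
    Within W A.U marksP s fun s' => A.Env s' ∧ (∀ y < 100, y < 10 ∨ 15 ≤ y → s'.reg y = s.reg y) ∧
      ∀ X < A.R * A.Z, s'.arr 10 X = if A.Tab 0 X then 1 else 0 := by
  have hU := h.R_le_U
  have hkR := h.k_le_R
  have hDR := h.D_le_R
  have hRP := h.R_le_P
  have hP1 := h.one_le_P
  have hN1 : 1 ≤ A.N := h.N_pos
  have hZ1 : 0 < A.Z := h.Z_pos
  have hk := h.pos
  have hkap : A.kap ≤ k := by unfold kap; omega
  have hM := h.M_ge
  have hkB : k ≤ A.B := A.le_pow k_Q (by norm_num)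
  have hNNB : A.N * A.N ≤ A.B := A.le_pow (mul_Q h.N_Q h.N_Q) (by norm_num)
  have hZB : A.Z ≤ A.B := A.le_pow Z_Q (by norm_num)
  have hMB : A.M ≤ A.B := A.le_pow M_Q (by norm_num)
  have hdQ : ∀ i x, dig A.D i x ≤ A.Q ^ 1 := fun i x => (dig_lt h.D_pos i x).le.trans D_Q
  have hS : A.U = 8 * (A.P * A.P * (A.N * A.N * A.N)) := rfl
  have u1 := A.le_unit (a := A.kap) (b := 1) (c := A.N) (d := A.N) (e := 1) (by omega) hP1 le_rfl
    le_rfl hN1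
  have u2 := A.le_unit (a := 1) (b := 1) (c := A.N) (d := A.N) (e := 1) hP1 hP1 le_rfl
    le_rfl hN1
  have u3 := A.le_unit (a := 1) (b := 1) (c := 1) (d := 1) (e := 1) hP1 hP1 hN1 hN1 hN1
  have u4 : A.Z * (A.R * A.P) ≤ A.P * A.P * (A.N * A.N * A.N) := by
    calc A.Z * (A.R * A.P) = A.R * A.Z * A.P := by ring
      _ = A.P * A.P * (A.N * A.N * 1) := by rw [← PNN]; ring
      _ ≤ _ := A.le_unit le_rfl le_rfl le_rfl le_rfl hN1
  have u5 : A.Z * (k * k) ≤ A.Z * (A.R * A.P) := by gcongr; omega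
  have u6 : A.Z * 1 ≤ A.Z * (A.R * A.P) := Nat.mul_le_mul_left _ (by nlinarith)
  have u7 : A.Z * (k * 1) ≤ A.Z * (A.R * A.P) := by gcongr
  have u8 : A.Z * (A.R * 1) ≤ A.Z * (A.R * A.P) := by gcongr
  have u9 : k * k ≤ A.P * A.P * (A.N * A.N * A.N) := by
    simpa using A.le_unit (a := k) (b := k) (c := 1) (d := 1) (e := 1) (by omega) (by omega) hN1 hN1 hN1
  have u10 : A.D * A.D ≤ A.P * A.P * (A.N * A.N * A.N) := by
    simpa using A.le_unit (a := A.D) (b := A.D) (c := 1) (d := 1) (e := 1) (by omega) (by omega) hN1 hN1 hN1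
  obtain ⟨hr0, hr2, hr3, hr4, hr5, hr6, hr7, hr8, hr9, hr15, hr27⟩ := hr
  have hZk : A.Z * (k + 1) + 1 ≤ A.U := by
    have : A.Z * (k + 1) + 1 = A.Z * (k * 1) + A.Z * 1 + 1 := by ring
    omega
  refine Within.seq (within_sumFill hC hs (a := 9) (by decide) (by decide) (by decide)
    (by decide) (by decide) (by decide) (n' := A.Z) (o := 0) (M := k) (τ := 1)
    (m' := fun _ => k) (t := fun i j => if dig A.D j i < A.D / 2 then 0 else 1)
    (g := fun _ acc => if acc = 0 then 1 else 0) (by simp [hr5])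
    (by simp [hr0]) (by simp) (fun i hi j hj acc => ?_) (by simp)
    (by simp) hZB hkB (fun i hi j hj => by split_ifs <;> omega) (by omega)
    (fun i hi acc hacc => by split_ifs <;> omega) hZk)
    fun s7 h7 => ?_
  · simp only [Ex.eval_add, Ex.eval_isZero, Ex.eval_lt, Ex.eval_mod, Ex.eval_div, Ex.eval_get,
      Ex.eval_reg, Ex.eval_lit, State.at_reg, State.at_arr]
    simp [hr2, hc.a5 j hj, div_pow_mod]
    split_ifs <;> omega
  obtain ⟨k7, v7, -⟩ := h7
  refine Within.seq (within_sumFill hC k7.bd (a := 19) (by decide) (by decide) (by decide)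
    (by decide) (by decide) (by decide) (n' := A.Z) (o := 0) (M := k) (τ := 1)
    (m' := fun _ => k) (t := fun i j => if A.H < dig A.D j i then 1 else 0)
    (g := fun _ acc => acc) (by simp [k7.regs, hr5])
    (by simp [k7.regs, hr0]) (by simp) (fun i hi j hj acc => ?_) (by simp)
    (by simp) hZB hkB (fun i hi j hj => by split_ifs <;> omega) (by omega)
    (fun i hi acc hacc => by omega) hZk)
    fun s8 h8 => ?_
  · have : A.D / 4 = A.H := by unfold D; omega
    simp only [Ex.eval_add, Ex.eval_lt, Ex.eval_mod, Ex.eval_div, Ex.eval_get, Ex.eval_reg,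
      Ex.eval_lit, State.at_reg, State.at_arr]
    simp [k7.regs, hr2, k7.arrs, hc.a5 j hj, div_pow_mod, this]
  obtain ⟨k8, v8, -⟩ := h8
  simp only [zero_add] at v7 v8
  have q8 : ∀ y < 100, y < 10 ∨ 15 ≤ y → s8.reg y = s.reg y := fun y hy hy' => by
    rw [k8.regs y hy hy', k7.regs y hy hy']
  have p8 : ∀ i < k, s8.arr 5 i = A.D ^ i := fun i hi => by
    rw [k8.arrs 5 (by norm_num), k7.arrs 5 (by norm_num), hc.a5 i hi]
  have hadj8 : s8.arr 1 = s.arr 1 := by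
    rw [k8.arrs 1 (by norm_num), k7.arrs 1 (by norm_num)]
  have hH : A.D / 4 = A.H := by unfold D; omega
  -- Violations are counted over pairs of types: an entry above `1`, or two distinct adjacent types
  -- with positive entries. Distinctness is the sum of the two strict comparisons, so loops are
  -- disregarded.
  let bad : ℕ → ℕ → ℕ := fun x jj => (if A.H + 1 < dig A.D (jj / k) x then 1 else 0) +
    ((if jj / k < jj % k then 1 else 0) + (if jj % k < jj / k then 1 else 0)) *
    ((if A.H < dig A.D (jj / k) x then 1 else 0) * (if A.H < dig A.D (jj % k) x then 1 else 0) *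
      s.arr 1 jj)
  have hadj' : ∀ jj < k * k, s.arr 1 jj ≤ 1 := fun jj hjj => by
    have h1 : jj / k < k := Nat.div_lt_of_lt_mul hjj
    have h2 : jj % k < k := Nat.mod_lt _ hk
    have := hadj ⟨_, h1⟩ ⟨_, h2⟩
    simp only [mul_comm (jj / k), Nat.div_add_mod] at this
    rw [this]; split_ifs <;> omega
  have hkkB : k * k * 3 ≤ A.B := A.le_pow (mul_Q (mul_Q k_Q k_Q) (lit_Q (by norm_num))) (by norm_num)
  have hbad1 : ∀ x, ∀ jj < k * k, bad x jj ≤ 3 := fun x jj hjj => by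
    have := hadj' jj hjj
    have h01 : ∀ (p : Prop) [Decidable p], (if p then 1 else 0) ≤ 1 := fun p _ => by
      split_ifs <;> omega
    calc bad x jj ≤ 1 + (1 + 1) * (1 * 1 * 1) := by
          simp only [bad]; gcongr <;> exact h01 _
      _ = 3 := rfl
  refine Within.seq (within_sumFill hC k8.bd (a := 21) (by decide) (by decide) (by decide)
    (by decide) (by decide) (by decide) (n' := A.Z) (o := 0) (M := k * k) (τ := 3)
    (m' := fun _ => k * k) (t := bad)
    (g := fun _ acc => acc) (by simp [q8, hr5])
    (by simp [q8, hr0]) (by simp) (fun i hi j hj acc => ?_) (by simp)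
    (by simp) hZB (by omega) (fun i hi j hj => hbad1 i j hj) hkkB
    (fun i hi acc hacc => by omega) ?_)
    fun s9 h9 => ?_
  · have h1 : j / k < k := Nat.div_lt_of_lt_mul hj
    have h2 : j % k < k := Nat.mod_lt _ hk
    simp [bad, q8, hr0, hr2, p8 _ h1, p8 _ h2, div_pow_mod, hH, hadj8]
  · have : A.Z * (k * k + 1) + 1 = A.Z * (k * k) + A.Z * 1 + 1 := by ring
    omega
  obtain ⟨k9, v9, -⟩ := h9
  simp only [zero_add] at v9
  have hRZB : A.R * A.Z ≤ A.B := A.le_pow (mul_Q h.R_Q Z_Q) (by norm_num)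
  have q9 : ∀ y < 100, y < 10 ∨ 15 ≤ y → s9.reg y = s.reg y := fun y hy hy' => by
    rw [k9.regs y hy hy', q8 y hy hy']
  have hbad : ∀ x, ∑ jj ∈ range (k * k), bad x jj = 0 ↔ (∀ i < k, dig A.D i x ≤ A.H + 1) ∧
      ∀ i j : Fin k, i ≠ j → A.H < dig A.D i x → A.H < dig A.D j x → ¬ A.T.Adj i j := fun x => by
    rw [sum_eq_zero_iff]
    constructor
    · intro H
      refine ⟨fun i hi => ?_, fun i j hij hi hj hA => ?_⟩
      · have := H (i * k + 0) (mem_range.2 (index_lt hi hk))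
        simp only [bad, index_div hk, Nat.add_eq_zero_iff] at this
        by_contra hc
        simp only [not_le] at hc
        simp [hc] at this
      · have := H (i * k + j) (mem_range.2 (index_lt i.2 j.2))
        simp only [bad, index_div j.2, index_mod j.2, hadj, if_pos hi, if_pos hj, if_pos hA,
          Nat.add_eq_zero_iff] at this
        have hne : (i : ℕ) ≠ j := fun h => hij (Fin.ext h)
        have := this.2
        simp at this
        omega
    · rintro ⟨H1, H2⟩ jj hjj
      rw [mem_range] at hjj
      have h1 : jj / k < k := Nat.div_lt_of_lt_mul hjj
      have h2 : jj % k < k := Nat.mod_lt _ hk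
      have h3 := hadj ⟨_, h1⟩ ⟨_, h2⟩
      simp only [mul_comm (jj / k), Nat.div_add_mod] at h3
      have h4 := H1 _ h1
      simp only [bad, if_neg (not_lt.2 h4), h3, zero_add]
      by_cases e1 : jj / k = jj % k
      · simp [e1]
      · by_cases e2 : A.H < dig A.D (jj / k) x
        · by_cases e3 : A.H < dig A.D (jj % k) x
          · have := H2 ⟨_, h1⟩ ⟨_, h2⟩ (by simpa using e1) e2 e3
            simp [this]
          · simp [e3]
        · simp [e2]
  have hpos : ∀ x, (∑ i ∈ range k, if A.H < dig A.D i x then 1 else 0) = 0 ↔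
      ∀ i < k, dig A.D i x ≤ A.H := fun x => by
    rw [sum_eq_zero_iff]
    refine forall_congr' fun i => ?_
    rw [mem_range]
    refine imp_congr_right fun _ => ?_
    simp
  have hvalid : ∀ x < A.Z, s7.arr 9 x = if Half A.D k x then 1 else 0 := fun x hx => by
    rw [v7 x hx]
    refine if_congr ?_ rfl rfl
    rw [sum_eq_zero_iff, Half]
    refine forall_congr' fun i => ?_
    rw [mem_range]
    refine imp_congr_right fun _ => ?_
    simp
  refine Within.mono (within_map hC k9.bd (a := 10) (by decide) (by decide) (by decide) (by decide)
    (n' := A.R * A.Z) (o := 0) (g := fun X => if A.Tab 0 X then 1 else 0)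
    (by simp [q9, hr7, hr5]) (by simp)
    (fun i hi => ?_) hRZB
    (fun i hi => by have := A.le_pow (A.lit_Q (x := 1) (by norm_num)) (by norm_num)
                    split_ifs <;> omega) ?_) le_rfl fun s10 h10 => ?_
  · have hx : i % A.Z < A.Z := Nat.mod_lt _ hZ1
    simp only [Ex.eval_mul, Ex.eval_get, Ex.eval_isZero, Ex.eval_cond, Ex.eval_mod, Ex.eval_div,
      Ex.eval_reg, Ex.eval_lit, State.at_reg, State.at_arr]
    simp only [q9, hr5, v9 _ hx, k9.arrs 9 (by norm_num), k8.arrs 9 (by norm_num), hvalid _ hx,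
      k9.arrs 19 (by norm_num), v8 _ hx, Nat.reduceLT, Nat.reduceLeDiff, true_or,
      if_true, Nat.reduceEqDiff, if_false, hbad, hpos]
    exact h.tab_zero_eq i
  · have : A.R * A.Z + 1 = A.Z * (A.R * 1) + 1 := by ring
    omega
  obtain ⟨k10, v10, -⟩ := h10
  simp only [zero_add] at v10
  have q10 : ∀ y < 100, y < 10 ∨ 15 ≤ y → s10.reg y = s.reg y := fun y hy hy' => by
    rw [k10.regs y hy hy', q9 y hy hy']
  refine ⟨⟨?_, hc.congr fun b hb => ?_, fun x hx => ?_, fun x hx => ?_, fun m => ?_, k10.bd⟩, q10,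
    v10⟩
  · exact Regs.congr ⟨hr0, hr2, hr3, hr4, hr5, hr6, hr7, hr8, hr9, hr15, hr27⟩
      fun y hy hy' _ => q10 y hy hy'
  · rw [k10.arrs b (by omega), k9.arrs b (by omega), k8.arrs b (by omega), k7.arrs b (by omega)]
  · rw [k10.arrs 9 (by norm_num), k9.arrs 9 (by norm_num), k8.arrs 9 (by norm_num), hvalid x hx]
  · rw [k10.arrs 19 (by norm_num), k9.arrs 19 (by norm_num), v8 x hx]
  · rw [k10.arrs 16 (by norm_num), k9.arrs 16 (by norm_num), k8.arrs 16 (by norm_num),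
      k7.arrs 16 (by norm_num), h16 m]

end Setup

end NDColoring

namespace NDColoring

/-! ### The sumset of a table with itself -/

namespace Setup

open Finset Program

variable {k : ℕ} {A : Setup k} {s s' : State} {W : ℕ}

lemma div_lt_of_lt_index {a N i : ℕ} (hi : i < a * N) : i / N < a :=
  Nat.div_lt_of_lt_mul (by rwa [mul_comm])

/-- The forward transform takes about `P * N ^ 3` steps, the products and the inverse transform `2 *
P ^ 2 * N ^ 3` each, and the union over tags `2 * P ^ 2 * N ^ 2`; the unit `U` is chosen to cover
each of them. -/
theorem within_transform (h : A.Good) (hbin : A.IsBin) (hC : Cap W A.B 64) (he : A.Env s)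
    (hg : ∀ X < A.P * A.N * A.N, s.arr 10 X ≤ 1)
    (hhalf : ∀ X < A.P * A.N * A.N, s.arr 10 X ≠ 0 → Half A.D A.kap (X % A.N)) :
    Within W A.U transformP s fun s' => A.Env s' ∧
      (∀ y < 100, y < 10 ∨ 15 ≤ y → s'.reg y = s.reg y) ∧
      (∀ b, b < 11 ∨ 14 < b → s'.arr b = s.arr b) ∧
      (∀ tag < A.P, ∀ X < 2 * A.P * A.N * A.N,
        s'.arr 13 (tag * (2 * A.P * A.N * A.N) + X) ≠ 0 ↔
        ∃ z < A.N * A.N, tag * (A.N * A.N) + z ≤ X ∧ X - (tag * (A.N * A.N) + z) < A.P * A.N * A.N ∧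
          s.arr 10 (tag * (A.N * A.N) + z) ≠ 0 ∧ s.arr 10 (X - (tag * (A.N * A.N) + z)) ≠ 0) ∧
      ∀ X < 2 * A.P * A.N * A.N, s'.arr 14 X ≠ 0 ↔ ∃ Y ≤ X, Y < A.P * A.N * A.N ∧
        X - Y < A.P * A.N * A.N ∧ s.arr 10 Y ≠ 0 ∧ s.arr 10 (X - Y) ≠ 0 := by
  have hP1 := h.one_le_P
  have hN1 : 1 ≤ A.N := h.N_pos
  have hM := h.M_ge
  have hU : A.U = 8 * (A.P * A.P * (A.N * A.N * A.N)) := rfl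
  have hNB : A.N ≤ A.B := A.le_pow h.N_Q (by norm_num)
  have hMB : A.M ≤ A.B := A.le_pow M_Q (by norm_num)
  have hPB : A.P ≤ A.B := A.le_pow P_Q (by norm_num)
  have hPNNB : A.P * A.N * A.N ≤ A.B := A.le_pow (mul_Q (mul_Q P_Q h.N_Q) h.N_Q) (by norm_num)
  have h2PNNB : 2 * A.P * A.N * A.N ≤ A.B :=
    A.le_pow (mul_Q (mul_Q (mul_Q (lit_Q (by norm_num)) P_Q) h.N_Q) h.N_Q) (by norm_num)
  have hbigB : A.P * (2 * A.P * A.N) * A.N ≤ A.B :=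
    A.le_pow (mul_Q (mul_Q P_Q (mul_Q (mul_Q (lit_Q (by norm_num)) P_Q) h.N_Q)) h.N_Q)
      (by norm_num)
  have hNMM : A.N * (A.M * A.M) ≤ A.B :=
    A.le_pow (mul_Q h.N_Q (mul_Q M_Q M_Q)) (by norm_num)
  have u1 := A.le_unit (a := A.P) (b := 1) (c := A.N) (d := A.N) (e := A.N) le_rfl hP1 le_rfl
    le_rfl le_rfl
  have u2 := A.le_unit (a := A.P) (b := 1) (c := A.N) (d := A.N) (e := 1) le_rfl hP1 le_rfl
    le_rfl hN1
  have u3 := A.le_unit (a := A.P) (b := A.P) (c := A.N) (d := A.N) (e := 1) le_rfl le_rfl le_rfl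
    le_rfl hN1
  have u4 := A.le_unit (a := 1) (b := 1) (c := 1) (d := 1) (e := 1) hP1 hP1 hN1 hN1 hN1
  obtain ⟨hr0, hr2, hr3, hr4, hr5, hr6, hr7, hr8, hr9, hr15, hr27⟩ := he.regs
  refine Within.seq (within_sumFill hC he.bd (a := 11) (by decide) (by decide) (by decide)
    (by decide) (by decide) (by decide) (n' := A.P * A.N * A.N) (o := 0) (M := A.N) (τ := 1 * A.M)
    (m' := fun _ => A.N)
    (t := fun i j => s.arr 10 (i / A.N * A.N + j) * s.arr 7 (i % A.N * A.N + j))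
    (g := fun _ acc => acc % A.M) (by simp [hr4, hr6]) (by simp [hr4]) (by simp)
    (fun i hi j hj acc => by simp [hr4]) (by simp [hr8]) (by simp) hPNNB hNB
    (fun i hi j hj => Nat.mul_le_mul (hg _ (index_lt (div_lt_of_lt_index hi) hj))
      (he.chars.a7_lt _ (index_lt (Nat.mod_lt _ hN1) hj)).le)
    (A.le_pow (mul_Q h.N_Q (mul_Q (lit_Q (by norm_num)) M_Q)) (by norm_num))
    (fun i hi acc hacc => (Nat.mod_lt _ (by omega)).le.trans hMB) ?_) fun s1 h1 => ?_
  · have : A.P * A.N * A.N * (A.N + 1) + 1 =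
      A.P * 1 * (A.N * A.N * A.N) + A.P * 1 * (A.N * A.N * 1) + 1 := by ring
    omega
  obtain ⟨k1, v1, -⟩ := h1
  simp only [zero_add] at v1
  have hhat : ∀ i < A.P * A.N * A.N, s1.arr 11 i < A.M := fun i hi => by
    rw [v1 i hi]; exact Nat.mod_lt _ (by omega)
  let key : ℕ → ℕ → ℕ := fun i j => i / A.N / (2 * A.P * A.N) * A.N + j
  let kk : ℕ → ℕ := fun i => i / A.N % (2 * A.P * A.N)
  refine Within.seq (within_sumFill hC k1.bd (a := 12) (by decide) (by decide) (by decide)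
    (by decide) (by decide) (by decide) (n' := A.P * (2 * A.P * A.N) * A.N) (o := 0) (M := A.N)
    (τ := A.M * A.M) (m' := fun _ => A.N)
    (t := fun i j => if key i j ≤ kk i ∧ kk i - key i j < A.P * A.N then
      s1.arr 11 (key i j * A.N + i % A.N) * s1.arr 11 ((kk i - key i j) * A.N + i % A.N) else 0)
    (g := fun _ acc => acc % A.M) (by simp [k1.regs, hr4, hr6]) (by simp [k1.regs, hr4]) (by simp)
    (fun i hi j hj acc => ?_) (by simp [k1.regs, hr8]) (by simp) hbigB hNB
    (fun i hi j hj => ?_) hNMM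
    (fun i hi acc hacc => (Nat.mod_lt _ (by omega)).le.trans hMB) ?_) fun s2 h2 => ?_
  · simp only [Ex.eval_add, Ex.eval_mul, Ex.eval_sub, Ex.eval_isZero, Ex.eval_lt, Ex.eval_mod,
      Ex.eval_div, Ex.eval_get, Ex.eval_reg, Ex.eval_lit, State.at_reg, State.at_arr]
    simp only [k1.regs, hr4, hr6, Nat.reduceLT, Nat.reduceLeDiff, true_or, if_true,
      Nat.reduceEqDiff, if_false]
    change acc + (if (if kk i < key i j then 1 else 0) = 0 then 1 else 0) *
      (if kk i - key i j < A.P * A.N then 1 else 0) * _ = _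
    congr 1
    by_cases c1 : key i j ≤ kk i
    · by_cases c2 : kk i - key i j < A.P * A.N
      · rw [if_neg (not_lt.2 c1), if_pos rfl, if_pos c2, if_pos ⟨c1, c2⟩, one_mul, one_mul]
      · rw [if_neg c2, if_neg (fun c3 : key i j ≤ kk i ∧ _ => c2 c3.2), mul_zero, zero_mul]
    · rw [if_pos (not_le.1 c1), if_neg one_ne_zero,
        if_neg (fun c3 : key i j ≤ kk i ∧ _ => c1 c3.1), zero_mul, zero_mul]
  · have hy : i % A.N < A.N := Nat.mod_lt _ hN1
    split_ifs with hc
    · have htag : i / A.N / (2 * A.P * A.N) < A.P := div_lt_of_lt_index (div_lt_of_lt_index hi)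
      exact Nat.mul_le_mul (hhat _ (index_lt (index_lt htag hj) hy)).le
        (hhat _ (index_lt hc.2 hy)).le
    · exact Nat.zero_le _
  · have : A.P * (2 * A.P * A.N) * A.N * (A.N + 1) + 1 =
      2 * (A.P * A.P * (A.N * A.N * A.N)) + 2 * (A.P * A.P * (A.N * A.N * 1)) + 1 := by ring
    omega
  obtain ⟨k2, v2, -⟩ := h2
  simp only [zero_add] at v2
  refine Within.seq (within_sumFill hC k2.bd (a := 13) (by decide) (by decide) (by decide)
    (by decide) (by decide) (by decide) (n' := A.P * (2 * A.P * A.N) * A.N) (o := 0) (M := A.N)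
    (τ := A.M * A.M) (m' := fun _ => A.N)
    (t := fun i j => s2.arr 12 (i / A.N * A.N + j) * s.arr 8 (j * A.N + i % A.N))
    (g := fun _ acc => if acc % A.M = 0 then 0 else 1) (by simp [k2.regs, k1.regs, hr4, hr6])
    (by simp [k2.regs, k1.regs, hr4]) (by simp)
    (fun i hi j hj acc => by simp [k2.regs, k1.regs, hr4, k2.arrs, k1.arrs])
    (fun i hi acc => ?_) (by simp) hbigB hNB
    (fun i hi j hj => ?_) hNMM
    (fun i hi acc hacc => by split_ifs <;> omega) ?_) fun s3 h3 => ?_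
  · simp [k2.regs, k1.regs, hr8]
  · refine Nat.mul_le_mul ?_ (he.chars.a8_lt _ (index_lt hj (Nat.mod_lt _ hN1))).le
    rw [v2 _ (index_lt (div_lt_of_lt_index hi) hj)]
    exact (Nat.mod_lt _ (by omega)).le
  · have : A.P * (2 * A.P * A.N) * A.N * (A.N + 1) + 1 =
      2 * (A.P * A.P * (A.N * A.N * A.N)) + 2 * (A.P * A.P * (A.N * A.N * 1)) + 1 := by ring
    omega
  obtain ⟨k3, v3, -⟩ := h3
  simp only [zero_add] at v3
  have hconv : ∀ tag < A.P, ∀ X < 2 * A.P * A.N * A.N,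
      s3.arr 13 (tag * (2 * A.P * A.N * A.N) + X) ≠ 0 ↔
      ∃ z < A.N * A.N, tag * (A.N * A.N) + z ≤ X ∧ X - (tag * (A.N * A.N) + z) < A.P * A.N * A.N ∧
        s.arr 10 (tag * (A.N * A.N) + z) ≠ 0 ∧ s.arr 10 (X - (tag * (A.N * A.N) + z)) ≠ 0 := by
    intro tag htag X hX
    have hks : X / A.N < 2 * A.P * A.N := div_lt_of_lt_index hX
    have hv : X % A.N < A.N := Nat.mod_lt _ hN1
    have hXe : X / A.N * A.N + X % A.N = X := Nat.div_add_mod' X A.N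
    have hidx : tag * (2 * A.P * A.N * A.N) + X =
        (tag * (2 * A.P * A.N) + X / A.N) * A.N + X % A.N := by
      conv_lhs => rw [← hXe]
      ring
    obtain ⟨d, hd⟩ := hbin
    have hd1 : 1 ≤ d := by
      by_contra hcon
      have hd0 : d = 0 := by omega
      have := h.D_ge
      rw [hd, hd0] at this
      omega
    have hD2 : A.D / 2 = 2 ^ (d - 1) := by
      obtain ⟨e, rfl⟩ := Nat.exists_eq_add_of_le' hd1
      rw [hd, pow_succ]
      simp
    have hmain := conv_ne_zero_iff (P := A.P) (D := A.D) (N := A.N) (M := A.M) (r := A.rr)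
      (τ := A.tau) (n := A.kap) hd1 (by rw [rr, hD2]) h.one_le_rr h.two_kap_le hd rfl rfl
      (g := s.arr 10) (e := s.arr 7) (e' := s.arr 8) (hat := s1.arr 11) (S := s2.arr 12)
      he.chars.a7 he.chars.a8 (fun key hkey y hy => ?_) (fun tag htag ks hks y hy => ?_)
      hg hhalf htag hks hv
    · rw [hidx, v3 _ (index_lt (index_lt htag hks) hv), index_div hv, index_mod hv]
      rw [pairCount_ne_zero_iff_index (N := A.N) (D := A.D) (n := A.kap) rfl htag hv hhalf, hXe] at hmain
      rw [← hmain]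
      simp
    · rw [v1 _ (index_lt hkey hy), index_div hy, index_mod hy]
    · rw [v2 _ (index_lt (index_lt htag hks) hy)]
      simp only [key, index_div hy, index_mod hy, index_div hks,
        index_mod hks, kk]
  refine Within.mono (within_sumFill hC k3.bd (a := 14) (by decide) (by decide) (by decide)
    (by decide) (by decide) (by decide) (n' := 2 * A.P * A.N * A.N) (o := 0) (M := A.P)
    (τ := 1) (m' := fun _ => A.P)
    (t := fun i j => s3.arr 13 (j * (2 * A.P * A.N * A.N) + i))
    (g := fun _ acc => acc) (by simp [k3.regs, k2.regs, k1.regs, hr4, hr6])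
    (by simp [k3.regs, k2.regs, k1.regs, hr6]) (by simp)
    (fun i hi j hj acc => by simp [k3.regs, k2.regs, k1.regs, hr4, hr6])
    (by simp) (by simp) h2PNNB hPB
    (fun i hi j hj => ?_) (by omega)
    (fun i hi acc hacc => by omega) ?_) le_rfl fun s4 h4 => ?_
  · have h1 := index_lt hj hi
    rw [show A.P * (2 * A.P * A.N * A.N) = A.P * (2 * A.P * A.N) * A.N by ring] at h1
    rw [v3 _ h1]
    split_ifs <;> omega
  · have : 2 * A.P * A.N * A.N * (A.P + 1) + 1 =
      2 * (A.P * A.P * (A.N * A.N * 1)) + 2 * (A.P * 1 * (A.N * A.N * 1)) + 1 := by ring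
    omega
  obtain ⟨k4, v4, -⟩ := h4
  simp only [zero_add] at v4
  refine ⟨(((he.keep k1 (by decide)).keep k2 (by decide)).keep k3 (by decide)).keep k4 (by decide),
    fun y hy hy' => by rw [k4.regs y hy hy', k3.regs y hy hy', k2.regs y hy hy', k1.regs y hy hy'],
    fun b hb => by rw [k4.arrs b (by omega), k3.arrs b (by omega), k2.arrs b (by omega),
      k1.arrs b (by omega)], fun tag htag X hX => by rw [k4.arrs 13 (by norm_num), hconv tag htag X hX],
    fun X hX => ?_⟩
  rw [v4 X hX, Ne, sum_eq_zero_iff]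
  push Not
  constructor
  · rintro ⟨tag, htag, hne⟩
    rw [mem_range] at htag
    obtain ⟨z, hz, h1, h2, h3, h4⟩ := (hconv tag htag X hX).1 hne
    exact ⟨_, h1, by rw [mul_assoc]; exact index_lt htag hz, h2, h3, h4⟩
  · rintro ⟨Y, h1, h2, h3, h4, h5⟩
    have hNN : 0 < A.N * A.N := by positivity
    have hY : Y / (A.N * A.N) * (A.N * A.N) + Y % (A.N * A.N) = Y := Nat.div_add_mod' _ _
    have htag : Y / (A.N * A.N) < A.P := div_lt_of_lt_index (by rwa [← mul_assoc])
    exact ⟨_, mem_range.2 htag, (hconv _ htag X hX).2 ⟨_, Nat.mod_lt Y hNN, by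
      rw [hY]; exact ⟨h1, h3, h4, h5⟩⟩⟩

end Setup

end NDColoring

namespace NDColoring

/-! ### The passage through the levels -/

namespace Setup

open Finset Program

variable {k : ℕ} {A : Setup k} {s s' : State} {W l x : ℕ}

lemma sum_range_ite_lt {a n : ℕ} (h : a ≤ n) : (∑ c ∈ range n, if c < a then 1 else 0) = a := by
  rw [← card_filter]
  conv_rhs => rw [← card_range a]
  congr 1
  ext c
  simp only [mem_filter, mem_range]
  omega

/-- The vector of `x` at level `l + 1` splits optimally into those of `w` and of the complement. -/
def Splits (A : Setup k) (l x w : ℕ) : Prop :=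
  w ≤ x + A.del l ∧ (w < A.Z ∧ Half A.D k w ∧ A.f l w ≤ 2 ^ l) ∧
    (x + A.del l - w < A.Z ∧ Half A.D k (x + A.del l - w) ∧ A.f l (x + A.del l - w) ≤ 2 ^ l) ∧
    A.f l w + A.f l (x + A.del l - w) ≤ A.f (l + 1) x

open Classical in
/-- The configurations on reaching level `l`. -/
structure Lev (A : Setup k) (l : ℕ) (s : State) : Prop where
  env : A.Env s
  r16 : s.reg 16 = l
  r18 : s.reg 18 = A.m l
  r21 : s.reg 21 = 2 ^ (A.L - l)
  tab : ∀ X < A.R * A.Z, s.arr 10 X = if A.Tab l X then 1 else 0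
  a17 : ∀ l' < l, s.arr 17 l' = A.del l'
  a15 : ∀ l' < l, ∀ x < A.Z, Half A.D k x → A.f (l' + 1) x ≤ 2 ^ (l' + 1) →
    A.Splits l' x (s.arr 15 (l' * A.Z + x))

lemma Good.m_zero (h : A.Good) : A.m 0 = 0 := cn_eq_zero_iff.2 fun i => by
  have hb : A.b i / 2 ^ (A.L - 0) = 0 := by
    by_contra hcon
    have := h.big (Nat.zero_le _) ⟨i, i.2, hcon⟩
    have := h.k_H_le
    omega
  simp only [vec, hb, dig_zero]
  omega

lemma Good.splits (h : A.Good) (hl : l < A.L) (hxZ : x < A.Z) (hx : Half A.D k x) {X Y : ℕ}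
    (hf : A.f (l + 1) x ≤ 2 ^ (l + 1))
    (hX : X = (A.f (l + 1) x - 2 * A.m l) * A.Z + (x + A.del l)) (hY : Y ≤ X)
    (t : A.Tab l Y) (t' : A.Tab l (X - Y)) : A.Splits l x (Y % A.Z) := by
  obtain ⟨h1, h2⟩ := h.witness hl hxZ hx hf hX hY t t'
  have h3 : x + A.del l - Y % A.Z = (X - Y) % A.Z := by omega
  have hZ := h.Z_pos
  rw [Splits, h3]
  exact ⟨by omega, ⟨Nat.mod_lt _ hZ, t.1, t.2.2⟩, ⟨Nat.mod_lt _ hZ, t'.1, t'.2.2⟩, h2⟩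

lemma Good.level_lt (_ : A.Good) (hl : l ≤ A.L) : l ≤ A.Q ^ 1 :=
  hl.trans (Nat.lt_two_pow_self.le.trans L_Q)

lemma Good.m_Q (h : A.Good) (hl : l ≤ A.L) : A.m l ≤ A.Q ^ 1 :=
  (h.m_le_pow hl).trans ((Nat.pow_le_pow_right (by norm_num) hl).trans L_Q)

open Classical in
lemma Good.sum_ne_zero_iff (h : A.Good) (hl : l < A.L)
    (tab : ∀ X < A.R * A.Z, s.arr 10 X = if A.Tab l X then 1 else 0)
    (a14 : ∀ X < 2 * A.P * A.N * A.N, s.arr 14 X ≠ 0 ↔ ∃ Y ≤ X, Y < A.P * A.N * A.N ∧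
        X - Y < A.P * A.N * A.N ∧ s.arr 10 Y ≠ 0 ∧ s.arr 10 (X - Y) ≠ 0)
    (hxZ : x < A.Z) (hx : Half A.D k x) {c : ℕ} (hc : c < 2 * A.R - 1) :
    s.arr 14 (c * A.Z + (x + A.del l)) ≠ 0 ↔
      A.f (l + 1) x ≤ 2 * A.m l + c ∧ A.f (l + 1) x ≤ 2 ^ (l + 1) := by
  have hPNN := A.PNN
  have h2PNN : 2 * A.P * A.N * A.N = 2 * A.R * A.Z := by rw [mul_assoc 2 A.R, ← hPNN]; ring
  have htab : ∀ X < A.R * A.Z, s.arr 10 X ≠ 0 ↔ A.Tab l X := fun X hX => by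
    rw [tab X hX]; split_ifs with hc <;> simp [hc]
  have hlt : c * A.Z + (x + A.del l) < 2 * A.P * A.N * A.N := by
    rw [h2PNN]
    exact index_lt (by omega) (h.add_del_lt hxZ hx)
  rw [← h.sumset_iff hl hxZ hx hc rfl, a14 _ hlt, hPNN]
  exact exists_congr fun Y => and_congr_right fun _ => and_congr_right fun h1 =>
    and_congr_right fun h2 => and_congr (htab _ h1) (htab _ h2)

/-- The marks are monotone in `c`, so counting the unmarked costs finds the least marked one, which
lies within the range by `Good.f_succ_le`. -/
lemma Good.sum_isZero (h : A.Good) (hl : l < A.L)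
    (hany : ∀ x < A.Z, Half A.D k x → ∀ c < 2 * A.R - 1,
      (s.arr 14 (c * A.Z + (x + A.del l)) ≠ 0 ↔
        A.f (l + 1) x ≤ 2 * A.m l + c ∧ A.f (l + 1) x ≤ 2 ^ (l + 1)))
    (hxZ : x < A.Z) (hx : Half A.D k x) (hf : A.f (l + 1) x ≤ 2 ^ (l + 1)) :
    (∑ c ∈ range (2 * A.R - 1), if s.arr 14 (c * A.Z + (x + A.del l)) = 0 then 1 else 0) =
      A.f (l + 1) x - 2 * A.m l := by
  have h1 := h.f_succ_le hl hx
  rw [← sum_range_ite_lt (show A.f (l + 1) x - 2 * A.m l ≤ 2 * A.R - 1 by omega)]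
  refine sum_congr rfl fun c hc => if_congr ?_ rfl rfl
  have := hany x hxZ hx c (mem_range.1 hc)
  rw [← not_iff_not, ← ne_eq, this]
  omega

open Classical in
theorem within_search (h : A.Good) (hC : Cap W A.B 64) (hl : l < A.L) (he : A.Env s)
    (r16 : s.reg 16 = l) (r19 : s.reg 19 = A.del l)
    (tab : ∀ X < A.R * A.Z, s.arr 10 X = if A.Tab l X then 1 else 0)
    (hany : ∀ x < A.Z, Half A.D k x → ∀ c < 2 * A.R - 1,
      (s.arr 14 (c * A.Z + (x + A.del l)) ≠ 0 ↔
        A.f (l + 1) x ≤ 2 * A.m l + c ∧ A.f (l + 1) x ≤ 2 ^ (l + 1)))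
    (a13 : ∀ tag < A.P, ∀ X < 2 * A.P * A.N * A.N,
        s.arr 13 (tag * (2 * A.P * A.N * A.N) + X) ≠ 0 ↔
        ∃ z < A.N * A.N, tag * (A.N * A.N) + z ≤ X ∧ X - (tag * (A.N * A.N) + z) < A.P * A.N * A.N ∧
          s.arr 10 (tag * (A.N * A.N) + z) ≠ 0 ∧ s.arr 10 (X - (tag * (A.N * A.N) + z)) ≠ 0)
    (a14 : ∀ X < 2 * A.P * A.N * A.N, s.arr 14 X ≠ 0 ↔ ∃ Y ≤ X, Y < A.P * A.N * A.N ∧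
        X - Y < A.P * A.N * A.N ∧ s.arr 10 Y ≠ 0 ∧ s.arr 10 (X - Y) ≠ 0) :
    Within W A.U searchP s (fun s' => A.Env s' ∧
      (∀ y < 100, y < 10 ∨ 15 ≤ y → s'.reg y = if y = 17 then A.m (l + 1) - 2 * A.m l else s.reg y) ∧
      (∀ b, b ≠ 15 → b ≠ 20 → b ≠ 22 → s'.arr b = s.arr b) ∧
      (∀ j < l * A.Z, s'.arr 15 j = s.arr 15 j) ∧
      ∀ x < A.Z, Half A.D k x → A.f (l + 1) x ≤ 2 ^ (l + 1) →
        A.Splits l x (s'.arr 15 (l * A.Z + x))) := by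
  have hP1 := h.one_le_P
  have hN1 : 1 ≤ A.N := h.N_pos
  have hNN : 0 < A.N * A.N := by positivity
  have hZ1 := h.Z_pos
  have hR2 := A.R_pos
  have hPNN := A.PNN
  have h2PNN : 2 * A.P * A.N * A.N = 2 * A.R * A.Z := by rw [mul_assoc 2 A.R, ← hPNN]; ring
  have hU : A.U = 8 * (A.P * A.P * (A.N * A.N * A.N)) := rfl
  have hRU := h.R_le_U
  have hNB : A.N ≤ A.B := A.le_pow h.N_Q (by norm_num)
  have hPB : A.P ≤ A.B := A.le_pow P_Q (by norm_num)
  have hZB : A.Z ≤ A.B := A.le_pow Z_Q (by norm_num)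
  have h1B : 1 ≤ A.B := A.le_pow (A.lit_Q (x := 1) (by norm_num)) (by norm_num)
  have hNNB : A.N * A.N ≤ A.B := A.le_pow (mul_Q h.N_Q h.N_Q) (by norm_num)
  have hRZB : A.R * A.Z ≤ A.B := A.le_pow (mul_Q h.R_Q Z_Q) (by norm_num)
  have h2RB : 2 * A.R - 1 ≤ A.B :=
    (Nat.sub_le _ _).trans (A.le_pow (mul_Q (lit_Q (by norm_num)) h.R_Q) (by norm_num))
  have hdelZ := h.del_lt l
  have hmB : 2 * A.m l + A.m (l + 1) ≤ A.B := A.le_pow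
    (add_Q (p := 1) (q := 0) (mul_Q (lit_Q (by norm_num)) (h.m_Q hl.le)) (h.m_Q hl)) (by norm_num)
  have u2 := A.le_unit (a := A.P) (b := 1) (c := A.N) (d := A.N) (e := 1) le_rfl hP1 le_rfl
    le_rfl hN1
  have u3 := A.le_unit (a := A.P) (b := A.P) (c := A.N) (d := A.N) (e := 1) le_rfl le_rfl le_rfl
    le_rfl hN1
  have u4 := A.le_unit (a := 1) (b := 1) (c := 1) (d := 1) (e := 1) hP1 hP1 hN1 hN1 hN1
  have hZP := h.Z_le
  have u5 : A.Z * A.P ≤ A.P * A.P * (A.N * A.N * 1) :=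
    (Nat.mul_le_mul_right _ hZP).trans (le_of_eq (by ring))
  have u6 : A.Z * (A.N * A.N) ≤ A.P * A.P * (A.N * A.N * A.N) := by
    calc _ ≤ A.P * A.N * A.N * (A.P * A.N) :=
          Nat.mul_le_mul hZP (Nat.mul_le_mul_right _ h.N_le_P)
      _ = _ := by ring
  have htab : ∀ X < A.R * A.Z, s.arr 10 X ≠ 0 ↔ A.Tab l X := fun X hX => by
    rw [tab X hX]; split_ifs with hc <;> simp [hc]
  have hcount := fun x hxZ hx hf => h.sum_isZero (x := x) hl hany hxZ hx hf
  have hm2 := h.two_m_le_m hl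
  have hmR := h.f_succ_le hl (half_zero h)
  have hmp := h.m_le_pow (show l + 1 ≤ A.L from hl)
  change A.m (l + 1) + 2 ≤ _ at hmR
  have hsh : (∑ c ∈ range (2 * A.R - 1), if s.arr 14 (c * A.Z + A.del l) = 0 then 1 else 0) =
      A.m (l + 1) - 2 * A.m l := by
    have := hcount 0 hZ1 (half_zero h) hmp
    rwa [zero_add] at this
  obtain ⟨hr0, hr2, hr3, hr4, hr5, hr6, hr7, hr8, hr9, hr15, hr27⟩ := he.regs
  refine Within.seq (within_sumFold hC he.bd (x := 17) (by norm_num) (by norm_num) (by decide)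
    (by decide) (by decide) (m' := 2 * A.R - 1) (v := A.m (l + 1) - 2 * A.m l)
    (t := fun c => if s.arr 14 (c * A.Z + A.del l) = 0 then 1 else 0)
    (by simp [hr7]) (fun i j hj acc => by simp [hr5, r19]) (fun i => by simp [hsh])
    h2RB (by rw [hsh]; omega) (by omega) (by omega)) fun s1 h1 => ?_
  have e1 := he.keepReg h1 (by norm_num) (by norm_num)
  refine Within.seq (within_sumFill hC h1.bd (a := 20) (by decide) (by decide) (by decide)
    (by decide) (by decide) (by decide) (n' := A.Z) (o := 0) (M := 2 * A.R - 1) (τ := 1)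
    (m' := fun _ => 2 * A.R - 1)
    (t := fun i c => if s.arr 14 (c * A.Z + (i + A.del l)) = 0 then 1 else 0)
    (g := fun i acc => acc * A.Z + (i + A.del l)) (by simp [h1.regs, hr5]) (by simp [h1.regs, hr7])
    (by simp)
    (fun i hi j hj acc => by simp [h1.regs, h1.arrs, hr5, r19]) (by simp [h1.regs, hr5, r19])
    (by simp) hZB h2RB
    (fun i hi j hj => by split_ifs <;> omega) (by omega)
    (fun i hi acc hacc => ?_) ?_) fun s2 h2 => ?_
  · have e2 : acc ≤ A.Q ^ 2 := by
      have := mul_Q (lit_Q (A := A) (x := 2) (by norm_num)) h.R_Q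
      norm_num at this
      omega
    exact A.le_pow (add_Q (p := 2) (q := 1) (mul_Q e2 Z_Q)
      (add_Q (p := 0) (q := 0) (hi.le.trans Z_Q) (hdelZ.le.trans Z_Q))) (by norm_num)
  · have e3 : A.Z * (2 * A.R - 1 + 1) + 1 = 2 * (A.P * 1 * (A.N * A.N * 1)) + 1 := by
      rw [show 2 * A.R - 1 + 1 = 2 * A.R by omega]
      have : A.P * 1 * (A.N * A.N * 1) = A.R * A.Z := by rw [← hPNN]; ring
      rw [this]; ring
    omega
  obtain ⟨k2, v2, -⟩ := h2
  simp only [zero_add] at v2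
  refine Within.seq (within_searchFill hC k2.bd (a := 22) (by decide) (by decide) (by decide)
    (by decide) (by decide) (by decide) (n' := A.Z) (o := 0) (M := A.P) (τ := A.P) (m' := A.P)
    (p := fun i j => s.arr 13 (j * (2 * A.P * A.N * A.N) + s2.arr 20 i) ≠ 0)
    (v := fun _ j => j) (g := fun _ acc => acc) (by simp [k2.regs, h1.regs, hr5])
    (by simp [k2.regs, h1.regs, hr6]) (by simp)
    (fun i hi j hj acc => by simp [k2.regs, h1.regs, k2.arrs, h1.arrs, hr4, hr6])
    (fun i hi j hj acc => by simp) (by simp) le_rfl hZB hPB (fun i hi j hj => hj.le) hPB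
    (fun i hi acc hacc => hacc.trans hPB) ?_) fun s3 h3 => ?_
  · have : A.Z * (A.P + 1) + 1 = A.Z * A.P + A.Z + 1 := by ring
    have : A.P * A.N * A.N = A.P * 1 * (A.N * A.N * 1) := by ring
    omega
  obtain ⟨k3, v3, v3', -⟩ := h3
  have hτB : A.P * (A.N * A.N) + A.N * A.N ≤ A.B := by
    have h1 : A.P * (A.N * A.N) ≤ A.Q ^ 3 := mul_Q P_Q (mul_Q h.N_Q h.N_Q)
    have h2 : A.N * A.N ≤ A.Q ^ 2 := mul_Q h.N_Q h.N_Q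
    exact A.le_pow (add_Q h1 h2) (by norm_num)
  simp only [zero_add] at v3 v3'
  -- The candidates are the codes carrying the tag selected by the preceding fill.
  obtain ⟨Y, hY⟩ : ∃ Y : ℕ → ℕ → ℕ, ∀ i z, Y i z = s3.arr 22 i * (A.N * A.N) + z :=
    ⟨_, fun _ _ => rfl⟩
  have e3 := (e1.keep k2 (by decide)).keep k3 (by decide)
  have q3 : ∀ y < 100, y < 10 ∨ 15 ≤ y → y ≠ 17 → s3.reg y = s.reg y := fun y hy hy' hne => by
    rw [k3.regs y hy hy', k2.regs y hy hy', h1.regs y hy hy', if_neg hne]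
  have p3 : ∀ b, b ≠ 20 → b ≠ 22 → s3.arr b = s.arr b := fun b hb hb' => by
    rw [k3.arrs b hb', k2.arrs b hb, h1.arrs]
  have p320 : s3.arr 20 = s2.arr 20 := k3.arrs 20 (by norm_num)
  refine Within.mono (within_searchFill hC k3.bd (a := 15) (by decide) (by decide) (by decide)
    (by decide) (by decide) (by decide) (n' := A.Z) (o := l * A.Z) (M := A.N * A.N)
    (τ := A.P * (A.N * A.N) + A.N * A.N) (m' := A.N * A.N)
    (p := fun i z => (Y i z ≤ s2.arr 20 i ∧ s2.arr 20 i - Y i z < A.R * A.Z) ∧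
      s.arr 10 (Y i z) ≠ 0 ∧ s.arr 10 (s2.arr 20 i - Y i z) ≠ 0)
    (v := fun i z => Y i z) (g := fun _ acc => acc % A.Z) (by simp [q3, hr5])
    (by simp [q3, hr4]) (by simp [q3, hr5, r16])
    (fun i hi j hj acc => ?_)
    (fun i hi j hj acc => by simp [q3, hr4, hY]) (by simp [q3, hr5]) le_rfl hZB hNNB
    (fun i hi j hj => ?_) hτB
    (fun i hi acc hacc => (Nat.mod_lt _ hZ1).le.trans hZB) ?_) le_rfl fun s4 h4 => ?_
  · simp only [Ex.eval_add, Ex.eval_mul, Ex.eval_sub, Ex.eval_isZero, Ex.eval_lt,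
      Ex.eval_get, Ex.eval_reg, State.at_reg, State.at_arr]
    simp only [q3, p3, p320, hr4, hr5, hr7, Nat.reduceLT, Nat.reduceLeDiff, true_or, if_true,
      Nat.reduceEqDiff, if_false, ne_eq, not_false_eq_true]
    simp only [← hY]
    change (if (if s2.arr 20 i < Y i j then 1 else 0) = 0 then 1 else 0) *
      (if s2.arr 20 i - Y i j < A.R * A.Z then 1 else 0) *
      (s.arr 10 (Y i j) * s.arr 10 (s2.arr 20 i - Y i j)) ≠ 0 ↔ _
    simp only [ne_eq, mul_eq_zero, not_or]
    refine and_congr (and_congr ?_ ?_) Iff.rfl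
    · by_cases hc : s2.arr 20 i < Y i j
      · rw [if_pos hc]; simp [hc]
      · rw [if_neg hc]; simpa using hc
    · simp
  · obtain ⟨acc, hacc, hv⟩ := v3' i hi
    simp only [hY]
    rw [hv]
    exact Nat.add_le_add (Nat.mul_le_mul_right _ hacc) hj.le
  · have : A.Z * (A.N * A.N + 1) + 1 = A.Z * (A.N * A.N) + A.Z + 1 := by ring
    have : A.P * A.N * A.N = A.P * 1 * (A.N * A.N * 1) := by ring
    omega
  obtain ⟨k4, v4, -, v4'⟩ := h4
  have e4 := e3.keep k4 (by decide)
  have hwit : ∀ x < A.Z, Half A.D k x → A.f (l + 1) x ≤ 2 ^ (l + 1) →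
      A.Splits l x (s4.arr 15 (l * A.Z + x)) := by
    intro x hxZ hx hf
    have hc : A.f (l + 1) x - 2 * A.m l < 2 * A.R - 1 := by
      have := h.f_succ_le hl hx; omega
    have hX : s2.arr 20 x = (A.f (l + 1) x - 2 * A.m l) * A.Z + (x + A.del l) := by
      rw [v2 x hxZ, hcount x hxZ hx hf]
    have hXlt : s2.arr 20 x < 2 * A.P * A.N * A.N := by
      rw [hX, h2PNN]
      exact index_lt (by omega) (h.add_del_lt hxZ hx)
    have hne : s.arr 14 (s2.arr 20 x) ≠ 0 := by
      rw [hX, hany x hxZ hx _ hc]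
      exact ⟨by omega, hf⟩
    obtain ⟨Y₀, g1, g2, g3, g4, g5⟩ := (a14 _ hXlt).1 hne
    have hY₀ : Y₀ / (A.N * A.N) * (A.N * A.N) + Y₀ % (A.N * A.N) = Y₀ := Nat.div_add_mod' _ _
    have htag : Y₀ / (A.N * A.N) < A.P := div_lt_of_lt_index (by rwa [← mul_assoc])
    obtain ⟨tag, ht, hp, hv⟩ := v3 x hxZ ⟨_, htag, (a13 _ htag _ hXlt).2 ⟨_, Nat.mod_lt Y₀ hNN, by
      rw [hY₀]; exact ⟨g1, g3, g4, g5⟩⟩⟩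
    obtain ⟨z, hz, f1, f2, f3, f4⟩ := (a13 _ ht _ hXlt).1 hp
    obtain ⟨z', hz', ⟨⟨c1, c2⟩, c3, c4⟩, hv'⟩ := v4 x hxZ ⟨z, hz, by
      simp only [hY, hv, ← hPNN]
      exact ⟨⟨f1, f2⟩, f3, f4⟩⟩
    rw [hv']
    have hYlt : Y x z' < A.R * A.Z := by
      simp only [hY, hv, ← hPNN, mul_assoc A.P]
      exact index_lt ht hz'
    exact h.splits hl hxZ hx hf hX c1 ((htab _ hYlt).1 c3) ((htab _ c2).1 c4)
  refine ⟨e4, fun y hy hy' => ?_, fun b h15 h20 h22 => ?_, fun j hj => ?_, hwit⟩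
  · rw [k4.regs y hy hy', k3.regs y hy hy', k2.regs y hy hy', h1.regs y hy hy']
  · rw [k4.arrs b h15, p3 b h20 h22]
  · rw [v4' _ (Or.inl hj), p3 15 (by norm_num) (by norm_num)]

open Classical in
theorem within_advance (h : A.Good) (hC : Cap W A.B 64) (hl : l < A.L) (he : A.Env s)
    (r16 : s.reg 16 = l) (r17 : s.reg 17 = A.m (l + 1) - 2 * A.m l) (r18 : s.reg 18 = A.m l)
    (r19 : s.reg 19 = A.del l) (r21 : s.reg 21 = 2 ^ (A.L - (l + 1)))
    (a17 : ∀ l' < l + 1, s.arr 17 l' = A.del l')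
    (a15 : ∀ l' < l + 1, ∀ x < A.Z, Half A.D k x → A.f (l' + 1) x ≤ 2 ^ (l' + 1) →
      A.Splits l' x (s.arr 15 (l' * A.Z + x)))
    (hany : ∀ x < A.Z, Half A.D k x → ∀ c < 2 * A.R - 1,
      (s.arr 14 (c * A.Z + (x + A.del l)) ≠ 0 ↔
        A.f (l + 1) x ≤ 2 * A.m l + c ∧ A.f (l + 1) x ≤ 2 ^ (l + 1))) :
    Within W A.U advanceP s (A.Lev (l + 1)) := by
  have hP1 := h.one_le_P
  have hN1 : 1 ≤ A.N := h.N_pos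
  have hNN : 0 < A.N * A.N := by positivity
  have hZ1 := h.Z_pos
  have hR2 := A.R_pos
  have hPNN := A.PNN
  have h2PNN : 2 * A.P * A.N * A.N = 2 * A.R * A.Z := by rw [mul_assoc 2 A.R, ← hPNN]; ring
  have hU : A.U = 8 * (A.P * A.P * (A.N * A.N * A.N)) := rfl
  have hRU := h.R_le_U
  have hNB : A.N ≤ A.B := A.le_pow h.N_Q (by norm_num)
  have hPB : A.P ≤ A.B := A.le_pow P_Q (by norm_num)
  have hZB : A.Z ≤ A.B := A.le_pow Z_Q (by norm_num)
  have h1B : 1 ≤ A.B := A.le_pow (A.lit_Q (x := 1) (by norm_num)) (by norm_num)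
  have hNNB : A.N * A.N ≤ A.B := A.le_pow (mul_Q h.N_Q h.N_Q) (by norm_num)
  have hRZB : A.R * A.Z ≤ A.B := A.le_pow (mul_Q h.R_Q Z_Q) (by norm_num)
  have h2RB : 2 * A.R - 1 ≤ A.B :=
    (Nat.sub_le _ _).trans (A.le_pow (mul_Q (lit_Q (by norm_num)) h.R_Q) (by norm_num))
  have hdelZ := h.del_lt l
  have hmB : 2 * A.m l + A.m (l + 1) ≤ A.B := A.le_pow
    (add_Q (p := 1) (q := 0) (mul_Q (lit_Q (by norm_num)) (h.m_Q hl.le)) (h.m_Q hl)) (by norm_num)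
  have u2 := A.le_unit (a := A.P) (b := 1) (c := A.N) (d := A.N) (e := 1) le_rfl hP1 le_rfl
    le_rfl hN1
  have u3 := A.le_unit (a := A.P) (b := A.P) (c := A.N) (d := A.N) (e := 1) le_rfl le_rfl le_rfl
    le_rfl hN1
  have u4 := A.le_unit (a := 1) (b := 1) (c := 1) (d := 1) (e := 1) hP1 hP1 hN1 hN1 hN1
  have hZP := h.Z_le
  have u5 : A.Z * A.P ≤ A.P * A.P * (A.N * A.N * 1) :=
    (Nat.mul_le_mul_right _ hZP).trans (le_of_eq (by ring))
  have u6 : A.Z * (A.N * A.N) ≤ A.P * A.P * (A.N * A.N * A.N) := by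
    calc _ ≤ A.P * A.N * A.N * (A.P * A.N) :=
          Nat.mul_le_mul hZP (Nat.mul_le_mul_right _ h.N_le_P)
      _ = _ := by ring
  have hm2 := h.two_m_le_m hl
  have hmR := h.f_succ_le hl (half_zero h)
  have hmp := h.m_le_pow (show l + 1 ≤ A.L from hl)
  change A.m (l + 1) + 2 ≤ _ at hmR
  obtain ⟨hr0, hr2, hr3, hr4, hr5, hr6, hr7, hr8, hr9, hr15, hr27⟩ := he.regs
  have a9 := he.a9
  refine Within.seq (within_map hC he.bd (a := 10) (by decide) (by decide) (by decide) (by decide)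
    (n' := A.R * A.Z) (o := 0) (g := fun X => if A.Tab (l + 1) X then 1 else 0)
    (by simp [hr5, hr7]) (by simp) (fun X hX => ?_) hRZB
    (fun X hX => by split_ifs <;> omega) ?_) fun s5 h5 => ?_
  · have hx : X % A.Z < A.Z := Nat.mod_lt _ hZ1
    simp only [Ex.eval_mul, Ex.eval_get, Ex.eval_isZero, Ex.eval_mod, Ex.eval_add,
      Ex.eval_reg, State.at_reg, State.at_arr]
    simp only [hr5, r17, r19,
      if_true, Nat.reduceEqDiff, if_false]
    rw [a9 _ hx]
    by_cases hh : Half A.D k (X % A.Z)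
    -- Adding the shift to the cost part of the index translates costs relative to `m (l + 1)` into
    -- costs relative to `2 * m l`.
    · have hidx : X + (A.m (l + 1) - 2 * A.m l) * A.Z + A.del l =
          (X / A.Z + (A.m (l + 1) - 2 * A.m l)) * A.Z + (X % A.Z + A.del l) := by
        have := Nat.div_add_mod' X A.Z
        rw [add_mul]
        omega
      have hXR : X / A.Z < A.R := div_lt_of_lt_index hX
      have key := hany _ hx hh (X / A.Z + (A.m (l + 1) - 2 * A.m l)) (by omega)
      rw [if_pos hh, one_mul, hidx]
      have : A.Tab (l + 1) X ↔ A.f (l + 1) (X % A.Z) ≤ 2 * A.m l +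
          (X / A.Z + (A.m (l + 1) - 2 * A.m l)) ∧ A.f (l + 1) (X % A.Z) ≤ 2 ^ (l + 1) := by
        rw [Tab]
        constructor
        · rintro ⟨-, t2, t3⟩; exact ⟨by omega, t3⟩
        · rintro ⟨t2, t3⟩; exact ⟨hh, by omega, t3⟩
      rw [if_congr (this.trans key.symm) rfl rfl]
      by_cases hz : s.arr 14 ((X / A.Z + (A.m (l + 1) - 2 * A.m l)) * A.Z + (X % A.Z + A.del l)) = 0
      · simp [hz]
      · simp [hz]
    · rw [if_neg hh, if_neg (fun t : A.Tab (l + 1) X => hh t.1), zero_mul]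
  · have : A.P * A.N * A.N = A.P * 1 * (A.N * A.N * 1) := by ring
    omega
  obtain ⟨k5, v5, -⟩ := h5
  simp only [zero_add] at v5
  have e5 := he.keep k5 (by decide)
  have q5 : ∀ y < 100, y < 10 ∨ 15 ≤ y → s5.reg y = s.reg y := fun y hy hy' => by
    rw [k5.regs y hy hy']
  refine Within.seq (within_set hC k5.bd (x := 18) (v := A.m (l + 1)) (by norm_num) (by decide)
    ?_ (by omega) (by omega)) fun s6 h6 => ?_
  · simp only [Ex.eval_add, Ex.eval_mul, Ex.eval_lit, Ex.eval_reg,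
      k5.regs 17 (by norm_num) (by norm_num), r17, q5 18 (by norm_num) (by norm_num), r18]
    omega
  refine Within.mono (within_set hC h6.bd (x := 16) (v := l + 1) (by norm_num) (by decide)
    (by simp [h6.regs, q5, r16]) (A.le_pow (h.level_lt hl) (by norm_num)) (by omega)) le_rfl fun s7 h7 => ?_
  have q7 : ∀ y < 100, y < 10 ∨ 15 ≤ y → y ≠ 16 → y ≠ 18 → s7.reg y = s.reg y :=
    fun y hy hy' h16 h18 => by
      rw [h7.regs y hy hy', if_neg h16, h6.regs y hy hy', if_neg h18, q5 y hy hy']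
  refine ⟨(e5.keepReg h6 (by norm_num) (by norm_num)).keepReg h7 (by norm_num) (by norm_num),
    by simp [h7.regs], by simp [h7.regs, h6.regs], by simp [q7, r21], fun X hX => ?_,
    fun l' hl' => ?_, fun l' hl' x hxZ hx hf => ?_⟩
  · rw [h7.arrs, h6.arrs, v5 X hX]
  · rw [h7.arrs, h6.arrs, k5.arrs 17 (by norm_num), a17 l' hl']
  · rw [h7.arrs, h6.arrs, k5.arrs 15 (by norm_num)]
    exact a15 l' hl' x hxZ hx hf

open Classical in
theorem within_level (h : A.Good) (hbin : A.IsBin) (hC : Cap W A.B 64) (hl : l < A.L)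
    (hs : A.Lev l s) : Within W A.U levelP s (A.Lev (l + 1)) := by
  obtain ⟨he, r16, r18, r21, tab, a17, a15⟩ := hs
  have hU := h.one_le_U
  have hRU := h.R_le_U
  have hkR := h.k_le_R
  obtain ⟨hr0, hr2, hr3, hr4, hr5, hr6, hr7, hr8, hr9, hr15, hr27⟩ := he.regs
  have hpow : 2 ^ (A.L - l) / 2 = 2 ^ (A.L - (l + 1)) := by
    rw [show A.L - l = A.L - (l + 1) + 1 by omega, pow_succ, Nat.mul_div_cancel _ (by norm_num)]
  refine Within.seq (within_set hC he.bd (x := 21) (v := 2 ^ (A.L - (l + 1))) (by norm_num)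
    (by decide) (by simp [r21, hpow])
    (A.le_pow (L_Q.trans' (Nat.pow_le_pow_right (by norm_num) (Nat.sub_le _ _))) (by norm_num)) hU)
    fun s1 h1 => ?_
  have e1 := he.keepReg h1 (by norm_num) (by norm_num)
  have hH : A.D / 4 = A.H := by unfold D; omega
  have hR2 := A.R_pos
  refine Within.seq (within_sumFold hC h1.bd (x := 19) (by norm_num) (by norm_num) (by decide)
    (by decide) (by decide) (m' := k) (v := A.del l) (t := fun i => A.off l i * A.D ^ i)
    (by simp [h1.regs, hr0]) (fun i j hj acc => ?_) (by simp [del])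
    (A.le_pow k_Q (by norm_num)) (A.le_pow (Z_Q.trans' (h.del_lt l).le) (by norm_num))
    (A.le_pow (Z_Q.trans' (h.del_lt l).le) (by norm_num)) (by omega)) fun s2 h2 => ?_
  · simp [h1.regs, hr2, hH, e1.chars.a4 j hj, e1.chars.a5 j hj, off]
  have e2 := e1.keepReg h2 (by norm_num) (by norm_num)
  refine Within.seq (within_sto hC h2.bd 17 (m := l) (v := A.del l) (by decide) (by decide)
    (by simp [h2.regs, h1.regs, r16]) (by simp [h2.regs])
    (A.le_pow (Z_Q.trans' (h.del_lt l).le) (by norm_num)) hU) fun s3 h3 => ?_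
  obtain ⟨⟨h3r, h3a⟩, h3b⟩ := h3
  have a3 : ∀ b ≠ 17, s3.arr b = s.arr b := fun b hb => by
    ext j
    rw [h3a, if_neg (by tauto), h2.arrs, h1.arrs]
  have e3 : A.Env s3 := e2.congr (e2.regs.congr fun y hy _ _ => h3r y hy)
    (fun b hb => by rw [a3 b (by omega), h2.arrs, h1.arrs]) h3b
  have q3 : ∀ y < 100, y < 10 ∨ 15 ≤ y → y ≠ 19 → y ≠ 21 → s3.reg y = s.reg y :=
    fun y hy hy' h19 h21 => by
      rw [h3r y hy, h2.regs y hy hy', if_neg h19, h1.regs y hy hy', if_neg h21]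
  have t3 : ∀ X < A.P * A.N * A.N, s3.arr 10 X ≠ 0 → A.Tab l X := fun X hX => by
    rw [a3 10 (by norm_num), tab X (by rwa [← PNN])]
    split_ifs with hc <;> simp [hc]
  refine Within.seq (within_transform h hbin hC e3 (fun X hX => ?_) fun X hX hne => ?_)
    fun s4 h4 => ?_
  · rw [a3 10 (by norm_num), tab X (by rwa [← PNN])]
    split_ifs <;> omega
  -- The lowest `kap` digits of the index are among the digits of the vector part.
  · intro i hi
    rw [N, dig_mod hi]
    have h5 := (t3 X hX hne).1 i (hi.trans_le (by unfold kap; omega))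
    rwa [Z, dig_mod (hi.trans_le (by unfold kap; omega))] at h5
  obtain ⟨e4, q4, a4, c13, c14⟩ := h4
  rw [← a4 10 (by norm_num)] at c13 c14
  have f16 : s4.reg 16 = l := by
    rw [q4 _ (by norm_num) (by norm_num), q3 _ (by norm_num) (by norm_num) (by norm_num) (by norm_num), r16]
  have f18 : s4.reg 18 = A.m l := by
    rw [q4 _ (by norm_num) (by norm_num), q3 _ (by norm_num) (by norm_num) (by norm_num) (by norm_num), r18]
  have f19 : s4.reg 19 = A.del l := by
    rw [q4 _ (by norm_num) (by norm_num), h3r _ (by norm_num), h2.regs _ (by norm_num) (by norm_num),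
      if_pos rfl]
  have f21 : s4.reg 21 = 2 ^ (A.L - (l + 1)) := by
    rw [q4 _ (by norm_num) (by norm_num), h3r _ (by norm_num), h2.regs _ (by norm_num) (by norm_num),
      if_neg (by norm_num), h1.regs _ (by norm_num) (by norm_num), if_pos rfl]
  have f10 : ∀ X < A.R * A.Z, s4.arr 10 X = if A.Tab l X then 1 else 0 := fun X hX => by
    rw [a4 10 (by norm_num), a3 10 (by norm_num), tab X hX]
  have hany : ∀ x < A.Z, Half A.D k x → ∀ c < 2 * A.R - 1,
      (s4.arr 14 (c * A.Z + (x + A.del l)) ≠ 0 ↔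
        A.f (l + 1) x ≤ 2 * A.m l + c ∧ A.f (l + 1) x ≤ 2 ^ (l + 1)) :=
    fun x hxZ hx c hc => h.sum_ne_zero_iff hl f10 c14 hxZ hx hc
  refine Within.seq (within_search h hC hl e4 f16 f19 f10 hany c13 c14)
    fun s5 ⟨e5, q5, a5, b5, w5⟩ => ?_
  refine within_advance h hC hl e5 (by simp [q5, f16]) (by simp [q5]) (by simp [q5, f18])
    (by simp [q5, f19]) (by simp [q5, f21]) (fun l' hl' => ?_) (fun l' hl' x hxZ hx hf => ?_) ?_
  · rw [a5 17 (by norm_num) (by norm_num) (by norm_num), a4 17 (by norm_num), h3a]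
    by_cases hc : l' = l
    · rw [if_pos ⟨rfl, hc⟩, hc]
    · rw [if_neg (by tauto), h2.arrs, h1.arrs, a17 l' (by omega)]
  · rcases Nat.lt_succ_iff_lt_or_eq.1 hl' with hlt | rfl
    · rw [b5 _ (index_lt hlt hxZ), a4 15 (by norm_num), a3 15 (by norm_num)]
      exact a15 l' hlt x hxZ hx hf
    · exact w5 x hxZ hx hf
  · rw [a5 14 (by norm_num) (by norm_num) (by norm_num)]
    exact hany

theorem within_levels (h : A.Good) (hbin : A.IsBin) (hC : Cap W A.B 64) (hs : A.Lev 0 s) :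
    Within W (A.U * (A.L + 1)) (.loop 16 15 levelP) s (A.Lev A.L) :=
  Within.loop A.Lev A.L h.one_le_U
    (fun l hl s hs => ⟨by rw [hs.r16, hs.env.regs.r15]; exact hl, within_level h hbin hC hl hs⟩)
    (fun s hs => by rw [hs.r16, hs.env.regs.r15]; exact lt_irrefl _) hs

end Setup

end NDColoring

namespace NDColoring

/-! ### The passage back through the levels -/

open Finset in
-- Exchange of summation; the targets need to be in range only for elements of nonzero multiplicity.
lemma sum_scatter {R : Type*} [CommSemiring R] {Z : ℕ} {μ ν w w' : ℕ → ℕ}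
    (hν : ∀ y < Z, ν y = ∑ x ∈ range Z, ((if y = w x then μ x else 0) + if y = w' x then μ x else 0))
    (hw : ∀ x < Z, μ x ≠ 0 → w x < Z ∧ w' x < Z) (g : ℕ → R) :
    ∑ y ∈ range Z, (ν y : R) * g y = ∑ x ∈ range Z, (μ x : R) * (g (w x) + g (w' x)) := by
  have h1 : ∀ y ∈ range Z, (ν y : R) * g y = ∑ x ∈ range Z,
      ((if y = w x then (μ x : R) * g y else 0) + if y = w' x then (μ x : R) * g y else 0) := by
    intro y hy
    rw [hν y (mem_range.1 hy), Nat.cast_sum, sum_mul]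
    refine sum_congr rfl fun x _ => ?_
    split_ifs <;> push_cast <;> ring
  rw [sum_congr rfl h1, sum_comm]
  refine sum_congr rfl fun x hx => ?_
  by_cases h0 : μ x = 0
  · simp [h0]
  · obtain ⟨h2, h3⟩ := hw x (mem_range.1 hx) h0
    rw [sum_add_distrib, sum_ite_eq', sum_ite_eq', if_pos (mem_range.2 h2),
      if_pos (mem_range.2 h3), mul_add]

namespace Setup

open Finset Program

variable {k : ℕ} {A : Setup k} {s s' : State} {W l x : ℕ} {μ ν : ℕ → ℕ}

/-- The multiplicities `μ` of vectors at level `l` describe a decomposition of the demand. -/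
structure Mult (A : Setup k) (l : ℕ) (μ : ℕ → ℕ) : Prop where
  ok : ∀ x < A.Z, μ x ≠ 0 → Half A.D k x ∧ A.f l x ≤ 2 ^ l
  tot : ∑ x ∈ range A.Z, μ x = 2 ^ (A.L - l)
  cost : ∑ x ∈ range A.Z, μ x * A.f l x ≤ A.f A.L A.Mid
  vec : ∀ i, ∑ x ∈ range A.Z, (μ x : ℤ) * A.vec l x i = A.b i

lemma Mult.congr (hμ : A.Mult l μ) (h : ∀ x < A.Z, ν x = μ x) : A.Mult l ν := by
  obtain ⟨h1, h2, h3, h4⟩ := hμ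
  refine ⟨fun x hx => by rw [h x hx]; exact h1 x hx, ?_, ?_, fun i => ?_⟩
  · rw [← h2]; exact sum_congr rfl fun x hx => h x (mem_range.1 hx)
  · refine le_trans (le_of_eq ?_) h3
    exact sum_congr rfl fun x hx => by rw [h x (mem_range.1 hx)]
  · rw [← h4]
    exact sum_congr rfl fun x hx => by rw [h x (mem_range.1 hx)]

lemma Good.mult_top (h : A.Good) : A.Mult A.L fun x => if x = A.Mid then 1 else 0 := by
  have hM := mem_range.2 h.Mid_lt
  refine ⟨fun x _ hne => ?_, ?_, ?_, fun i => ?_⟩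
  · obtain rfl : x = A.Mid := by by_contra hc; simp [hc] at hne
    exact ⟨h.Mid_half, h.Mid_le_pow⟩
  · rw [sum_ite_eq', if_pos hM, Nat.sub_self, pow_zero]
  · simp only [ite_mul, one_mul, zero_mul]
    rw [sum_ite_eq', if_pos hM]
  · simp only [Nat.cast_ite, Nat.cast_one, Nat.cast_zero, ite_mul, one_mul, zero_mul]
    rw [sum_ite_eq', if_pos hM, h.vec_Mid]

/-- Each copy of a vector is replaced by the two parts of its splitting: the number of copies
doubles, the cost does not grow, and `Good.add_eq_iff` preserves the weighted sum. -/
lemma Good.mult_step (h : A.Good) (hl : l < A.L) (hμ : A.Mult (l + 1) μ) {w : ℕ → ℕ}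
    (hw : ∀ x < A.Z, μ x ≠ 0 → A.Splits l x (w x))
    (hν : ∀ y < A.Z, ν y = ∑ x ∈ range A.Z, ((if y = w x then μ x else 0) +
      if y = x + A.del l - w x then μ x else 0)) : A.Mult l ν := by
  have hwZ : ∀ x < A.Z, μ x ≠ 0 → w x < A.Z ∧ x + A.del l - w x < A.Z := fun x hx hne =>
    ⟨(hw x hx hne).2.1.1, (hw x hx hne).2.2.1.1⟩
  refine ⟨fun y hy hne => ?_, ?_, ?_, fun i => ?_⟩
  · rw [hν y hy] at hne
    obtain ⟨x, hx, hne⟩ := exists_ne_zero_of_sum_ne_zero hne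
    have hx := mem_range.1 hx
    by_cases h1 : y = w x
    · have h0 : μ x ≠ 0 := fun h0 => by simp [h0] at hne
      subst h1
      exact (hw x hx h0).2.1.2
    · by_cases h2 : y = x + A.del l - w x
      · have h0 : μ x ≠ 0 := fun h0 => by simp [h0] at hne
        subst h2
        exact (hw x hx h0).2.2.1.2
      · simp [h1, h2] at hne
  · have h1 := sum_scatter hν hwZ (fun _ => 1)
    simp only [mul_one, Nat.cast_id] at h1
    rw [h1, ← sum_mul, hμ.tot, show A.L - l = A.L - (l + 1) + 1 by omega, pow_succ]
  · have h1 := sum_scatter hν hwZ (A.f l)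
    simp only [Nat.cast_id] at h1
    rw [h1]
    refine (sum_le_sum fun x hx => ?_).trans hμ.cost
    rcases Nat.eq_zero_or_pos (μ x) with h0 | h0
    · simp [h0]
    · exact Nat.mul_le_mul_left _ (hw x (mem_range.1 hx) h0.ne').2.2.2
  · rw [sum_scatter hν hwZ (fun y => A.vec l y i), ← hμ.vec i]
    refine sum_congr rfl fun x hx => ?_
    have hx := mem_range.1 hx
    by_cases h0 : μ x = 0
    · simp [h0]
    · obtain ⟨h1, ⟨h2, h3, -⟩, ⟨h4, h5, -⟩, -⟩ := hw x hx h0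
      have := (h.add_eq_iff hl hx (hμ.ok x hx h0).1 h2 h3 h4 h5).1 (by omega)
      rw [← this]
      rfl

/-- The tables needed on the way back. -/
structure Back (A : Setup k) (s : State) : Prop where
  regs : A.Regs s
  a5 : ∀ i < k, s.arr 5 i = A.D ^ i
  a19 : ∀ x < A.Z, s.arr 19 x = ∑ i ∈ range k, if A.H < dig A.D i x then 1 else 0
  a17 : ∀ l < A.L, s.arr 17 l = A.del l
  a15 : ∀ l < A.L, ∀ x < A.Z, Half A.D k x → A.f (l + 1) x ≤ 2 ^ (l + 1) →
    A.Splits l x (s.arr 15 (l * A.Z + x))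
  r1 : s.reg 1 = A.f A.L A.Mid
  bd : s.Bd A.B

lemma Back.congr (h : A.Back s) (hr : ∀ y < 100, y < 10 ∨ 15 ≤ y → y < 16 ∨ y = 27 → s'.reg y = s.reg y)
    (ha : ∀ b, b = 5 ∨ b = 15 ∨ b = 17 ∨ b = 19 → s'.arr b = s.arr b)
    (hb : s'.Bd A.B) : A.Back s' := by
  obtain ⟨hR, h5, h19, h17, h15, h1, -⟩ := h
  refine ⟨hR.congr hr, ?_, ?_, ?_, ?_, ?_, hb⟩
  · rwa [ha 5 (by norm_num)]
  · rwa [ha 19 (by norm_num)]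
  · rwa [ha 17 (by norm_num)]
  · rwa [ha 15 (by norm_num)]
  · rw [hr 1 (by norm_num) (by norm_num) (by norm_num), h1]

lemma Back.keepReg {x v : ℕ} (h : A.Back s) (hs : s.KeepReg A.B x v s') (hx : 16 ≤ x)
    (hx' : x ≠ 27) : A.Back s' :=
  h.congr (fun y hy hy' hy'' => by rw [hs.regs y hy hy', if_neg (by omega)])
    (fun b _ => by rw [hs.arrs]) hs.bd

/-- The configurations on the way back at level `l`. -/
structure Down (A : Setup k) (l : ℕ) (s : State) : Prop where
  back : A.Back s
  r16 : s.reg 16 = l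
  low : ∀ c < l * A.Z, s.arr 16 c = 0
  mult : A.Mult l fun x => s.arr 16 (l * A.Z + x)

/-- The configurations while row `l` is computed from the multiplicities `μ`, when `j` of these have
been dealt with. -/
structure Scat (A : Setup k) (l : ℕ) (μ w : ℕ → ℕ) (j : ℕ) (s : State) : Prop where
  back : A.Back s
  r16 : s.reg 16 = l
  r28 : s.reg 28 = j
  a15 : ∀ x < A.Z, s.arr 15 (l * A.Z + x) = w x
  low : ∀ c < l * A.Z, s.arr 16 c = 0
  high : ∀ x < A.Z, s.arr 16 ((l + 1) * A.Z + x) = μ x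
  row : ∀ y < A.Z, s.arr 16 (l * A.Z + y) = ∑ x ∈ range j, ((if y = w x then μ x else 0) +
      if y = x + A.del l - w x then μ x else 0)

theorem within_scatter (hC : Cap W A.B 64) (hl : l < A.L) {w : ℕ → ℕ}
    (hμ : A.Mult (l + 1) μ) (hw : ∀ x < A.Z, μ x ≠ 0 → A.Splits l x (w x)) {j : ℕ} (hj : j < A.Z)
    (hs : A.Scat l μ w j s) : Within W 1 scatterP s (A.Scat l μ w (j + 1)) := by
  obtain ⟨hb, r16, r28, a15, low, high, row⟩ := hs
  have r5 := hb.regs.r5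
  -- Every copy enters the row twice, so no partial sum exceeds twice the number of copies, which is
  -- at most `2 ^ L`.
  have hbound : ∀ y, ∑ x ∈ range (j + 1), ((if y = w x then μ x else 0) +
      if y = x + A.del l - w x then μ x else 0) ≤ A.B := fun y => by
    refine le_trans ?_ (A.le_pow (p := 1) L_Q (by norm_num))
    calc _ ≤ ∑ x ∈ range (j + 1), (μ x + μ x) :=
          sum_le_sum fun x _ => add_le_add (by split_ifs <;> omega) (by split_ifs <;> omega)
      _ ≤ ∑ x ∈ range A.Z, (μ x + μ x) :=
          sum_le_sum_of_subset (range_subset_range.2 hj)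
      _ = 2 ^ (A.L - (l + 1) + 1) := by rw [sum_add_distrib, hμ.tot, pow_succ]; ring
      _ ≤ 2 ^ A.L := Nat.pow_le_pow_right (by norm_num) (by omega)
  have hμB : μ j ≤ A.B := by rw [← high j hj]; exact hb.bd.2 _ _
  have hrow : ∀ y < A.Z, s.arr 16 (l * A.Z + y) + ((if y = w j then μ j else 0) +
      if y = j + A.del l - w j then μ j else 0) ≤ A.B := fun y hy => by
    rw [row y hy, ← sum_range_succ]
    exact hbound y
  refine Within.seq (within_set hC hb.bd (x := 29) (v := μ j) (by norm_num) (by decide)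
    (by simp [r16, r28, r5, high j hj]) hμB le_rfl) fun s1 h1 => ?_
  refine Within.seq (within_set hC h1.bd (x := 30) (v := w j) (by norm_num) (by decide)
    (by simp [h1.regs, h1.arrs, r16, r28, r5, a15 j hj]) (by rw [← a15 j hj]; exact hb.bd.2 _ _) le_rfl)
    fun s2 h2 => ?_
  refine Within.seq (within_sto hC h2.bd 16 (m := l * A.Z + w j)
    (v := s.arr 16 (l * A.Z + w j) + μ j) (by decide) (by decide)
    (by simp [h1.regs, h2.regs, r16, r5]) (by simp [h1.regs, h2.regs, h1.arrs, h2.arrs, r16, r5])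
    ?_ le_rfl) fun s3 h3 => ?_
  -- For `μ j = 0` nothing is known about the witness, but the cell keeps its value.
  · rcases Nat.eq_zero_or_pos (μ j) with h0 | h0
    · rw [h0]; exact hb.bd.2 _ _
    · have := hrow (w j) (hw j hj h0.ne').2.1.1
      rw [if_pos rfl] at this
      omega
  obtain ⟨⟨r3, a3⟩, b3⟩ := h3
  have v3 : ∀ c, s3.arr 16 c = s.arr 16 c + if c = l * A.Z + w j then μ j else 0 := fun c => by
    rw [a3]
    by_cases hc : c = l * A.Z + w j
    · rw [if_pos ⟨rfl, hc⟩, if_pos hc, hc]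
    · rw [if_neg (by tauto), if_neg hc, h2.arrs, h1.arrs]; rfl
  have p3 : ∀ b ≠ 16, s3.arr b = s.arr b := fun b hb => by
    ext c
    rw [a3, if_neg (by tauto), h2.arrs, h1.arrs]
  refine Within.seq (within_sto hC b3 16 (m := l * A.Z + (j + A.del l - w j))
    (v := s3.arr 16 (l * A.Z + (j + A.del l - w j)) + μ j) (by decide) (by decide)
    (by simp [r3, h1.regs, h2.regs, p3, r16, r28, r5, hb.a17 l hl])
    (by simp [r3, h1.regs, h2.regs, p3, r16, r28, r5, hb.a17 l hl])
    ?_ le_rfl) fun s4 h4 => ?_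
  · rcases Nat.eq_zero_or_pos (μ j) with h0 | h0
    · rw [h0]; exact b3.2 _ _
    · have := hrow (j + A.del l - w j) (hw j hj h0.ne').2.2.1.1
      rw [if_pos rfl] at this
      rw [v3]
      simp only [add_right_inj]
      omega
  obtain ⟨⟨r4, a4⟩, b4⟩ := h4
  have v4 : ∀ c, s4.arr 16 c = s.arr 16 c + ((if c = l * A.Z + w j then μ j else 0) +
      if c = l * A.Z + (j + A.del l - w j) then μ j else 0) := fun c => by
    rw [a4]
    by_cases hc : c = l * A.Z + (j + A.del l - w j)
    · rw [if_pos ⟨rfl, hc⟩, if_pos hc, ← hc, v3, add_assoc]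
    · rw [if_neg (by tauto), if_neg hc, v3]; rfl
  have p4 : ∀ b ≠ 16, s4.arr b = s.arr b := fun b hb => by
    ext c
    rw [a4, if_neg (by tauto), p3 b hb]
  have q4 : ∀ y < 100, y < 10 ∨ 15 ≤ y → y ≠ 29 → y ≠ 30 → s4.reg y = s.reg y :=
    fun y hy hy' h29 h30 => by
      rw [r4 y hy, r3 y hy, h2.regs y hy hy', if_neg h30, h1.regs y hy hy', if_neg h29]
  have e4 : A.Back s4 := hb.congr (fun y hy hy' _ => q4 y hy hy' (by omega) (by omega))
    (fun b hb => p4 b (by omega)) b4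
  refine Within.mono (within_set hC b4 (x := 28) (v := j + 1) (by norm_num) (by decide)
    (by simp [q4, r28]) (hj.trans_le (A.le_pow Z_Q (by norm_num))) le_rfl) le_rfl fun s5 h5 => ?_
  refine ⟨e4.keepReg h5 (by norm_num) (by norm_num), by simp [h5.regs, q4, r16],
    by simp [h5.regs], fun x hx => ?_, fun c hc => ?_, fun x hx => ?_, fun y hy => ?_⟩
  · rw [h5.arrs, p4 15 (by norm_num), a15 x hx]
  · rw [h5.arrs, v4, low c hc, if_neg (by omega), if_neg (by omega)]
  · rw [h5.arrs, v4, high x hx]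
    rcases Nat.eq_zero_or_pos (μ j) with h0 | h0
    · simp [h0]
    · obtain ⟨-, ⟨h6, -⟩, ⟨h7, -⟩, -⟩ := hw j hj h0.ne'
      have : (l + 1) * A.Z = l * A.Z + A.Z := by ring
      rw [if_neg (by omega), if_neg (by omega), add_zero, add_zero]
  · rw [h5.arrs, v4, row y hy, sum_range_succ]
    simp only [add_right_inj]

theorem within_back (h : A.Good) (hC : Cap W A.B 64) (hl : l < A.L) (hs : A.Down (l + 1) s) :
    Within W A.U backP s (A.Down l) := by
  obtain ⟨hb, r16, low, hμ⟩ := hs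
  have hU := h.one_le_U
  have hZU : A.Z + 1 ≤ A.U := by
    have hP1 := h.one_le_P
    have hN1 : 1 ≤ A.N := h.N_pos
    have u2 := A.le_unit (a := A.P) (b := 1) (c := A.N) (d := A.N) (e := 1) le_rfl hP1 le_rfl
      le_rfl hN1
    have : A.P * A.N * A.N = A.P * 1 * (A.N * A.N * 1) := by ring
    have := h.Z_le
    have := h.Z_pos
    unfold U
    omega
  refine Within.seq (within_set hC hb.bd (x := 16) (v := l) (by norm_num) (by decide)
    (by simp [r16]) ((h.level_lt hl.le).trans (A.le_pow le_rfl (by norm_num))) hU) fun s1 h1 => ?_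
  have e1 := hb.keepReg h1 (by norm_num) (by norm_num)
  refine Within.seq (within_set hC h1.bd (x := 28) (v := 0) (by norm_num) (by decide)
    (by simp) (Nat.zero_le _) hU) fun s2 h2 => ?_
  have e2 := e1.keepReg h2 (by norm_num) (by norm_num)
  have hw : ∀ x < A.Z, s.arr 16 ((l + 1) * A.Z + x) ≠ 0 →
      A.Splits l x (s.arr 15 (l * A.Z + x)) := fun x hx hne =>
    hb.a15 l hl x hx (hμ.ok x hx hne).1 (hμ.ok x hx hne).2
  have hlZ : (l + 1) * A.Z = l * A.Z + A.Z := by ring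
  refine Within.mono (Within.loop (A.Scat l (fun x => s.arr 16 ((l + 1) * A.Z + x))
    (fun x => s.arr 15 (l * A.Z + x))) A.Z le_rfl
    (fun j hj s' hs' => ⟨by rw [hs'.r28, hs'.back.regs.r5]; exact hj, within_scatter hC hl hμ hw hj hs'⟩)
    (fun s' hs' => by rw [hs'.r28, hs'.back.regs.r5]; exact lt_irrefl _)
    ⟨e2, by simp [h2.regs, h1.regs], by simp [h2.regs], fun x _ => by rw [h2.arrs, h1.arrs],
      fun c hc => by rw [h2.arrs, h1.arrs]; exact low c (by omega),
      fun x _ => by rw [h2.arrs, h1.arrs],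
      fun y hy => by rw [h2.arrs, h1.arrs, range_zero, sum_empty]; exact low _ (by omega)⟩)
    (by omega) fun s3 h3 => ?_
  exact ⟨h3.back, h3.r16, h3.low, h.mult_step hl hμ hw h3.row⟩

/-- Register `27` is never written, so comparing it with the level tests whether the level is
positive. -/
theorem within_backs (h : A.Good) (hC : Cap W A.B 64) (hs : A.Down A.L s) :
    Within W (A.U * (A.L + 1)) (.loop 27 16 backP) s (A.Down 0) := by
  have := Within.loop (W := W) (U := A.U) (p := backP) (s := s) (y := 27) (z := 16)
    (fun j => A.Down (A.L - j)) A.L h.one_le_U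
    (fun j hj s hs => ⟨by rw [hs.r16, hs.back.regs.r27]; omega, by
      rw [show A.L - j = A.L - (j + 1) + 1 by omega] at hs
      exact within_back h hC (by omega) hs⟩)
    (fun s hs => by rw [hs.r16, hs.back.regs.r27]; omega) hs
  simpa using this

/-- The result of the program. -/
structure Result (A : Setup k) (μ : ℕ → ℕ) (s : State) : Prop where
  r0 : s.reg 0 = A.Z
  r1 : s.reg 1 = A.f A.L A.Mid
  a2 : ∀ x < A.Z, s.arr 2 x = if ∃ i < k, A.H < dig A.D i x then μ x else 0
  a3 : ∀ x < A.Z, ∀ i < k, s.arr 3 (x * k + i) ≠ 0 ↔ A.H < dig A.D i x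

theorem within_result (h : A.Good) (hC : Cap W A.B 64) (hs : A.Down 0 s) :
    Within W A.U (.seq sizesP <| .seq classesP <| setP 0 .rZ) s fun s' =>
      ∃ μ, A.Mult 0 μ ∧ A.Result μ s' := by
  obtain ⟨hb, r16, low, hμ⟩ := hs
  simp only [zero_mul, zero_add] at hμ
  have hk := h.pos
  have hZ1 : 0 < A.Z := h.Z_pos
  have hP1 := h.one_le_P
  have hN1 : 1 ≤ A.N := h.N_pos
  have hRP := h.R_le_P
  have hkR := h.k_le_R
  have hZB : A.Z ≤ A.B := A.le_pow Z_Q (by norm_num)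
  have hS : A.U = 8 * (A.P * A.P * (A.N * A.N * A.N)) := rfl
  have hU := h.one_le_U
  have u4 : A.Z * k ≤ A.P * A.P * (A.N * A.N * A.N) := by
    calc A.Z * k ≤ A.P * A.N * A.N * A.P := Nat.mul_le_mul h.Z_le (hkR.trans hRP)
      _ = A.P * A.P * (A.N * A.N * 1) := by ring
      _ ≤ _ := A.le_unit le_rfl le_rfl le_rfl le_rfl hN1
  have u5 : A.Z ≤ A.Z * k := Nat.le_mul_of_pos_right _ hk
  have hH : A.D / 4 = A.H := by unfold D; omega
  obtain ⟨hr0, hr2, hr3, hr4, hr5, hr6, hr7, hr8, hr9, hr15, hr27⟩ := hb.regs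
  refine Within.seq (within_map hC hb.bd (a := 2) (by decide) (by decide) (by decide) (by decide)
    (n' := A.Z) (o := 0) (g := fun x => if ∃ i < k, A.H < dig A.D i x then s.arr 16 x else 0)
    (by simp [hr5]) (by simp) (fun x hx => ?_) hZB
    (fun x hx => by split_ifs; exacts [hb.bd.2 _ _, Nat.zero_le _]) (by omega)) fun s1 h1 => ?_
  · have h1 : s.arr 19 x ≠ 0 ↔ ∃ i < k, A.H < dig A.D i x := by
      rw [hb.a19 x hx, Ne, sum_eq_zero_iff]
      push Not
      refine exists_congr fun i => ?_
      simp
    by_cases h2 : ∃ i < k, A.H < dig A.D i x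
    · simp [if_pos h2, h1.2 h2]
    · have h3 : s.arr 19 x = 0 := by by_contra hc; exact h2 (h1.1 hc)
      simp only [if_neg h2]
      simp [h3]
  obtain ⟨k1, v1, -⟩ := h1
  refine Within.seq (within_map hC k1.bd (a := 3) (by decide) (by decide) (by decide) (by decide)
    (n' := A.Z * k) (o := 0) (g := fun m => if A.H < dig A.D (m % k) (m / k) then 1 else 0)
    (by simp [k1.regs, hr5, hr0]) (by simp) (fun m hm => ?_)
    (A.le_pow (mul_Q Z_Q k_Q) (by norm_num))
    (fun x hx => by
      have : 1 ≤ A.B := A.le_pow (A.lit_Q (x := 1) (by norm_num)) (by norm_num)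
      split_ifs <;> omega) (by omega)) fun s2 h2 => ?_
  · have := hb.a5 (m % k) (Nat.mod_lt _ hk)
    simp only [dig]
    simp [k1.regs, k1.arrs, hr0, hr2, hH, this]
    exact if_congr Iff.rfl rfl rfl
  obtain ⟨k2, v2, -⟩ := h2
  refine Within.mono (within_set hC k2.bd (x := 0) (v := A.Z) (by norm_num) (by decide)
    (by simp [k2.regs, k1.regs, hr5]) hZB hU) le_rfl fun s3 h3 => ?_
  simp only [zero_add] at v1 v2
  refine ⟨_, hμ, by simp [h3.regs], by simp [h3.regs, k2.regs, k1.regs, hb.r1], fun x hx => ?_,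
    fun x hx i hi => ?_⟩
  · rw [h3.arrs, k2.arrs 2 (by norm_num), v1 x hx]
  · rw [h3.arrs, v2 _ (index_lt hx hi), index_div hi, index_mod hi]
    split_ifs with hc <;> simp [hc]

theorem within_output (h : A.Good) (hC : Cap W A.B 64) (hs : A.Lev A.L s) :
    Within W (A.U * (A.L + 1)) outputP s fun s' => ∃ μ, A.Mult 0 μ ∧ A.Result μ s' := by
  obtain ⟨he, r16, r18, r21, tab, a17, a15⟩ := hs
  have hU := h.one_le_U
  have hRU := h.R_le_U
  have hkR := h.k_le_R
  have hR2 := A.R_pos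
  have hUL : A.U ≤ A.U * (A.L + 1) := Nat.le_mul_of_pos_right _ (by omega)
  have h1B : 1 ≤ A.B := A.le_pow (A.lit_Q (x := 1) (by norm_num)) (by norm_num)
  have hH : A.D / 4 = A.H := by unfold D; omega
  have hMid : ∑ i ∈ range k, A.H * A.D ^ i = A.Mid := rfl
  have hMB : A.Mid ≤ A.B := h.Mid_lt.le.trans (A.le_pow Z_Q (by norm_num))
  obtain ⟨hr0, hr2, hr3, hr4, hr5, hr6, hr7, hr8, hr9, hr15, hr27⟩ := he.regs
  refine Within.seq ((within_sumFold hC he.bd (x := 22) (by norm_num) (by norm_num) (by decide)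
    (by decide) (by decide) (m' := k) (v := A.Mid) (t := fun i => A.H * A.D ^ i)
    (by simp [hr0]) (fun i j hj acc => ?_) (by simp [hMid]) (A.le_pow k_Q (by norm_num))
    hMB hMB (by omega)).mono hUL fun _ h => h) fun s1 h1 => ?_
  · simp [hr2, hH, he.chars.a5 j hj]
  have e1 := he.keepReg h1 (by norm_num) (by norm_num)
  have hf1 := h.m_le_f A.L A.Mid
  have hf2 := h.f_le A.L h.Mid_half
  have hf3 := h.Mid_le_pow
  have hf4 := h.k_H_le
  -- Again the unmarked costs are counted, now for the demand vector itself at the last level.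
  have hval : (∑ c ∈ range A.R, if s.arr 10 (c * A.Z + A.Mid) = 0 then 1 else 0) =
      A.f A.L A.Mid - A.m A.L := by
    rw [← sum_range_ite_lt (show A.f A.L A.Mid - A.m A.L ≤ A.R by omega)]
    refine sum_congr rfl fun c hc => if_congr ?_ rfl rfl
    rw [tab _ (index_lt (mem_range.1 hc) h.Mid_lt)]
    simp only [ite_eq_right_iff, one_ne_zero, imp_false, Tab, index_div h.Mid_lt,
      index_mod h.Mid_lt, h.Mid_half, hf3, true_and, and_true]
    omega
  have hfB : A.f A.L A.Mid ≤ A.B := hf3.trans (A.le_pow L_Q (by norm_num))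
  refine Within.seq ((within_sumFold hC h1.bd (x := 1) (by norm_num) (by norm_num) (by decide)
    (by decide) (by decide) (m' := A.R) (v := A.f A.L A.Mid)
    (t := fun c => if s.arr 10 (c * A.Z + A.Mid) = 0 then 1 else 0)
    (by simp [h1.regs, hr7]) (fun i j hj acc => by simp [h1.regs, h1.arrs, hr5])
    (fun i => ?_) (A.le_pow h.R_Q (by norm_num)) (by rw [hval]; omega) hfB
    (by omega)).mono hUL fun _ h => h) fun s2 h2 => ?_
  · simp [h1.regs, r18, hval]
    omega
  have q2 : ∀ y < 100, y < 10 ∨ 15 ≤ y → y ≠ 1 → y ≠ 22 → s2.reg y = s.reg y :=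
    fun y hy hy' g1 g22 => by rw [h2.regs y hy hy', if_neg g1, h1.regs y hy hy', if_neg g22]
  have e2 : A.Back s2 := by
    refine ⟨⟨?_, ?_, ?_, ?_, ?_, ?_, ?_, ?_, ?_, ?_, ?_⟩, ?_, ?_, ?_, ?_, by simp [h2.regs], h2.bd⟩
    any_goals rw [q2 _ (by norm_num) (by norm_num) (by norm_num) (by norm_num)]; assumption
    all_goals rw [h2.arrs, h1.arrs]
    exacts [he.chars.a5, he.a19, a17, a15]
  refine Within.seq ((within_sto hC h2.bd 16 (m := A.L * A.Z + A.Mid) (v := 1) (by decide) (by decide)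
    (by simp [h2.regs, h1.regs, r16, hr5]) (by simp) h1B hU).mono hUL fun _ h => h) fun s3 h3 => ?_
  obtain ⟨⟨r3, a3⟩, b3⟩ := h3
  have v3 : ∀ c, s3.arr 16 c = if c = A.L * A.Z + A.Mid then 1 else 0 := fun c => by
    rw [a3, h2.arrs, h1.arrs, he.a16]; simp
  have e3 : A.Back s3 := e2.congr (fun y hy _ _ => r3 y hy) (fun b hb => by
    ext c; rw [a3, if_neg (by omega)]) b3
  refine Within.seq (within_backs h hC ⟨e3, ?_, fun c hc => ?_, ?_⟩) fun s4 h4 =>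
    (within_result h hC h4).mono hUL fun _ h => h
  · rw [r3 _ (by norm_num), q2 _ (by norm_num) (by norm_num) (by norm_num) (by norm_num), r16]
  · rw [v3, if_neg (by omega)]
  · refine h.mult_top.congr fun x _ => ?_
    rw [v3]; simp

end Setup

end NDColoring

namespace NDColoring

/-! ### The result of the program -/

namespace Setup

open Finset Program

variable {k : ℕ} {A : Setup k} {s : State} {W : ℕ} {μ : ℕ → ℕ}

theorem within_main (h : A.Good) (hbin : A.IsBin) (hC : Cap W A.B 64) (hD : A.D = base k)
    (hL : A.L = Nat.clog 2 (4 * A.n * A.R + 1)) (hs : s.Bd A.B) (h0 : s.reg 0 = k)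
    (hreg : ∀ x ≠ 0, s.reg x = 0) (hn : ∑ i ∈ range k, s.arr 0 i = A.n)
    (hb : ∀ i < k, (if s.arr 1 (i * k + i) = 0 then 1 else s.arr 0 i) = A.b i)
    (hadj : ∀ i j : Fin k, A.T.Adj i j → s.arr 1 (i * k + j) = 1)
    (hadj' : ∀ i j : Fin k, ¬ A.T.Adj i j → s.arr 1 (i * k + j) = 0)
    (h16 : ∀ m, s.arr 16 m = 0) :
    Within W (A.U * (A.L + 1)) main s fun s' => ∃ μ, A.Mult 0 μ ∧ A.Result μ s' := by
  classical
  have hUL : A.U ≤ A.U * (A.L + 1) := Nat.le_mul_of_pos_right _ (by omega)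
  refine Within.seq (within_param h hC hD hL hs h0 hreg hn)
    fun s1 ⟨hr, r16, r18, r21, a1, b1⟩ => ?_
  refine Within.seq ((within_chars h hC hr b1 (by rwa [a1])).mono hUL fun _ h => h)
    fun s2 ⟨hc2, b2, q2, a2, a2'⟩ => ?_
  refine Within.seq ((within_marks h hC (hr.congr fun y hy hy' _ => q2 y hy hy') b2 hc2
    (fun i j => ?_) (by rwa [a2', a1])).mono hUL fun _ h => h) fun s3 ⟨e3, q3, t3⟩ => ?_
  · rw [a2, a1]
    split_ifs with hij
    exacts [hadj i j hij, hadj' i j hij]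
  refine Within.seq (within_levels h hbin hC ⟨e3, ?_, ?_, ?_, fun X hX => ?_, fun l hl => ?_,
    fun l hl => ?_⟩) fun s4 h4 => within_output h hC h4
  · rw [q3 _ (by norm_num) (by norm_num), q2 _ (by norm_num) (by norm_num), r16]
  · rw [q3 _ (by norm_num) (by norm_num), q2 _ (by norm_num) (by norm_num), r18, h.m_zero]
  · rw [q3 _ (by norm_num) (by norm_num), q2 _ (by norm_num) (by norm_num), r21, Nat.sub_zero]
  · rw [t3 X hX]
  · omega
  · omega

lemma Good.vec_zero (h : A.Good) (x : ℕ) (i : Fin k) : A.vec 0 x i = (dig A.D i x : ℤ) - A.H := by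
  have hb : A.b i / 2 ^ (A.L - 0) = 0 := by
    by_contra hcon
    have := h.big (Nat.zero_le _) ⟨i, i.2, hcon⟩
    have := h.k_H_le
    omega
  simp only [vec, hb]
  push_cast
  ring

lemma length_palette (s : State) (k : ℕ) :
    (s.palette k).length = ∑ x ∈ range (s.reg 0), s.arr 2 x := by
  simp only [State.palette, List.length_flatMap, List.length_replicate]
  rfl

lemma countP_palette (s : State) (i : Fin k) : (s.palette k).countP (i ∈ ·) =
    ∑ x ∈ range (s.reg 0), if s.arr 3 (x * k + i) ≠ 0 then s.arr 2 x else 0 := by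
  simp only [State.palette, List.countP_flatMap]
  change _ = (Multiset.map _ _).sum
  rw [← Multiset.sum_coe, ← Multiset.map_coe]
  congr 1
  refine Multiset.map_congr rfl fun x _ => ?_
  rw [Function.comp_apply, List.countP_replicate]
  simp

/-- Every vector that receives colors has a positive entry and hence cost at least `1`, so the
number of colors is bounded by the total cost. -/
lemma Result.length_le (h : A.Good) (hμ : A.Mult 0 μ) (hr : A.Result μ s) :
    (s.palette k).length ≤ A.f A.L A.Mid := by
  rw [length_palette, hr.r0]
  refine (sum_le_sum fun x hx => ?_).trans hμ.cost
  rw [hr.a2 x (mem_range.1 hx)]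
  split_ifs with hc
  · obtain ⟨i, hi, hc⟩ := hc
    refine Nat.le_mul_of_pos_right _ (Nat.pos_of_ne_zero fun h0 => ?_)
    have := cn_eq_zero_iff.1 h0 ⟨i, hi⟩
    rw [h.vec_zero] at this
    simp only at this
    omega
  · exact Nat.zero_le _

/-- Vectors at level `0` have entries at most `1`, so each entry is bounded by the indicator of
being positive; with multiplicities the entries add up to the demand. -/
lemma Result.le_countP (h : A.Good) (hμ : A.Mult 0 μ) (hr : A.Result μ s) (i : Fin k) :
    A.b i ≤ (s.palette k).countP (i ∈ ·) := by
  rw [countP_palette, hr.r0]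
  rw [← Nat.cast_le (α := ℤ), ← hμ.vec i, Nat.cast_sum]
  refine sum_le_sum fun x hx => ?_
  have hx := mem_range.1 hx
  have h3 := hr.a3 x hx i i.2
  rw [hr.a2 x hx, h.vec_zero]
  by_cases hc : A.H < dig A.D i x
  · rw [if_pos (h3.2 hc), if_pos ⟨i, i.2, hc⟩]
    by_cases h0 : μ x = 0
    · simp [h0]
    · have h1 := (cn_le_one_iff.1 (hμ.ok x hx h0).2).1 i
      rw [h.vec_zero] at h1
      nlinarith
  · rw [if_neg (mt h3.1 hc)]
    exact mul_nonpos_of_nonneg_of_nonpos (by positivity) (by omega)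

lemma Result.isIndep (h : A.Good) (hμ : A.Mult 0 μ) (hr : A.Result μ s) :
    ∀ S ∈ s.palette k, A.T.IsIndep S := by
  intro S hS
  simp only [State.palette, List.mem_flatMap, List.mem_range, List.mem_replicate, hr.r0] at hS
  obtain ⟨x, hx, hne, rfl⟩ := hS
  rw [hr.a2 x hx] at hne
  have h0 : μ x ≠ 0 := fun h0 => by simp [h0] at hne
  intro i hi j hj hij
  rw [mem_filter, hr.a3 x hx _ (Fin.is_lt _)] at hi hj
  refine (cn_le_one_iff.1 (hμ.ok x hx h0).2).2 i j hij ?_ ?_ <;> rw [h.vec_zero] <;> omega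

end Setup

/-! ### Application to the type graph of a decomposition -/

section Solution

open Finset Setup
open scoped Classical

variable {V : Type u} {G : SimpleGraph V} {k : ℕ}

lemma input_adj (T : TypeGraph k) (i j : Fin k) :
    T.input.arr 1 (i * k + j) = if T.Adj i j then 1 else 0 := by
  simp only [TypeGraph.input, one_ne_zero, if_false, if_true]
  refine if_congr ⟨?_, fun h => ⟨i, j, rfl, h⟩⟩ rfl rfl
  rintro ⟨i', j', h, hadj⟩
  have h1 := index_div (y := i) j.2
  have h2 := index_mod (y := i) j.2
  rw [h, index_div j'.2] at h1
  rw [h, index_mod j'.2] at h2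
  rwa [← Fin.ext h1, ← Fin.ext h2]

lemma input_bd (T : TypeGraph k) {B : ℕ} (h1 : 1 ≤ B) (hk : k ≤ B) (hn : ∑ i, T.weight i ≤ B) :
    T.input.Bd B := by
  refine ⟨fun x _ => ?_, fun a m => ?_⟩ <;> simp only [TypeGraph.input]
  · split_ifs <;> omega
  · split_ifs
    · exact (single_le_sum (f := T.weight) (fun _ _ => Nat.zero_le _) (mem_univ _)).trans hn
    all_goals omega

lemma NDDecomposition.ofType_b (D : NDDecomposition G k) (i : Fin k) :
    (ofType D.typeGraph).b i = D.demand i := by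
  simp only [ofType, i.2, dif_pos, NDDecomposition.typeGraph, if_true, demand]

variable [Fintype V]

lemma NDDecomposition.ofType_n (D : NDDecomposition G k) :
    (ofType D.typeGraph).n = Fintype.card V := D.sum_ncard

lemma NDDecomposition.f_Mid (D : NDDecomposition G k) (h : (ofType D.typeGraph).Good) :
    ((ofType D.typeGraph).f (ofType D.typeGraph).L (ofType D.typeGraph).Mid : ℕ∞) =
      G.chromaticNumber := by
  rw [D.chromaticNumber_eq, Setup.f]
  congr 2
  funext i
  rw [h.vec_Mid, D.ofType_b]

lemma NDDecomposition.solved [LinearOrder V] (D : NDDecomposition G k)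
    (h : (ofType D.typeGraph).Good) {μ : ℕ → ℕ} {s : State} (hμ : (ofType D.typeGraph).Mult 0 μ)
    (hr : (ofType D.typeGraph).Result μ s) : D.Solved s := by
  have hc : ∀ i, D.demand i ≤ (s.palette k).countP (i ∈ ·) := fun i => by
    rw [← D.ofType_b]
    exact hr.le_countP h hμ i
  refine ⟨?_, fun v => ?_, fun u v huv => D.decode_ne hc (hr.isIndep h hμ) huv⟩
  · rw [hr.r1, D.f_Mid h]
  · rw [hr.r1]
    exact (D.decode_lt hc v).trans_le (hr.length_le h hμ)

theorem NDDecomposition.within_main [LinearOrder V] (D : NDDecomposition G k) (hk : 1 ≤ k) {W : ℕ}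
    (hC : Cap W (ofType D.typeGraph).B 64) :
    Within W ((ofType D.typeGraph).U * ((ofType D.typeGraph).L + 1)) Program.main
      D.typeGraph.input D.Solved := by
  have h : (ofType D.typeGraph).Good := ofType_good _ hk D.one_le_ncard
  have hw : ∀ i : Fin k, D.typeGraph.input.arr 0 i = D.typeGraph.weight i := fun i => by
    simp [TypeGraph.input]
  refine Within.mono (Setup.within_main h (ofType_isBin _) hC (ofType_D _) (ofType_L _)
    (input_bd _ ?_ ?_ ?_) rfl (fun x hx => if_neg hx) ?_ (fun i hi => ?_) (fun i j hij => ?_)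
    (fun i j hij => ?_) (fun m => by simp [TypeGraph.input])) le_rfl
    fun s ⟨μ, hμ, hr⟩ => D.solved h hμ hr
  · exact le_pow (lit_Q (x := 1) (by norm_num)) (by norm_num)
  · exact le_pow k_Q (by norm_num)
  · exact le_pow (n_Q (A := ofType D.typeGraph)) (p := 1) (by norm_num)
  · rw [← Fin.sum_univ_eq_sum_range]
    exact sum_congr rfl fun i _ => hw i
  · have h1 := input_adj D.typeGraph ⟨i, hi⟩ ⟨i, hi⟩
    have h2 := hw ⟨i, hi⟩
    simp only at h1 h2
    rw [h1, h2]
    simp only [ofType, hi, dif_pos]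
    split_ifs <;> simp_all
  · exact (input_adj _ i j).trans (if_pos hij)
  · exact (input_adj _ i j).trans (if_neg hij)

end Solution

end NDColoring

namespace NDColoring

/-! ### The running time and the word size -/

namespace Setup

open Finset

variable {k : ℕ}

lemma base_ge (k : ℕ) : 16 ≤ base k := by
  obtain ⟨d, h1, -, h3, -⟩ := base_spec k
  rw [h3]
  exact (Nat.pow_le_pow_right (by norm_num) h1 : 2 ^ 4 ≤ 2 ^ d)

/-- The search overshoots by at most one doubling, hence `640 = 2 * 320`; the initial value `16` is
below this bound. -/
lemma base_pow_le (hk : 1 ≤ k) : base k ^ 16 ≤ 640 ^ 16 * k ^ 9 := by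
  obtain ⟨d, -, -, h3, h4, -⟩ := base_spec k
  rw [h3]
  rcases h4 with rfl | h4
  · exact (by norm_num : (2 ^ 4) ^ 16 ≤ 640 ^ 16 * 1).trans (Nat.mul_le_mul_left _ (Nat.one_le_pow _ _ hk))
  · refine h4.trans (le_of_eq ?_)
    rw [← mul_assoc]
    norm_num

lemma base_le (hk : 1 ≤ k) : base k ≤ 640 * k := by
  refine le_of_pow_le_pow_left₀ (n := 16) (by norm_num) (by omega) ((base_pow_le hk).trans ?_)
  rw [mul_pow]
  exact Nat.mul_le_mul_left _ (Nat.pow_le_pow_right hk (by norm_num))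

/-- Used to absorb factors exponential in `k` into `k ^ k`. -/
lemma pow_le_pow_self (a k : ℕ) (ha : 1 ≤ a) : a ^ k ≤ a ^ a * k ^ k := by
  rcases Nat.eq_zero_or_pos k with rfl | hk
  · simpa using Nat.one_le_pow _ _ ha
  rcases le_total a k with h | h
  · exact (Nat.pow_le_pow_left h k).trans (Nat.le_mul_of_pos_left _ (Nat.pow_pos ha))
  · exact (Nat.pow_le_pow_right ha h).trans (Nat.le_mul_of_pos_right _ (Nat.pow_pos hk))

/-- The base is of order `k ^ (9/16)` and the exponent about `5 * k / 3`, so the main factor is `k ^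
(15 * k / 16)`. The power `48 = 3 * 16` clears both denominators and turns it into `k ^ (45 * k)`;
of the `3 * k` left up to `48 * k`, one `k ^ k` absorbs everything exponential in `k`. -/
lemma exists_base_pow_le :
    ∃ c, ∀ k, 1 ≤ k → k ^ 3 * base k ^ (2 * k - k / 3 + 3) ≤ c * k ^ k := by
  obtain ⟨a, ha, ha1⟩ : ∃ a, a = 640 ^ 80 * 2 ^ 243 ∧ 1 ≤ a :=
    ⟨_, rfl, Nat.mul_pos (Nat.pow_pos (by norm_num)) (Nat.pow_pos (by norm_num))⟩
  obtain ⟨b, hb, hb1⟩ : ∃ b, b = 640 ^ 176 ∧ 1 ≤ b := ⟨_, rfl, Nat.pow_pos (by norm_num)⟩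
  refine ⟨b * a ^ a, fun k hk => ?_⟩
  have hc : 1 ≤ b * a ^ a := Nat.mul_pos hb1 (by positivity)
  refine le_of_pow_le_pow_left₀ (n := 48) (by norm_num) (by positivity) ?_
  have hD : 1 ≤ base k := (by norm_num : 1 ≤ 16).trans (base_ge k)
  calc (k ^ 3 * base k ^ (2 * k - k / 3 + 3)) ^ 48
      = k ^ 144 * base k ^ (48 * (2 * k - k / 3 + 3)) := by
        rw [mul_pow, ← pow_mul, ← pow_mul, mul_comm 48]
    -- The rounding of `k / 3` loses at most `2 / 3`, which is included in the constant `11`.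
    _ ≤ k ^ 144 * base k ^ (16 * (5 * k + 11)) :=
        Nat.mul_le_mul_left _ (Nat.pow_le_pow_right hD (by omega))
    _ ≤ k ^ 144 * (640 ^ 16 * k ^ 9) ^ (5 * k + 11) := by
        rw [pow_mul]
        exact Nat.mul_le_mul_left _ (Nat.pow_le_pow_left (base_pow_le hk) _)
    _ = 640 ^ 176 * (640 ^ 80) ^ k * k ^ 243 * k ^ (45 * k) := by
        rw [mul_pow, ← pow_mul, ← pow_mul, ← pow_mul, show 16 * (5 * k + 11) = 176 + 80 * k by ring,
          show 9 * (5 * k + 11) = 99 + 45 * k by ring, pow_add, pow_add,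
          show 243 = 144 + 99 by norm_num, pow_add k 144]
        ac_rfl
    -- The polynomial factor becomes exponential through `k ≤ 2 ^ k`.
    _ ≤ 640 ^ 176 * (640 ^ 80) ^ k * (2 ^ k) ^ 243 * k ^ (45 * k) :=
        Nat.mul_le_mul_right _ (Nat.mul_le_mul_left _
          (Nat.pow_le_pow_left Nat.lt_two_pow_self.le _))
    _ = b * a ^ k * k ^ (45 * k) := by
        rw [ha, hb, mul_pow, ← pow_mul 2, mul_comm k, pow_mul 2, mul_assoc (640 ^ 176)]
    _ ≤ b * (a ^ a * k ^ k) * k ^ (45 * k) := by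
        gcongr
        exact pow_le_pow_self a k ha1
    _ = b * a ^ a * k ^ (46 * k) := by
        rw [show 46 * k = k + 45 * k by ring, pow_add]
        ac_rfl
    _ ≤ (b * a ^ a) ^ 48 * k ^ (48 * k) :=
        Nat.mul_le_mul (Nat.le_self_pow (by norm_num) _) (Nat.pow_le_pow_right hk (by omega))
    _ = (b * a ^ a * k ^ k) ^ 48 := by rw [mul_pow _ (k ^ k), ← pow_mul k, mul_comm k]

variable (T : TypeGraph k)

lemma R_le (hk : 1 ≤ k) : (ofType T).R ≤ 2 * (k * base k) := by
  have h1 := Nat.mul_le_mul hk (base_ge k)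
  rw [ofType_R]
  omega

/-- The additional factor is the one by which `L + 1` exceeds `log n` in `L_le`. -/
lemma U_le (hk : 1 ≤ k) : (ofType T).U * (4 * (ofType T).R + 4) ≤
    384 * (k ^ 3 * base k ^ (2 * k - k / 3 + 3)) := by
  have hR := R_le T hk
  have h2 := (ofType T).R_pos
  have hU : (ofType T).U = 8 * (ofType T).R ^ 2 * base k ^ (2 * k - k / 3) := by
    have : 2 * k - k / 3 = (k - 2 * (k / 3)) + (k - 2 * (k / 3)) + (k / 3 + k / 3 + k / 3) := by omega
    rw [this, pow_add, pow_add, pow_add, pow_add, U, P, N, ofType_D]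
    simp only [kap]
    ring
  calc _ ≤ 8 * (ofType T).R ^ 2 * base k ^ (2 * k - k / 3) * (6 * (ofType T).R) := by
        rw [hU]; exact Nat.mul_le_mul_left _ (by omega)
    _ = 48 * (ofType T).R ^ 3 * base k ^ (2 * k - k / 3) := by ring
    _ ≤ 48 * (2 * (k * base k)) ^ 3 * base k ^ (2 * k - k / 3) := by gcongr
    _ = _ := by rw [pow_add]; ring

lemma clog_mul_le (m n : ℕ) : Nat.clog 2 (m * n) ≤ Nat.clog 2 m + Nat.clog 2 n :=
  Nat.clog_le_of_le_pow (by
    rw [pow_add]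
    exact Nat.mul_le_mul (Nat.le_pow_clog (by norm_num) _) (Nat.le_pow_clog (by norm_num) _))

/-- Since `log n ≥ 1`, the additive term can be turned into a factor. Bounding the logarithm of `4 *
R + 1` by the number itself is wasteful but only costs a factor polynomial in `k`. -/
lemma L_le (hn : 2 ≤ (ofType T).n) : (((ofType T).L + 1 : ℕ) : ℝ) ≤
    ((4 * (ofType T).R + 4 : ℕ) : ℝ) * Real.logb 2 (ofType T).n := by
  have h1 : 1 ≤ Real.logb 2 (ofType T).n := by
    rw [Real.le_logb_iff_rpow_le (by norm_num) (by positivity)]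
    simpa using (Nat.cast_le (α := ℝ)).2 hn
  have h2 : (ofType T).L ≤ Nat.clog 2 (ofType T).n + (4 * (ofType T).R + 1) := by
    rw [ofType_L]
    refine (Nat.clog_mono_right 2 (m := (ofType T).n * (4 * (ofType T).R + 1)) ?_).trans
      ((clog_mul_le _ _).trans (Nat.add_le_add_left
        (Nat.clog_le_of_le_pow Nat.lt_two_pow_self.le) _))
    nlinarith
  have h3 : (Nat.clog 2 (ofType T).n : ℝ) ≤ Real.logb 2 (ofType T).n + 1 := by
    have := Real.natCeil_logb_natCast 2 (ofType T).n
    rw [← this]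
    exact (Nat.ceil_lt_add_one (by push_cast; linarith)).le
  have h4 : (((ofType T).L + 1 : ℕ) : ℝ) ≤ Nat.clog 2 (ofType T).n + (4 * (ofType T).R + 1) + 1 := by
    exact_mod_cast Nat.add_le_add_right h2 1
  have h5 : (0 : ℝ) ≤ (ofType T).R := Nat.cast_nonneg _
  push_cast at h4 ⊢
  nlinarith

lemma Q_le (hk : 1 ≤ k) (hn : 2 ≤ (ofType T).n) (hkn : k ≤ (ofType T).n) :
    (ofType T).Q ≤ ((ofType T).n * k ^ k) ^ 7100 := by
  obtain ⟨w, hw⟩ : ∃ w, w = (ofType T).n * k ^ k := ⟨_, rfl⟩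
  rw [← hw]
  have hkk : 1 ≤ k ^ k := Nat.one_le_pow _ _ hk
  have hnw : (ofType T).n ≤ w := by rw [hw]; exact Nat.le_mul_of_pos_right _ hkk
  have hw2 : 2 ≤ w := hn.trans hnw
  have hkw : k ≤ w := hkn.trans hnw
  have hkkw : k ^ k ≤ w := by rw [hw]; exact Nat.le_mul_of_pos_left _ (by omega)
  -- For `k = 1` the factor `2` is provided by `n`, and otherwise by `k ^ k`.
  have h2k : 2 ^ k ≤ w := by
    rcases Nat.lt_or_ge k 2 with h | h
    · obtain rfl : k = 1 := by omega
      simpa using hw2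
    · exact (Nat.pow_le_pow_left h k).trans hkkw
  have mono : ∀ {p q : ℕ}, p ≤ q → w ^ p ≤ w ^ q := fun h => Nat.pow_le_pow_right (by omega) h
  have two : ∀ p, 2 ^ p ≤ w ^ p := fun p => Nat.pow_le_pow_left hw2 p
  have hD : (ofType T).D ≤ 2 ^ 10 * k := by
    rw [ofType_D]; exact (base_le hk).trans (by omega)
  have hD1 : 1 ≤ (ofType T).D := by
    rw [ofType_D]; exact (by norm_num : 1 ≤ 16).trans (base_ge k)
  have hDw : (ofType T).D ≤ w ^ 11 := by
    refine hD.trans ?_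
    rw [pow_succ]
    exact Nat.mul_le_mul (two 10) hkw
  have hZ : (ofType T).D ^ k ≤ w ^ 11 := by
    refine (Nat.pow_le_pow_left hD k).trans ?_
    rw [mul_pow, ← pow_mul, mul_comm 10, pow_mul, pow_succ w]
    exact Nat.mul_le_mul (Nat.pow_le_pow_left h2k 10) hkkw
  have hR : (ofType T).R ≤ w ^ 13 := by
    refine (R_le T hk).trans ?_
    rw [← ofType_D T]
    calc 2 * (k * (ofType T).D) ≤ w * (w * w ^ 11) := by gcongr
      _ = w ^ 13 := by ring
  have hP : (ofType T).P ≤ w ^ 24 := by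
    calc (ofType T).P ≤ w ^ 13 * w ^ 11 := Nat.mul_le_mul hR
          ((Nat.pow_le_pow_right hD1 (Nat.sub_le _ _)).trans hZ)
      _ = w ^ 24 := by rw [← pow_add]
  -- The exponent of the modulus is at most `642 * k` and `D ^ k ≤ w ^ 11`, which gives `7062 = 11 *
  -- 642`; one more factor pays for the added `1`.
  have hM : (ofType T).M ≤ w ^ 7063 := by
    have h1 : (ofType T).rr ≤ k * 642 := by
      have h1 := rr_le (A := ofType T)
      have h2 := base_le hk
      rw [ofType_D] at h1
      omega
    have h2 : (ofType T).D ^ (ofType T).rr ≤ w ^ 7062 := by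
      refine (Nat.pow_le_pow_right hD1 h1).trans ?_
      rw [pow_mul, show 7062 = 11 * 642 by norm_num, pow_mul w]
      exact Nat.pow_le_pow_left hZ _
    have h3 : 1 ≤ w ^ 7062 := Nat.one_le_pow _ _ (by omega)
    have h4 : w ^ 7062 * 2 ≤ w ^ 7063 := by
      rw [pow_succ]; exact Nat.mul_le_mul_left _ hw2
    unfold M
    omega
  have hL : 2 ^ (ofType T).L ≤ w ^ 18 := by
    have hR1 := (ofType T).R_pos
    have h1 : 1 < 4 * (ofType T).n * (ofType T).R + 1 := by
      have : 0 < 4 * (ofType T).n * (ofType T).R := by positivity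
      omega
    have h2 := Nat.pow_pred_clog_lt_self (b := 2) (by norm_num) h1
    have h3 : 1 ≤ Nat.clog 2 (4 * (ofType T).n * (ofType T).R + 1) := Nat.clog_pos (by norm_num) h1
    have h4 : 2 ^ (ofType T).L = 2 * 2 ^ (ofType T).L.pred := by
      rw [← ofType_L] at h3
      rw [← pow_succ', Nat.pred_eq_sub_one, Nat.sub_add_cancel h3]
    rw [← ofType_L] at h2
    calc 2 ^ (ofType T).L ≤ 2 ^ 4 * ((ofType T).n * (ofType T).R) := by nlinarith
      _ ≤ w ^ 4 * (w * w ^ 13) := Nat.mul_le_mul (two 4) (Nat.mul_le_mul hnw hR)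
      _ = w ^ 18 := by ring
  have e1 : w ^ 11 ≤ w ^ 7063 := mono (by norm_num)
  have e2 : w ^ 24 ≤ w ^ 7063 := mono (by norm_num)
  have e3 : w ^ 18 ≤ w ^ 7063 := mono (by norm_num)
  have e4 : w ^ 6 ≤ w ^ 7063 := mono (by norm_num)
  have e5 : w ≤ w ^ 7063 := Nat.le_self_pow (by norm_num) w
  have e6 : 64 ≤ w ^ 6 := two 6
  have e7 : (ofType T).Z = (ofType T).D ^ k := rfl
  have e8 : (ofType T).Q ≤ 8 * w ^ 7063 := by
    unfold Q
    generalize 2 ^ (ofType T).L = t at *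
    generalize w ^ 7063 = t' at *
    omega
  calc (ofType T).Q ≤ 2 ^ 3 * w ^ 7063 := e8
    _ ≤ w ^ 3 * w ^ 7063 := Nat.mul_le_mul_right _ (two 3)
    _ = w ^ (3 + 7063) := by rw [← pow_add]
    _ ≤ w ^ 7100 := mono (by norm_num)

/-- The exponent combines `7100` from the parameters, `12` from the bound on stored numbers, and
`300` from the intermediate values of expressions. All larger exponents are allowed, as one constant
has to serve time and word size together. -/
lemma exists_cap : ∃ c, ∀ {k : ℕ} (T : TypeGraph k), 1 ≤ k → 2 ≤ (ofType T).n → k ≤ (ofType T).n →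
    ∀ c' ≥ c, Cap (((ofType T).n * k ^ k) ^ c') (ofType T).B 64 := by
  obtain ⟨c, hc⟩ : ∃ c, c = 7100 * (12 * 300) + 1 := ⟨_, rfl⟩
  refine ⟨c, fun {k} T hk hn hkn c' hc' => ?_⟩
  have h64 : 64 ≤ (ofType T).B := le_pow (lit_Q le_rfl) (by norm_num)
  have hw : 2 ≤ (ofType T).n * k ^ k :=
    hn.trans (Nat.le_mul_of_pos_right _ (Nat.one_le_pow _ _ hk))
  refine ⟨by omega, h64, ?_⟩
  rw [B, ← pow_mul]
  calc _ ≤ (((ofType T).n * k ^ k) ^ 7100) ^ (12 * 300) := Nat.pow_le_pow_left (Q_le T hk hn hkn) _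
    _ = ((ofType T).n * k ^ k) ^ (7100 * (12 * 300)) := by rw [← pow_mul]
    _ < ((ofType T).n * k ^ k) ^ c' := Nat.pow_lt_pow_right (by omega) (by omega)

end Setup

end NDColoring

/-! ### The theorem -/

theorem mainTheorem1 :
    (∃ (p : NDColoring.Prog) (c : ℕ),
      ∀ (V : Type u) [Fintype V] [LinearOrder V] (G : SimpleGraph V)
        (k : ℕ) (_ : k = NDColoring.nd G) (D : NDColoring.NDDecomposition G k),
        2 ≤ Fintype.card V →
        ∃ (t : ℕ) (s : NDColoring.State),
          NDColoring.Exec ((Fintype.card V * k ^ k) ^ c) p D.typeGraph.input t s ∧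
          (t : ℝ) ≤ c * (Real.sqrt k) ^ (2 * k) * Real.logb 2 (Fintype.card V) ∧
          D.Solved s) ∧
    (∀ (V : Type u) [Fintype V] (G : SimpleGraph V)
        (k : ℕ) (_ : k = NDColoring.nd G) (D : NDColoring.NDDecomposition G k),
        IsLeast D.ipValues G.chromaticNumber) := by
  refine ⟨?_, fun V _ G k _ D => D.isLeast_ipValues⟩
  obtain ⟨c₁, h₁⟩ := NDColoring.Setup.exists_base_pow_le
  obtain ⟨c₂, h₂⟩ := NDColoring.Setup.exists_cap
  obtain ⟨ℓ, hℓ⟩ : ∃ ℓ, ℓ = 60 * NDColoring.Program.main.len * 384 * c₁ := ⟨_, rfl⟩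
  -- One constant must bound both the running time, for which `ℓ` suffices, and the exponent of the
  -- word size, for which `c₂` suffices.
  refine ⟨NDColoring.Program.main, ℓ + c₂, fun V _ _ G k _ D hV => ?_⟩
  have hk : 1 ≤ k := by
    obtain ⟨v⟩ : Nonempty V := Fintype.card_pos_iff.1 (by omega)
    exact (Nat.zero_le _).trans_lt (D.part v).2
  have hkn : k ≤ Fintype.card V := by
    simpa using Fintype.card_le_of_surjective D.part D.surj
  have hn := D.ofType_n
  rw [← hn] at hV hkn
  obtain ⟨t, s, hE, ht, hS⟩ := D.within_main hk (h₂ D.typeGraph hk hV hkn (ℓ + c₂) (by omega))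
  rw [hn] at hE hV
  refine ⟨t, s, hE, ?_, hS⟩
  have hpow : Real.sqrt k ^ (2 * k) = (k : ℝ) ^ k := by
    rw [pow_mul, Real.sq_sqrt (Nat.cast_nonneg _)]
  have hlog : 0 ≤ Real.logb 2 (Fintype.card V) :=
    Real.logb_nonneg (by norm_num) (by exact_mod_cast (show 1 ≤ Fintype.card V by omega))
  have hL := NDColoring.Setup.L_le D.typeGraph (by rwa [hn])
  rw [hn] at hL
  have hU := (NDColoring.Setup.U_le D.typeGraph hk).trans (Nat.mul_le_mul_left 384 (h₁ k hk))
  rw [hpow]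
  generalize NDColoring.Setup.ofType D.typeGraph = A at *
  calc (t : ℝ) ≤ (60 * NDColoring.Program.main.len * (A.U * (A.L + 1)) : ℕ) := Nat.cast_le.2 ht
    _ = ((60 * NDColoring.Program.main.len * A.U : ℕ) : ℝ) * ((A.L + 1 : ℕ) : ℝ) := by
        rw [← Nat.cast_mul, mul_assoc _ A.U]
    _ ≤ ((60 * NDColoring.Program.main.len * A.U : ℕ) : ℝ) *
          (((4 * A.R + 4 : ℕ) : ℝ) * Real.logb 2 (Fintype.card V)) :=
        mul_le_mul_of_nonneg_left hL (Nat.cast_nonneg _)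
    _ = ((60 * NDColoring.Program.main.len * (A.U * (4 * A.R + 4)) : ℕ) : ℝ) *
          Real.logb 2 (Fintype.card V) := by
        rw [← mul_assoc, ← Nat.cast_mul, mul_assoc _ A.U]
    _ ≤ ((60 * NDColoring.Program.main.len * (384 * (c₁ * k ^ k)) : ℕ) : ℝ) *
          Real.logb 2 (Fintype.card V) :=
        mul_le_mul_of_nonneg_right (Nat.cast_le.2 (Nat.mul_le_mul_left _ hU)) hlog
    _ = (ℓ * k ^ k : ℕ) * Real.logb 2 (Fintype.card V) := by
        rw [hℓ]
        congr 2
        ring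
    _ ≤ ((ℓ + c₂ : ℕ) : ℝ) * (k : ℝ) ^ k * Real.logb 2 (Fintype.card V) := by
        refine mul_le_mul_of_nonneg_right ?_ hlog
        rw [← Nat.cast_pow, ← Nat.cast_mul]
        exact Nat.cast_le.2 (Nat.mul_le_mul_right _ (Nat.le_add_right _ _))
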